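/- **Conventions.** Let $k$ be an algebraically closed field of characteristic $p>2$, let $r\ge 3$, let $x_1,\dots,x_{r-1}\in k$ be pairwise distinct, $x_r=\infty$, $D=d/dx$ and $P_0=\prod_{i<r}(x-x_i)$. A Fuchsian operator with singularities in $x_1,\dots,x_r$ is $L=D^2+p_1D+p_2$ with $p_1=P_1/P_0$, $p_2=P_2/P_0+P_3/P_0^2$, where $P_1,P_2,P_3\in k[x]$, $\deg P_1\le r-2$, $\deg P_2\le r-3$, $\deg P_3\le r-2$. Its local exponents $\{\rho,\rho'\}$ are given at $x_i\neq\infty$ by $\rho+\rho'=1-P_1(x_i)/P_0'(x_i)$, $\rho\rho'=P_3(x_i)/P_0'(x_i)^2$, and at $\infty$ by $\rho+\rho'=-1+c_1$, $\rho\rho'=c_2$, where $c_1$ (resp. $c_2$) is the coefficient of $x^{r-2}$ in $P_1$ (resp. of $x^{r-3}$ in $P_2$). $L$ has *nilpotent $p$-curvature* if both $L(v)=0$ and $w'+p_1w=0$ have a nonzero polynomial solution; in that case the $p$-curvature is *nonzero* if the polynomial solutions of $L$ form a space of dimension $1$ over $k[x]^p$. $L$ is *normalized* if its monic polynomial solution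 of minimal degree has no zero at $x_1,\dots,x_{r-1}$. A point is *removable* for $L$ if, for some rational function $s\ne0$, the operator whose solutions are $s^{-1}w$, with $w$ a solution of $L$, is regular at that point. A *deformation datum* is a pair $(Z,\omega)$ of a finite Galois cover $Z\to\mathbb P^1_k$ of (connected) smooth projective curves with group $H$ and a meromorphic differential form $\omega\ne 0$ on $Z$ such that $\beta^*\omega=\chi(\beta)\omega$ for all $\beta\in H$, for an injective character $\chi:H\to\mathbb F_p^\times$, and $\omega=df/f$ for some meromorphic function $f$. For $c\in\mathbb P^1(k)$ and any $z\in Z$ above $c$ with stabilizer $H_z$, put $\sigma_c=(\mathrm{ord}_z\omega+1)/|H_z|$. The point $c$ is *supersingular* if $\sigma_c=(p+1)/(p-1)$, a *spike* if $\sigma_c\ne1$ and $\sigma_c\equiv1\pmod p$, and *singular* if it is neither of these and $\sigma_c\neq1$. (Congruences modulo $p$ are those of $\frac1{p-1}\mathbb Z$.) **Proposition.** Let $L=D^2+p_1D+p_2$ be a normalized Fuchsian operator with singularities in $x_1,\dots,x_r=\infty$, with nilpotent but nonzero $p$-curvature. Let $u$ be its monic polynomial solution of minimal degree, $d=\deg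 u$, and let its local exponents be $\{\alpha_i,0\}$ at $x_i$ $(i<r)$ and $\{-d,-d+\alpha_r\}$ at $x_r$. Then $(L,u)$ is attached to a deformation datum $(Z,\omega)$ in the following sense. There are a finite set $B\subset k\setminus\{x_1,\dots,x_{r-1}\}$, integers $0\le a_c<p-1$ and $\nu_c\ge0$ for $c\in\{x_1,\dots,x_r\}\cup B$ (write $a_i=a_{x_i}$, $\nu_i=\nu_{x_i}$), and $\epsilon\in k^\times$ such that: 1. $Z$ is a connected component of the smooth projective curve $$z^{p-1}=\prod_{i<r}(x-x_i)^{a_i}\prod_{c\in B}(x-c)^{a_c}\;u^2 ,$$ that is, its function field is generated over $k(x)$ by such a $z$, and $$\omega=\epsilon\, z\prod_{i<r}(x-x_i)^{\nu_i-1}\prod_{c\in B}(x-c)^{\nu_c-1}\,dx .$$ 2. With $Q=\prod_{i<r}(x-x_i)^{1+a_i-\nu_i}$ we have $p_1=Q'/Q$, and $p_2=P/P_0$ for a polynomial $P$ of degree at most $r-3$ whose coefficient of $x^{r-3}$ is $d(d+a_r-\nu_r)$; moreover $L(u)=0$. 3. $\sigma_{x_i}=\frac{a_i}{p-1}+\nu_i$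 for $1\le i\le r$, and $\alpha_i=\nu_i-a_i$ in $k$, i.e. $\alpha_i\equiv\sigma_{x_i}\pmod p$. Each $x_i$ $(1\le i\le r)$ that is not removable for $L$ is a singular point of $(Z,\omega)$. 4. $u$ has only simple zeros. For $c\in k\setminus\{x_1,\dots,x_{r-1}\}$: $c$ is supersingular if and only if $u(c)=0$ and $c\notin B$; $c$ is a spike if and only if $c\in B$ and $u(c)\ne0$; if $c\notin B$ and $u(c)\neq 0$ then $\sigma_c=1$. For $c\in B$ the number $\tau_c=\frac{a_c}{p-1}+\nu_c$ satisfies $\tau_c\neq1$, $\tau_c\equiv1\pmod p$, and $\sigma_c=\tau_c$ if $u(c)\ne0$, while $\sigma_c=\tau_c+\frac2{p-1}$ if $u(c)=0$. 5. $B$ is the set of those $c\in k\setminus\{x_1,\dots,x_{r-1}\}$ at which $D^{p-1}\frac1{Qu^2}$ vanishes. In particular, if no $x_i$ is removable and $D^{p-1}\frac1{Qu^2}$ does not vanish at any zero of $u$, then $x_1,\dots,x_r$ are exactly the singular points of $(Z,\omega)$, $B$ is its set of spikes, and $u$ is the monic polynomial whose zeros, all simple, are exactly its supersingular points. -/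

import Mathlib

open Polynomial

universe u

noncomputable section

namespace Fuchs

/-! ### Rational functions on the projective line -/

section RationalFunctions

variable {k : Type u} [Field k]

/-- The derivation `D = d/dx` of `k(x)`, by the quotient rule. -/
def ratDeriv (f : RatFunc k) : RatFunc k :=
  (algebraMap k[X] (RatFunc k) (derivative f.num) * algebraMap k[X] (RatFunc k) f.denom
    - algebraMap k[X] (RatFunc k) f.num * algebraMap k[X] (RatFunc k) (derivative f.denom))
    / algebraMap k[X] (RatFunc k) f.denom ^ 2

/-- The linear factor `x - c`, as a rational function. -/
def linFactor (c : k) : RatFunc k := RatFunc.X - RatFunc.C c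

/-- `f` has no pole at the finite point `c` (numerator and denominator are coprime). -/
def RegularAt (f : RatFunc k) (c : k) : Prop := f.denom.eval c ≠ 0

/-- `f` has no pole at `∞`. -/
def RegularAtInfty (f : RatFunc k) : Prop := f.num.natDegree ≤ f.denom.natDegree

/-- `f` vanishes at the finite point `c` (numerator and denominator are coprime). -/
def VanishesAt (f : RatFunc k) (c : k) : Prop := f.num.eval c = 0

end RationalFunctions

/-! ### Fuchsian operators of order two -/

/-- A Fuchsian operator `L = D² + p₁ D + p₂` on the projective line with its singularities in
the points `x₁, …, x_{r-1}` and `x_r = ∞`. With `P₀ = ∏ (x - xᵢ)`, the coefficients are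
`p₁ = P₁ / P₀` and `p₂ = P₂ / P₀ + P₃ / P₀²`. The degree bounds say that `∞` is at most a regular
singularity; `deg P₃ < deg P₀` makes `P₂, P₃` unique. -/
structure FuchsianOperator {k : Type u} [Field k] {r : ℕ} (x : Fin (r - 1) → k) where
  P₁ : k[X]
  P₂ : k[X]
  P₃ : k[X]
  natDegree_P₁ : P₁.natDegree ≤ r - 2
  natDegree_P₂ : P₂.natDegree ≤ r - 3
  natDegree_P₃ : P₃.natDegree ≤ r - 2

namespace FuchsianOperator

variable {k : Type u} [Field k] {r : ℕ} {x : Fin (r - 1) → k}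

/-- `P₀ = ∏_{i < r} (x - xᵢ)`. -/
def P₀ (_L : FuchsianOperator x) : k[X] := ∏ i, (X - C (x i))

/-- The coefficient `p₁` of `L`. -/
def p₁ (L : FuchsianOperator x) : RatFunc k :=
  algebraMap k[X] (RatFunc k) L.P₁ / algebraMap k[X] (RatFunc k) L.P₀

/-- The coefficient `p₂` of `L`. -/
def p₂ (L : FuchsianOperator x) : RatFunc k :=
  algebraMap k[X] (RatFunc k) L.P₂ / algebraMap k[X] (RatFunc k) L.P₀
    + algebraMap k[X] (RatFunc k) L.P₃ / algebraMap k[X] (RatFunc k) L.P₀ ^ 2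

/-- `L(v) = v'' + p₁ v' + p₂ v` for a polynomial `v`. -/
def apply (L : FuchsianOperator x) (v : k[X]) : RatFunc k :=
  algebraMap k[X] (RatFunc k) (derivative (derivative v))
    + L.p₁ * algebraMap k[X] (RatFunc k) (derivative v)
    + L.p₂ * algebraMap k[X] (RatFunc k) v

/-- `L_W(w) = w' + p₁ w` for a polynomial `w`; this is the Wronskian equation of `L`. -/
def wronskianApply (L : FuchsianOperator x) (w : k[X]) : RatFunc k :=
  algebraMap k[X] (RatFunc k) (derivative w) + L.p₁ * algebraMap k[X] (RatFunc k) w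

/-- The local exponents of `L` at `xᵢ ≠ ∞` are `{ρ, ρ'}`. -/
def HasLocalExponentsAt (L : FuchsianOperator x) (i : Fin (r - 1)) (ρ ρ' : k) : Prop :=
  ρ + ρ' = 1 - L.P₁.eval (x i) / (derivative L.P₀).eval (x i) ∧
    ρ * ρ' = L.P₃.eval (x i) / (derivative L.P₀).eval (x i) ^ 2

/-- The local exponents of `L` at `x_r = ∞` are `{ρ, ρ'}`. -/
def HasLocalExponentsAtInfty (L : FuchsianOperator x) (ρ ρ' : k) : Prop :=
  ρ + ρ' = -1 + L.P₁.coeff (r - 2) ∧ ρ * ρ' = L.P₂.coeff (r - 3)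

/-- `L` has nilpotent `p`-curvature: both `L` and its Wronskian equation have a (nonzero)
polynomial solution. -/
def NilpotentPCurvature (L : FuchsianOperator x) : Prop :=
  (∃ v : k[X], v ≠ 0 ∧ L.apply v = 0) ∧ ∃ w : k[X], w ≠ 0 ∧ L.wronskianApply w = 0

/-- The polynomial solutions of `L`, as a module over the ring `k[x]^p` of `p`-th powers. -/
def solutions (p : ℕ) [Fact p.Prime] [CharP k p] (L : FuchsianOperator x) :
    Submodule (frobenius k[X] p).range k[X] where
  carrier := {v | L.apply v = 0}
  zero_mem' := by simp [apply]
  add_mem' := by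
    intro v w hv hw
    have hv' : L.apply v = 0 := hv
    have hw' : L.apply w = 0 := hw
    have h : L.apply (v + w) = L.apply v + L.apply w := by
      simp only [apply, map_add]
      ring
    change L.apply (v + w) = 0
    rw [h, hv', hw', add_zero]
  smul_mem' := by
    rintro ⟨_, g, rfl⟩ v hv
    have hv' : L.apply v = 0 := hv
    have hd : ∀ w : k[X], derivative (g ^ p * w) = g ^ p * derivative w := by
      intro w
      rw [derivative_mul, derivative_pow]
      simp
    have h : L.apply (g ^ p * v) = algebraMap k[X] (RatFunc k) (g ^ p) * L.apply v := by
      simp only [apply, hd, map_mul]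
      ring
    change L.apply (g ^ p * v) = 0
    rw [h, hv', mul_zero]

/-- `L` has nonzero `p`-curvature (`L` being of nilpotent `p`-curvature): the polynomial
solutions form a space of dimension one over `k[x]^p`. -/
def NonzeroPCurvature (p : ℕ) [Fact p.Prime] [CharP k p] (L : FuchsianOperator x) : Prop :=
  Module.finrank (frobenius k[X] p).range (L.solutions p) = 1

/-- `v` is a monic polynomial solution of minimal degree. -/
def IsMinimalSolution (L : FuchsianOperator x) (v : k[X]) : Prop :=
  v.Monic ∧ L.apply v = 0 ∧ ∀ w : k[X], w ≠ 0 → L.apply w = 0 → v.natDegree ≤ w.natDegree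

/-- `L` is normalized: its monic polynomial solution of minimal degree has no zero in the finite
singular points. -/
def IsNormalized (L : FuchsianOperator x) : Prop :=
  ∀ v : k[X], L.IsMinimalSolution v → ∀ i, v.eval (x i) ≠ 0

/-- The coefficient `p₁` of the operator satisfied by `s⁻¹ w`, for `w` running through the
solutions of `L`. -/
def twist₁ (L : FuchsianOperator x) (s : RatFunc k) : RatFunc k :=
  L.p₁ + 2 * ratDeriv s / s

/-- The coefficient `p₂` of the operator satisfied by `s⁻¹ w`, for `w` running through the
solutions of `L`. -/
def twist₂ (L : FuchsianOperator x) (s : RatFunc k) : RatFunc k :=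
  L.p₂ + L.p₁ * ratDeriv s / s + ratDeriv (ratDeriv s) / s

/-- The point `c` can be removed from the singularities of `L` by multiplying all
solutions with one rational function. -/
def IsRemovableAt (L : FuchsianOperator x) (c : k) : Prop :=
  ∃ s : RatFunc k, s ≠ 0 ∧ RegularAt (L.twist₁ s) c ∧ RegularAt (L.twist₂ s) c

/-- The point `∞` can be removed from the singularities of `L` by multiplying all
solutions with one rational function. In the parameter `t = 1/x`, an operator `D² + q₁ D + q₂`
is `(d/dt)² + (2/t - q₁/t²) d/dt + q₂/t⁴`, up to the factor `t⁴`. -/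
def IsRemovableAtInfty (L : FuchsianOperator x) : Prop :=
  ∃ s : RatFunc k, s ≠ 0 ∧
    RegularAtInfty (2 * RatFunc.X - RatFunc.X ^ 2 * L.twist₁ s) ∧
    RegularAtInfty (RatFunc.X ^ 4 * L.twist₂ s)

end FuchsianOperator

/-! ### Differential forms and places of function fields -/

/-- The pullback of differentials along a homomorphism of `k`-algebras:
`a dB ↦ β(a) d(β(b))`. -/
def kaehlerPullback {k A B : Type u} [CommRing k] [CommRing A] [CommRing B] [Algebra k A]
    [Algebra k B] (β : A →ₐ[k] B) : Ω[A⁄k] →+ Ω[B⁄k] :=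
  letI : Algebra A B := β.toRingHom.toAlgebra
  haveI : IsScalarTower k A B := IsScalarTower.of_algebraMap_eq' β.comp_algebraMap.symm
  (KaehlerDifferential.map k k A B).toAddMonoidHom

theorem kaehlerPullback_smul_D {k A B : Type u} [CommRing k] [CommRing A] [CommRing B]
    [Algebra k A] [Algebra k B] (β : A →ₐ[k] B) (a b : A) :
    kaehlerPullback β (a • KaehlerDifferential.D k A b)
      = β a • KaehlerDifferential.D k B (β b) := by
  letI : Algebra A B := β.toRingHom.toAlgebra
  haveI : IsScalarTower k A B := IsScalarTower.of_algebraMap_eq' β.comp_algebraMap.symm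
  change KaehlerDifferential.map k k A B (a • KaehlerDifferential.D k A b) = _
  rw [map_smul, KaehlerDifferential.map_D, algebra_compatible_smul B a]
  rfl

/-- A uniformizer of a valuation ring `P` of `K`: a generator of the maximal ideal. -/
def IsUniformizer {K : Type u} [Field K] (P : ValuationSubring K) (t : K) : Prop :=
  P.valuation t < 1 ∧ ∀ f : K, P.valuation f < 1 → P.valuation f ≤ P.valuation t

/-- The differential form `ω` has order `n` at the place `P`: `ω = tⁿ w dt` for a uniformizer `t`
and a unit `w` of the valuation ring. -/
def HasOrderAt (k : Type u) {K : Type u} [Field k] [Field K] [Algebra k K] (ω : Ω[K⁄k])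
    (P : ValuationSubring K) (n : ℤ) : Prop :=
  ∃ t w : K, IsUniformizer P t ∧ P.valuation w = 1 ∧
    ω = (t ^ n * w) • KaehlerDifferential.D k K t

/-- The place `P` of `K/k` (a closed point of the curve with function field `K`) lies above the
point `c` of the projective line. -/
def LiesAbove {k K : Type u} [Field k] [Field K] [Algebra k K] [Algebra (RatFunc k) K]
    (P : ValuationSubring K) : OnePoint k → Prop
  | some c => (∀ b : k, algebraMap k K b ∈ P) ∧
      P.valuation (algebraMap (RatFunc k) K (linFactor c)) < 1
  | none => (∀ b : k, algebraMap k K b ∈ P) ∧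
      P.valuation (algebraMap (RatFunc k) K RatFunc.X⁻¹) < 1

/-! ### Deformation data -/

/-- A deformation datum of type `(H, χ)` over the projective line. The finite Galois cover
`Z → ℙ¹` of smooth projective curves is given by the extension `K / k(x)` of function fields,
`H = Gal(K / k(x))` is its Galois group, and meromorphic differential forms on `Z` are the
elements of the (one-dimensional) `K`-vector space `Ω[K⁄k]`. -/
structure DeformationDatum (p : ℕ) [Fact p.Prime] (k : Type u) [Field k] [CharP k p] where
  K : Type u
  [field : Field K]
  [algebraBase : Algebra k K]
  [algebra : Algebra (RatFunc k) K]
  [tower : IsScalarTower k (RatFunc k) K]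
  [finite : FiniteDimensional (RatFunc k) K]
  [galois : IsGalois (RatFunc k) K]
  /-- the differential form -/
  ω : Ω[K⁄k]
  ω_ne_zero : ω ≠ 0
  /-- the character by which the Galois group acts on `ω` -/
  χ : (K ≃ₐ[RatFunc k] K) →* (ZMod p)ˣ
  χ_injective : Function.Injective χ
  pullback_eq : ∀ β : K ≃ₐ[RatFunc k] K,
    kaehlerPullback ((β.restrictScalars k : K ≃ₐ[k] K) : K →ₐ[k] K) ω
      = ZMod.castHom (dvd_refl p) k (χ β : ZMod p) • ω
  logarithmic : ∃ f : K, f ≠ 0 ∧ ω = f⁻¹ • KaehlerDifferential.D k K f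

namespace DeformationDatum

attribute [instance] field algebraBase algebra tower finite galois

variable {p : ℕ} [Fact p.Prime] {k : Type u} [Field k] [CharP k p]

/-- `q` is the ramification invariant `σ_c = (ord_z ω + 1) / |H_z|` of the datum at the point `c`
of the projective line, for the points `z` of `Z` above `c`. -/
def IsRamificationInvariant (𝒟 : DeformationDatum p k) (c : OnePoint k) (q : ℚ) : Prop :=
  (∃ P : ValuationSubring 𝒟.K, LiesAbove (k := k) P c) ∧
    ∀ P : ValuationSubring 𝒟.K, LiesAbove (k := k) P c →
      ∃ n : ℤ, HasOrderAt k 𝒟.ω P n ∧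
        q = ((n : ℚ) + 1) / (Nat.card (P.decompositionSubgroup (RatFunc k)) : ℚ)

end DeformationDatum

/-- Congruence modulo `p` of rational numbers in `(1/(p-1)) ℤ`. -/
def RatModEq (p : ℕ) (s t : ℚ) : Prop := ∃ m : ℤ, ((p : ℚ) - 1) * (s - t) = (p : ℚ) * m

/-- The ramification invariant of a supersingular point. -/
def IsSupersingular (p : ℕ) (s : ℚ) : Prop := s = ((p : ℚ) + 1) / ((p : ℚ) - 1)

/-- The ramification invariant of a spike: a critical point with `σ ≡ 1 (mod p)`. -/
def IsSpike (p : ℕ) (s : ℚ) : Prop := s ≠ 1 ∧ RatModEq p s 1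

/-- The ramification invariant of a singularity (of a deformation datum): a critical point which
is neither supersingular nor a spike. -/
def IsSingular (p : ℕ) (s : ℚ) : Prop := s ≠ 1 ∧ ¬ IsSupersingular p s ∧ ¬ RatModEq p s 1

/-! ### The correspondence -/

/-- The rational function `Q = ∏_{i < r} (x - xᵢ)^{1 + aᵢ - νᵢ}`. -/
def wronskianQ {k : Type u} [Field k] {r : ℕ} (x : Fin (r - 1) → k) (a ν : OnePoint k → ℕ) :
    RatFunc k :=
  ∏ i, linFactor (x i) ^ (1 + (a (x i : k) : ℤ) - (ν (x i : k) : ℤ))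

open Classical in
/-- The pair `(L, u)` is the pair attached to the deformation datum `𝒟 = (Z, ω)`, where `σ` is the
family of ramification invariants of `𝒟`, the integers `a, ν` are the invariants of the points
`x₁, …, x_{r-1}, x_r = ∞` and of the points of `B`, `z` is the generator of the function
field of `Z` and `ε` is a constant. -/
structure IsAttachedTo {p : ℕ} [Fact p.Prime] {k : Type u} [Field k] [CharP k p] {r : ℕ}
    {x : Fin (r - 1) → k} (L : FuchsianOperator x) (u : k[X]) (𝒟 : DeformationDatum p k)
    (σ : OnePoint k → ℚ) (a ν : OnePoint k → ℕ) (B : Finset k) (z : 𝒟.K) (ε : k) : Prop where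
  /-- `σ` is the family of ramification invariants. -/
  ramification : ∀ c, 𝒟.IsRamificationInvariant c (σ c)
  a_lt : ∀ c, a c < p - 1
  /-- The points of `B` are none of `x₁, …, x_r`. -/
  disjoint : ∀ i, x i ∉ B
  /-- The invariants `σᵢ = aᵢ / (p - 1) + νᵢ` for `i < r`. -/
  sigma_sing : ∀ i, σ (x i : k) = (a (x i : k) : ℚ) / ((p : ℚ) - 1) + ν (x i : k)
  /-- The invariant `σ_r = a_r / (p - 1) + ν_r` at infinity. -/
  sigma_infty : σ OnePoint.infty
    = (a OnePoint.infty : ℚ) / ((p : ℚ) - 1) + ν OnePoint.infty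
  /-- The numbers `a_c / (p - 1) + ν_c` at the points of `B` are invariants of spikes. -/
  spike : ∀ c ∈ B, IsSpike p ((a (c : k) : ℚ) / ((p : ℚ) - 1) + ν (c : k))
  /-- A point of `B` has this invariant, raised by `2 / (p - 1)` if it is a zero of `u`. -/
  sigma_spike : ∀ c ∈ B, σ (c : k) = (a (c : k) : ℚ) / ((p : ℚ) - 1) + ν (c : k)
    + if u.eval c = 0 then 2 / ((p : ℚ) - 1) else 0
  /-- All other points are noncritical, or supersingular if they are zeros of `u`. -/
  sigma_other : ∀ c : k, (∀ i, x i ≠ c) → c ∉ B →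
    σ (c : k) = if u.eval c = 0 then ((p : ℚ) + 1) / ((p : ℚ) - 1) else 1
  monic : u.Monic
  /-- `u` has only simple zeros. -/
  squarefree : Squarefree u
  /-- Outside `x₁, …, x_r`, the supersingular points are the zeros of `u` outside `B`. -/
  supersingular_iff : ∀ c : k, (∀ i, x i ≠ c) →
    (IsSupersingular p (σ (c : k)) ↔ u.eval c = 0 ∧ c ∉ B)
  /-- Outside `x₁, …, x_r`, the spikes are the points of `B` which are not zeros of `u`. -/
  spike_iff : ∀ c : k, (∀ i, x i ≠ c) → (IsSpike p (σ (c : k)) ↔ c ∈ B ∧ u.eval c ≠ 0)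
  /-- The points `xᵢ ≠ ∞` are singularities of the datum, if they are not removable. -/
  singular : ∀ i, ¬ L.IsRemovableAt (x i) → IsSingular p (σ (x i : k))
  /-- The point `∞` is a singularity of the datum, if it is not removable. -/
  singular_infty : ¬ L.IsRemovableAtInfty → IsSingular p (σ OnePoint.infty)
  /-- `Z` is a connected component of the smooth projective curve with the Kummer equation
  `z^{p-1} = ∏ (x - xᵢ)^{aᵢ} u²`. -/
  kummer : z ^ (p - 1) = algebraMap (RatFunc k) 𝒟.K
    ((∏ i, linFactor (x i) ^ a (x i : k)) * (∏ c ∈ B, linFactor c ^ a (c : k))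
      * algebraMap k[X] (RatFunc k) u ^ 2)
  generates : IntermediateField.adjoin (RatFunc k) {z} = ⊤
  ε_ne_zero : ε ≠ 0
  /-- `ω = ε z ∏ (x - xᵢ)^{νᵢ - 1} dx`. -/
  omega_eq : 𝒟.ω = (algebraMap k 𝒟.K ε * z * algebraMap (RatFunc k) 𝒟.K
      ((∏ i, linFactor (x i) ^ ((ν (x i : k) : ℤ) - 1))
        * ∏ c ∈ B, linFactor c ^ ((ν (c : k) : ℤ) - 1)))
    • KaehlerDifferential.D k 𝒟.K (algebraMap (RatFunc k) 𝒟.K RatFunc.X)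
  /-- `B` consists of the zeros of `D^{p-1} (1 / (Q u²))` outside `x₁, …, x_r`. -/
  mem_B_iff : ∀ c : k, (∀ i, x i ≠ c) → (c ∈ B ↔
    VanishesAt (ratDeriv^[p - 1]
      (wronskianQ x a ν * algebraMap k[X] (RatFunc k) u ^ 2)⁻¹) c)
  /-- `p₁ = Q' / Q`. -/
  p₁_eq : L.p₁ = ratDeriv (wronskianQ x a ν) / wronskianQ x a ν
  /-- `p₂ = P / ∏_{i < r} (x - xᵢ)` with a polynomial `P` of degree at most `r - 3`, whose
  coefficient in degree `r - 3` is `d (d + a_r - ν_r)` for `d = deg u`. -/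
  p₂_eq : ∃ P : k[X], P.natDegree ≤ r - 3 ∧
    P.coeff (r - 3) = (u.natDegree : k)
      * ((u.natDegree : k) + (a OnePoint.infty : k) - (ν OnePoint.infty : k)) ∧
    L.p₂ = algebraMap k[X] (RatFunc k) P / algebraMap k[X] (RatFunc k) L.P₀
  /-- `u` is a solution of `L`. -/
  apply_eq : L.apply u = 0

end Fuchs

end

/-!
Write `D` for `d/dx` and let `w = ∏ (x - xᵢ)^{mᵢ}` be the solution of the Wronskian equation
`w' + p₁ w = 0` with `0 ≤ mᵢ < p` (`exists_residues`, `wronskian_singProd`). Reduction of order says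
that a primitive of `w / u²` would give a second solution of `L`. The obstruction to its existence
is `D^{p-1}(w / u²)`, and it is nonzero because the `p`-curvature is
(`iterate_derivative_ne_zero`). As `D^p = 0`, this function is a `p`-th power. It has no poles at the
zeros of `u`: these are simple by minimality of `u`, and the equation of `u` says that `w / u²` has
no residue there. So `D^{p-1}(w / u²) = h^p` with a nonzero polynomial `h`
(`exists_iterate_derivative_eq`).

The deformation datum is `ω = z₁ dx` on the curve `z₁^{p-1} = G` for `G = -h^p u² / w`. Since
`D^{p-1}(1 / G) = -1`, the function `z₁` satisfies `D^{p-1} z₁ = -z₁^p`, which by Jacobson's formula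
for `(D - z₁)^p` makes `D - z₁` nilpotent on `1`; the last nonzero iterate `f` has `df / f = ω`
(`exists_derivation_eq_mul`, `exists_deformationDatum`).

The order of `ω` at the places above a point depends only on the order of `G` there
(`hasOrderAt_kummer`): a local parameter is a monomial in `z₁` and a parameter of the line. With it,
the invariants `σ`, their congruences and the list of critical points come down to arithmetic with the
multiplicities of `h`, `u` and `w`; the set `B` consists of the zeros of `h` outside the `xᵢ`. The
function `z` of the theorem is `z₁`, divided by a constant and a product of powers of the `x - c`.

It remains to see that a singular point with `σ = 1`, `σ ≡ 1` or `σ = (p + 1) / (p - 1)` is removable.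
In the first two cases the exponents differ by one, and `s = 1`, respectively `s = x^d` at infinity,
removes it. In the last case they differ by `-1`, and `h` has just the order of vanishing which
excludes a logarithm; here `s = 1 / (x - xᵢ)`, respectively `s = x^{d+1}`, removes it.
-/

noncomputable section

namespace Fuchs

/-! ### Ramification in Galois extensions -/

open IsDedekindDomain Pointwise in
/-- A place `P` of a Galois extension `K / F` which is nontrivial on a Dedekind domain `R` of `F`
is discrete, with a uniformizer `π`. By the fundamental identity for the prime below `P`, its
ramification index `E` is at most the order of the decomposition group. -/
theorem exists_ramificationIndex_of_isDedekindDomain {R S F K : Type*} [CommRing R]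
    [IsDedekindDomain R] [CommRing S] [IsDedekindDomain S]
    [Field F] [Field K] [Algebra F K] [FiniteDimensional F K] [IsGalois F K]
    [Algebra R F] [IsFractionRing R F] [Algebra R K] [IsScalarTower R F K]
    [Algebra S K] [IsFractionRing S K] [Algebra R S] [IsScalarTower R S K]
    [IsIntegralClosure S R K] [Module.Finite R S]
    (P : ValuationSubring K) (hSP : ∀ s : S, algebraMap S K s ∈ P) (ϖ : R) (hϖ : Prime ϖ)
    (hlt : P.valuation (algebraMap R K ϖ) < 1) :
    ∃ (E : ℕ) (π : K), 1 ≤ E ∧ E ≤ Nat.card (P.decompositionSubgroup F) ∧ π ≠ 0 ∧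
      P.valuation π < 1 ∧ P.valuation (algebraMap R K ϖ) = P.valuation π ^ E ∧
      ∀ f : K, f ≠ 0 → ∃ n : ℤ, P.valuation f = P.valuation π ^ n := by
  have hRS : Function.Injective (algebraMap R S) := by
    have h : Function.Injective ((algebraMap S K).comp (algebraMap R S)) := by
      rw [← IsScalarTower.algebraMap_eq, IsScalarTower.algebraMap_eq R F K]
      exact (algebraMap F K).injective.comp (IsFractionRing.injective R F)
    exact Function.Injective.of_comp h
  have : FaithfulSMul R S := (faithfulSMul_iff_algebraMap_injective R S).2 hRS
  have : Module.Flat R S := inferInstance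
  have hRK : Function.Injective (algebraMap R K) := by
    rw [IsScalarTower.algebraMap_eq R S K]
    exact (IsFractionRing.injective S K).comp hRS
  let _ : MulSemiringAction (K ≃ₐ[F] K) S := IsIntegralClosure.MulSemiringAction R F K S
  have : SMulDistribClass (K ≃ₐ[F] K) S K := inferInstance
  have : Algebra.IsIntegral R S := IsIntegralClosure.isIntegral_algebra R K
  have : IsGaloisGroup (K ≃ₐ[F] K) R S := IsGaloisGroup.of_isFractionRing (K ≃ₐ[F] K) R S F K
  let 𝔬 : HeightOneSpectrum R :=
    ⟨Ideal.span {ϖ}, (Ideal.span_singleton_prime hϖ.ne_zero).2 hϖ, by simpa using hϖ.ne_zero⟩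
  have : 𝔬.asIdeal.IsMaximal := 𝔬.isPrime.isMaximal 𝔬.ne_bot
  let ι : S →+* P := (algebraMap S K).codRestrict P.toSubring hSP
  let 𝔭 : Ideal S := (IsLocalRing.maximalIdeal P).comap ι
  have h𝔭 : ∀ s : S, s ∈ 𝔭 ↔ P.valuation (algebraMap S K s) < 1 := by
    intro s
    change ι s ∈ IsLocalRing.maximalIdeal P ↔ _
    exact ValuationSubring.valuation_lt_one_iff P (ι s)
  have : 𝔭.IsPrime := Ideal.comap_isPrime _ _
  have : 𝔭.LiesOver 𝔬.asIdeal := by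
    constructor
    refine Ideal.IsMaximal.eq_of_le ‹_› (Ideal.IsPrime.ne_top inferInstance) ?_
    rw [Ideal.span_singleton_le_iff_mem, Ideal.mem_comap, h𝔭, ← IsScalarTower.algebraMap_apply]
    exact hlt
  have hne : 𝔭 ≠ ⊥ := by
    intro h
    have h1 : algebraMap R S ϖ ∈ 𝔭 := by
      rw [h𝔭, ← IsScalarTower.algebraMap_apply]
      exact hlt
    rw [h, Ideal.mem_bot, map_eq_zero_iff _ hRS] at h1
    exact hϖ.ne_zero h1
  let w : HeightOneSpectrum S := ⟨𝔭, inferInstance, hne⟩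
  -- the valuation of `P` is equivalent to the `𝔭`-adic one
  have hle : ∀ f : K, w.valuation K f ≤ 1 → P.valuation f ≤ 1 := by
    intro f hf
    obtain ⟨n, d, h⟩ := w.exists_primeCompl_mul_eq_of_integer f hf
    have hd : P.valuation (algebraMap S K d) = 1 := by
      refine le_antisymm ((ValuationSubring.valuation_le_one_iff _ _).2 (hSP _)) ?_
      by_contra! hcon
      exact d.2 ((h𝔭 _).2 hcon)
    have hn := (ValuationSubring.valuation_le_one_iff P _).2 (hSP n)
    rw [← h, map_mul, hd, mul_one] at hn
    exact hn
  have heq : ∀ f : K, w.valuation K f = 1 → P.valuation f = 1 := by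
    intro f hf
    refine le_antisymm (hle f hf.le) ?_
    have h := hle f⁻¹ (by rw [map_inv₀, hf, inv_one])
    have hf0 : 0 < P.valuation f := by
      rw [Valuation.pos_iff]
      rintro rfl
      simp at hf
    rw [map_inv₀] at h
    exact (inv_le_one₀ hf0).1 h
  have hge : ∀ f : K, f ∈ P → w.valuation K f ≤ 1 := by
    intro f hf
    by_contra! hcon
    have h1 : w.valuation K f⁻¹ < 1 := by
      rw [map_inv₀]
      exact inv_lt_one_of_one_lt₀ hcon
    obtain ⟨n, d, h⟩ := w.exists_primeCompl_mul_eq_of_integer f⁻¹ h1.le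
    have hd : w.valuation K (algebraMap S K d) = 1 := w.valuation_eq_one_iff_notMem.2 d.2
    have hn : w.valuation K (algebraMap S K n) < 1 := by
      rw [← h, map_mul, hd, mul_one]
      exact h1
    have hn' := (h𝔭 n).1 ((w.valuation_lt_one_iff_mem n).1 hn)
    have hd' : P.valuation (algebraMap S K d) = 1 := by
      refine le_antisymm ((ValuationSubring.valuation_le_one_iff _ _).2 (hSP _)) ?_
      by_contra! hcon
      exact d.2 ((h𝔭 _).2 hcon)
    rw [← h, map_mul, hd', mul_one, map_inv₀] at hn'
    have hf1 := (ValuationSubring.valuation_le_one_iff P f).2 hf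
    have hf0 : f ≠ 0 := by
      rintro rfl
      simp at hcon
    exact absurd hn' (not_lt.2 ((one_le_inv₀ ((Valuation.pos_iff _).2 hf0)).2 hf1))
  obtain ⟨π, hπ⟩ := w.valuation_exists_uniformizer K
  have hπ0 : π ≠ 0 := by
    rintro rfl
    rw [map_zero] at hπ
    exact WithZero.exp_ne_zero hπ.symm
  have hPπ : ∀ f : K, ∀ n : ℤ, w.valuation K f = w.valuation K π ^ n →
      P.valuation f = P.valuation π ^ n := by
    intro f n h
    have h1 : P.valuation (f / π ^ n) = 1 := by
      apply heq
      rw [map_div₀, map_zpow₀, h, div_self]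
      apply zpow_ne_zero
      simpa using hπ0
    rw [map_div₀, map_zpow₀, div_eq_one_iff_eq] at h1
    · exact h1
    · apply zpow_ne_zero
      simpa using hπ0
  have hram : 𝔬.asIdeal.ramificationIdx' w.asIdeal = 𝔬.asIdeal.ramificationIdxIn S := by
    rw [Ideal.ramificationIdxIn_eq_ramificationIdx 𝔬.asIdeal 𝔭 (K ≃ₐ[F] K)]
    exact Ideal.ramificationIdx'_eq_ramificationIdx 𝔬.asIdeal 𝔭 𝔬.ne_bot
  have hinj : 0 < 𝔬.asIdeal.ramificationIdxIn S * 𝔬.asIdeal.inertiaDegIn S := by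
    apply Nat.mul_pos
    · exact Nat.pos_of_ne_zero (Ideal.ramificationIdxIn_ne_zero (K ≃ₐ[F] K))
    · exact Nat.pos_of_ne_zero (Ideal.inertiaDegIn_ne_zero (K ≃ₐ[F] K))
  have hcard : Nat.card (MulAction.stabilizer (K ≃ₐ[F] K) 𝔭)
      = 𝔬.asIdeal.ramificationIdxIn S * 𝔬.asIdeal.inertiaDegIn S := by
    have h1 := Ideal.ncard_primesOver_mul_ramificationIdxIn_mul_inertiaDegIn 𝔬.asIdeal S
      (K ≃ₐ[F] K)
    have h2 := Nat.card_congr (MulAction.orbitProdStabilizerEquivGroup (K ≃ₐ[F] K) 𝔭)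
    rw [Nat.card_prod, Algebra.IsInvariant.orbit_eq_primesOver R S (K ≃ₐ[F] K) 𝔬.asIdeal 𝔭,
      ← h1] at h2
    have h3 : (𝔬.asIdeal.primesOver S).ncard ≠ 0 := by
      intro h
      rw [h, zero_mul] at h1
      exact Nat.card_pos.ne h1
    exact Nat.eq_of_mul_eq_mul_left (Nat.pos_of_ne_zero h3) h2
  have hstab : MulAction.stabilizer (K ≃ₐ[F] K) 𝔭 ≤ P.decompositionSubgroup F := by
    have key : ∀ g ∈ MulAction.stabilizer (K ≃ₐ[F] K) 𝔭, ∀ x ∈ P, g • x ∈ P := by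
      intro g hg x hx
      obtain ⟨n, d, h⟩ := w.exists_primeCompl_mul_eq_of_integer x (hge x hx)
      have hgd : g • (d : S) ∉ 𝔭 := by
        intro hcon
        rw [← MulAction.mem_stabilizer_iff.1 hg] at hcon
        exact d.2 ((Ideal.smul_mem_pointwise_smul_iff).1 hcon)
      have h1 : P.valuation (algebraMap S K (g • (d : S))) = 1 := by
        refine le_antisymm ((ValuationSubring.valuation_le_one_iff _ _).2 (hSP _)) ?_
        by_contra! hcon
        exact hgd ((h𝔭 _).2 hcon)
      have h2 : g • x * algebraMap S K (g • (d : S)) = algebraMap S K (g • n) := by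
        rw [algebraMap.smul', algebraMap.smul', ← smul_mul', h]
      rw [← ValuationSubring.valuation_le_one_iff]
      have h3 := (ValuationSubring.valuation_le_one_iff P _).2 (hSP (g • n))
      rwa [← h2, map_mul, h1, mul_one] at h3
    intro g hg
    refine MulAction.mem_stabilizer_iff.2 (le_antisymm ?_ ?_)
    · intro x hx
      rw [ValuationSubring.mem_pointwise_smul_iff_inv_smul_mem] at hx
      simpa using key g hg _ hx
    · intro x hx
      rw [ValuationSubring.mem_pointwise_smul_iff_inv_smul_mem]
      exact key g⁻¹ (inv_mem hg) x hx
  have hϖw : ∀ n : ℕ, w.valuation K (algebraMap R K ϖ) = w.valuation K π ^ n →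
      P.valuation (algebraMap R K ϖ) = P.valuation π ^ n := by
    intro n h
    have := hPπ (algebraMap R K ϖ) n (by rw [zpow_natCast, h])
    rwa [zpow_natCast] at this
  have hE : P.valuation (algebraMap R K ϖ)
      = P.valuation π ^ 𝔬.asIdeal.ramificationIdx' w.asIdeal := by
    apply hϖw
    rw [IsScalarTower.algebraMap_apply R F K, ← HeightOneSpectrum.valuation_liesOver K 𝔬 w, hπ,
      HeightOneSpectrum.valuation_of_algebraMap, 𝔬.intValuation_singleton hϖ.ne_zero rfl]
  refine ⟨𝔬.asIdeal.ramificationIdx' w.asIdeal, π, ?_, ?_, hπ0, ?_, hE, ?_⟩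
  · rw [hram]
    exact Nat.pos_of_mul_pos_right hinj
  · rw [hram]
    refine le_trans (Nat.le_mul_of_pos_right _ (Nat.pos_of_mul_pos_left hinj)) ?_
    rw [← hcard]
    exact Subgroup.card_le_of_le hstab
  · refine lt_of_le_of_ne (hle π ?_) ?_
    · rw [hπ, ← WithZero.exp_zero, WithZero.exp_le_exp]
      norm_num
    · intro h
      rw [hE, h, one_pow] at hlt
      exact lt_irrefl _ hlt
  · intro f hf
    refine ⟨-WithZero.log (w.valuation K f), hPπ f _ ?_⟩
    rw [hπ, ← WithZero.exp_zsmul, smul_neg, neg_smul, neg_neg, smul_eq_mul, mul_one,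
      WithZero.exp_log]
    simpa using hf

/-- A place `P` of a Galois extension `K / F`, which restricts to a discrete valuation of `F`
with uniformizer `t₀`, is discrete, with a ramification index `E` of at most the order of the
decomposition group: the valuation ring of `F` is a discrete valuation ring, and its integral
closure in `K` is a Dedekind domain. -/
theorem exists_ramificationIndex {F K : Type*} [Field F] [Field K] [Algebra F K]
    [FiniteDimensional F K] [IsGalois F K] (P : ValuationSubring K) (t₀ : F) (ht₀ : t₀ ≠ 0)
    (hlt : P.valuation (algebraMap F K t₀) < 1)
    (hF : ∀ f : F, f ≠ 0 → ∃ n : ℤ, P.valuation (algebraMap F K f)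
      = P.valuation (algebraMap F K t₀) ^ n) :
    ∃ (E : ℕ) (π : K), 1 ≤ E ∧ E ≤ Nat.card (P.decompositionSubgroup F) ∧ π ≠ 0 ∧
      P.valuation π < 1 ∧ P.valuation (algebraMap F K t₀) = P.valuation π ^ E ∧
      ∀ f : K, f ≠ 0 → ∃ n : ℤ, P.valuation f = P.valuation π ^ n := by
  let O : ValuationSubring F := P.comap (algebraMap F K)
  have memO : ∀ f : F, f ∈ O ↔ P.valuation (algebraMap F K f) ≤ 1 := by
    intro f
    rw [ValuationSubring.valuation_le_one_iff]; rfl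
  let ϖ : O := ⟨t₀, (memO _).2 hlt.le⟩
  have ht₀' : algebraMap F K t₀ ≠ 0 := by simpa using ht₀
  have hv0 : 0 < P.valuation (algebraMap F K t₀) := (Valuation.pos_iff _).2 ht₀'
  have unitO : ∀ f : O, IsUnit f ↔ P.valuation (algebraMap F K f) = 1 := by
    intro f
    constructor
    · intro hf
      obtain ⟨g, hg⟩ := hf.exists_right_inv
      apply le_antisymm ((memO _).1 f.2)
      have h1 : (f : F) * (g : F) = 1 := congrArg Subtype.val hg
      have h2 : P.valuation (algebraMap F K f) * P.valuation (algebraMap F K g) = 1 := by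
        rw [← map_mul, ← map_mul, h1, map_one, map_one]
      rw [← h2]
      exact mul_le_of_le_one_right' ((memO _).1 g.2)
    · intro h
      have hf0 : (f : F) ≠ 0 := by
        rintro h0
        rw [h0] at h
        simp at h
      refine IsUnit.of_mul_eq_one ⟨(f : F)⁻¹, (memO _).2 ?_⟩ ?_
      · rw [map_inv₀, map_inv₀, h]; simp
      · ext
        simp [hf0]
  have hfac : ∀ f : O, f ≠ 0 → ∃ n : ℕ, Associated (ϖ ^ n) f := by
    intro f hf
    have hf' : (f : F) ≠ 0 := fun h => hf (Subtype.ext h)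
    obtain ⟨n, hn⟩ := hF f hf'
    have hn0 : 0 ≤ n := by
      by_contra! hcon
      have := (memO _).1 f.2
      rw [hn] at this
      exact absurd this (not_le.2 (one_lt_zpow_of_neg₀ hv0 hlt hcon))
    lift n to ℕ using hn0
    have hd : P.valuation (algebraMap F K ((f : F) / t₀ ^ n)) = 1 := by
      rw [map_div₀, map_div₀, map_pow, map_pow, hn, zpow_natCast, div_self]
      exact (pow_pos hv0 n).ne'
    have hu : IsUnit (⟨(f : F) / t₀ ^ n, (memO _).2 hd.le⟩ : O) := (unitO _).2 hd
    refine ⟨n, hu.unit, ?_⟩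
    ext
    simp only [IsUnit.unit_spec, MulMemClass.coe_mul, SubmonoidClass.coe_pow, ϖ]
    field_simp
  have hϖ : Irreducible ϖ := by
    have hnu : ¬ IsUnit ϖ := by
      rw [unitO]
      exact hlt.ne
    refine ⟨hnu, ?_⟩
    intro a b hab
    have hne : a * b ≠ 0 := by
      rw [← hab]
      exact fun h => ht₀ (congrArg Subtype.val h)
    obtain ⟨n, hn⟩ := hfac a (left_ne_zero_of_mul hne)
    obtain ⟨m, hm⟩ := hfac b (right_ne_zero_of_mul hne)
    rcases Nat.eq_zero_or_pos n with rfl | hn0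
    · left
      rw [pow_zero] at hn
      exact associated_one_iff_isUnit.1 hn.symm
    rcases Nat.eq_zero_or_pos m with rfl | hm0
    · right
      rw [pow_zero] at hm
      exact associated_one_iff_isUnit.1 hm.symm
    exfalso
    have h1 : P.valuation (algebraMap F K a) < 1 := by
      refine lt_of_le_of_ne ((memO _).1 a.2) fun h => ?_
      exact hnu (isUnit_of_dvd_unit ((dvd_pow_self ϖ hn0.ne').trans hn.dvd) ((unitO _).2 h))
    have h2 : ϖ ∣ b := (dvd_pow_self ϖ hm0.ne').trans hm.dvd
    obtain ⟨c, hc⟩ := h2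
    have h3 : (a : F) * (c : F) = 1 := by
      have := congrArg Subtype.val hab
      rw [hc] at this
      simp only [MulMemClass.coe_mul, ϖ] at this
      field_simp at this
      exact this.symm
    exact hnu (isUnit_of_dvd_unit ((dvd_pow_self ϖ hn0.ne').trans hn.dvd)
      (IsUnit.of_mul_eq_one c (Subtype.ext h3)))
  have hdvr : IsDiscreteValuationRing O :=
    IsDiscreteValuationRing.ofHasUnitMulPowIrreducibleFactorization ⟨ϖ, hϖ, fun {f} hf => hfac f hf⟩
  let _ : Algebra O K := ((algebraMap F K).comp (algebraMap O F)).toAlgebra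
  have : IsScalarTower O F K := IsScalarTower.of_algebraMap_eq' rfl
  let S := integralClosure O K
  have : IsFractionRing S K := integralClosure.isFractionRing_of_finite_extension F K
  have : IsDedekindDomain S := integralClosure.isDedekindDomain O F K
  have : Module.Finite O S := IsIntegralClosure.finite O F K S
  have hSP : ∀ s : S, algebraMap S K s ∈ P := by
    intro s
    let _ : Algebra O P := (((algebraMap F K).comp (algebraMap O F)).codRestrict P.toSubring
      fun f => f.2).toAlgebra
    have : IsScalarTower O P K := IsScalarTower.of_algebraMap_eq' rfl
    have h : IsIntegral P (s : K) := IsIntegral.tower_top (R := O) s.2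
    obtain ⟨y, hy⟩ := IsIntegrallyClosed.isIntegral_iff.1 h
    rw [show algebraMap S K s = (s : K) from rfl, ← hy]
    exact y.2
  exact exists_ramificationIndex_of_isDedekindDomain (R := O) (S := S) (F := F) P hSP ϖ
    hϖ.prime hlt

/-! ### Tame Kummer covers at a place -/

theorem valuation_algebraMap_eq_one {k K : Type*} [Field k] [Field K] [Algebra k K]
    (P : ValuationSubring K) (hk : ∀ b : k, algebraMap k K b ∈ P) {b : k} (hb : b ≠ 0) :
    P.valuation (algebraMap k K b) = 1 := by
  refine le_antisymm ((ValuationSubring.valuation_le_one_iff _ _).2 (hk b)) ?_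
  have h := (ValuationSubring.valuation_le_one_iff _ _).2 (hk b⁻¹)
  rw [map_inv₀, map_inv₀] at h
  exact (inv_le_one₀ ((Valuation.pos_iff _).2 (by simpa using hb))).1 h

/-- The residue field of a place of `K / k` has no roots outside the algebraically closed
field `k`. -/
theorem exists_valuation_sub_algebraMap_lt {k K : Type*} [Field k] [IsAlgClosed k] [Field K]
    [Algebra k K] (P : ValuationSubring K) {g : ℕ} (hg : g ≠ 0) (y : K) (b : k)
    (h : P.valuation (y ^ g - algebraMap k K b) < 1) :
    ∃ c : k, P.valuation (y - algebraMap k K c) < 1 := by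
  have hmonic : (X ^ g - C b : k[X]).Monic := monic_X_pow_sub_C b hg
  have hs := (IsAlgClosed.splits (X ^ g - C b : k[X])).eq_prod_roots_of_monic hmonic
  have h1 : y ^ g - algebraMap k K b
      = ((X ^ g - C b : k[X]).roots.map fun c => y - algebraMap k K c).prod := by
    have := congrArg (aeval y) hs
    rw [map_multiset_prod, Multiset.map_map] at this
    simpa using this
  by_contra! hcon
  rw [h1, map_multiset_prod, Multiset.map_map] at h
  refine absurd h (not_lt.2 ?_)
  apply Multiset.one_le_prod
  intro x hx
  obtain ⟨c, -, rfl⟩ := Multiset.mem_map.1 hx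
  exact hcon c

theorem exists_zmod_eq_of_pow_eq_one {p : ℕ} [Fact p.Prime] {K : Type*} [Field K] [CharP K p]
    {ξ : K} (h : ξ ^ (p - 1) = 1) : ∃ c : (ZMod p)ˣ, ZMod.castHom (dvd_refl p) K c = ξ := by
  have h0 : ξ ≠ 0 := by
    rintro rfl
    rw [zero_pow (Nat.sub_ne_zero_of_lt (Fact.out : p.Prime).one_lt)] at h
    exact zero_ne_one h
  have h1 : ξ ^ p = ξ := by
    rw [← Nat.sub_add_cancel (Fact.out : p.Prime).one_le, pow_succ, h, one_mul]
  rw [← Subfield.mem_bot_iff_pow_eq_self K p, mem_bot_iff_intCast p K] at h1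
  obtain ⟨n, rfl⟩ := h1
  have hn : (n : ZMod p) ≠ 0 := by
    intro hn
    apply h0
    rw [← map_intCast (ZMod.castHom (dvd_refl p) K), hn, map_zero]
  exact ⟨Units.mk0 _ hn, by rw [Units.val_mk0, map_intCast]⟩

open Pointwise in
theorem valuation_lt_one_iff_of_mem_decompositionSubgroup {F K : Type*} [Field F] [Field K]
    [Algebra F K] {P : ValuationSubring K} {β : K ≃ₐ[F] K} (hβ : β ∈ P.decompositionSubgroup F)
    (f : K) : P.valuation (β f) < 1 ↔ P.valuation f < 1 := by
  have h : ∀ f : K, β f ∈ P ↔ f ∈ P := by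
    intro f
    conv_lhs => rw [← MulAction.mem_stabilizer_iff.1 hβ]
    exact ValuationSubring.smul_mem_pointwise_smul_iff
  rcases eq_or_ne f 0 with rfl | hf
  · simp
  have hf' : β f ≠ 0 := by simpa using hf
  have key : ∀ f : K, f ≠ 0 → (P.valuation f < 1 ↔ f⁻¹ ∉ P) := by
    intro f hf
    rw [← ValuationSubring.valuation_le_one_iff, map_inv₀, not_le,
      one_lt_inv₀ ((Valuation.pos_iff _).2 hf)]
  rw [key _ hf', key _ hf, ← map_inv₀, h]

theorem algEquiv_eq_of_adjoin_eq_top {F K : Type*} [Field F] [Field K] [Algebra F K] {z : K}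
    (hgen : IntermediateField.adjoin F {z} = ⊤) {β γ : K ≃ₐ[F] K} (h : β z = γ z) : β = γ := by
  apply AlgEquiv.coe_toAlgHom_injective
  refine AlgHom.ext fun x => ?_
  have hx : x ∈ IntermediateField.adjoin F {z} := hgen ▸ IntermediateField.mem_top
  induction hx using IntermediateField.adjoin_induction with
  | mem x hx => rw [Set.mem_singleton_iff.1 hx]; exact h
  | algebraMap x => simp
  | add x y _ _ hx hy => rw [map_add, map_add, hx, hy]
  | inv x _ hx => rw [map_inv₀, map_inv₀, hx]
  | mul x y _ _ hx hy => rw [map_mul, map_mul, hx, hy]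

section LogDeriv

variable {k K : Type*} [Field k] [Field K] [Algebra k K] {M : Type*} [AddCommGroup M] [Module K M]
  [Module k M] (D : Derivation k K M)

theorem inv_smul_derivation_mul {f g : K} (hf : f ≠ 0) (hg : g ≠ 0) :
    (f * g)⁻¹ • D (f * g) = f⁻¹ • D f + g⁻¹ • D g := by
  rw [Derivation.leibniz, smul_add, smul_smul, smul_smul, add_comm]
  congr 2 <;> field_simp

theorem inv_smul_derivation_zpow {f : K} (hf : f ≠ 0) (n : ℤ) :
    (f ^ n)⁻¹ • D (f ^ n) = (n : K) • f⁻¹ • D f := by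
  have hnat : ∀ n : ℕ, (f ^ n)⁻¹ • D (f ^ n) = (n : K) • f⁻¹ • D f := by
    intro n
    induction n with
    | zero => simp
    | succ n ih =>
      rw [pow_succ, inv_smul_derivation_mul D (pow_ne_zero n hf) hf, ih]
      push_cast
      rw [add_smul, one_smul]
  obtain ⟨n, rfl | rfl⟩ := n.eq_nat_or_neg
  · simpa using hnat n
  · have h := inv_smul_derivation_mul D (pow_ne_zero n hf) (inv_ne_zero (pow_ne_zero n hf))
    rw [mul_inv_cancel₀ (pow_ne_zero n hf), hnat] at h
    rw [zpow_neg, zpow_natCast]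
    rw [D.map_one_eq_zero, smul_zero] at h
    push_cast
    rw [neg_smul]
    exact (neg_eq_of_add_eq_zero_right h.symm).symm

end LogDeriv

/-- The order of `z dt₀`, up to powers of `t₀`, for `z^{p-1} = t₀^s U` with a unit `U` and a
parameter `t₀` of the place below `P`. With `g = gcd(s, p - 1)` and `p - 1 = g e`, Bézout gives
a monomial `t` in `z` and `t₀` with `v(t)^e = v(t₀)` and `v(z) = v(t)^{s/g}`. The function
`y = z^e t₀^{-s/g}` satisfies `y^g = U`, so its residue lies in `k` and is fixed by the
decomposition group, whose elements therefore multiply `z` by `e`-th roots of unity. Hence the order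
of the decomposition group is at most `e`. Since `e` divides the ramification index, which is at
most that order, all three are equal, and `t` is a uniformizer. -/
theorem hasOrderAt_kummer {p : ℕ} [Fact p.Prime] {k F K : Type u} [Field k] [IsAlgClosed k]
    [CharP k p] [Field F] [Field K] [Algebra k F] [Algebra F K] [Algebra k K]
    [IsScalarTower k F K] [FiniteDimensional F K] [IsGalois F K]
    {z : K} (hz : z ≠ 0) {G : F} (hzG : z ^ (p - 1) = algebraMap F K G)
    (hgen : IntermediateField.adjoin F {z} = ⊤)
    (P : ValuationSubring K) (hk : ∀ b : k, algebraMap k K b ∈ P)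
    {t₀ U : F} (ht₀ : t₀ ≠ 0) (hlt : P.valuation (algebraMap F K t₀) < 1)
    (hF : ∀ f : F, f ≠ 0 → ∃ n : ℤ, P.valuation (algebraMap F K f)
      = P.valuation (algebraMap F K t₀) ^ n)
    {s : ℤ} (hG : G = t₀ ^ s * U) {b : k} (hb : b ≠ 0)
    (hU : P.valuation (algebraMap F K U - algebraMap k K b) < 1)
    {W : K} (hW : P.valuation W ≤ 1)
    (hdU : KaehlerDifferential.D k K (algebraMap F K U)
      = W • KaehlerDifferential.D k K (algebraMap F K t₀)) (j : ℤ) :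
    ∃ n : ℤ, HasOrderAt k ((z * algebraMap F K t₀ ^ j) •
        KaehlerDifferential.D k K (algebraMap F K t₀)) P n ∧
      (s : ℚ) / ((p : ℚ) - 1) + 1 + j
        = ((n : ℚ) + 1) / (Nat.card (P.decompositionSubgroup F) : ℚ) := by
  have : CharP K p := charP_of_injective_algebraMap (algebraMap k K).injective p
  set τ : K := algebraMap F K t₀ with hτ
  have hτ0 : τ ≠ 0 := by simpa [hτ] using ht₀
  set v := P.valuation with hv
  have hvτ : 0 < v τ := (Valuation.pos_iff _).2 hτ0
  have hvz : 0 < v z := (Valuation.pos_iff _).2 hz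
  have hM0 : p - 1 ≠ 0 := Nat.sub_ne_zero_of_lt (Fact.out : p.Prime).one_lt
  have hvU : v (algebraMap F K U) = 1 := by
    have h := Valuation.map_add_eq_of_lt_right v (x := algebraMap F K U - algebraMap k K b)
      (y := algebraMap k K b) (by rwa [valuation_algebraMap_eq_one P hk hb])
    rwa [sub_add_cancel, valuation_algebraMap_eq_one P hk hb] at h
  have hU0 : algebraMap F K U ≠ 0 := by
    intro h
    rw [h, map_zero] at hvU
    exact zero_ne_one hvU
  -- Bézout's identity for `s` and `p - 1` gives the uniformizer `t`
  obtain ⟨e, he⟩ : Int.gcd s (p - 1 : ℕ) ∣ p - 1 := by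
    exact_mod_cast Int.gcd_dvd_right s ((p - 1 : ℕ) : ℤ)
  obtain ⟨s', hs'⟩ : (Int.gcd s (p - 1 : ℕ) : ℤ) ∣ s := Int.gcd_dvd_left s ((p - 1 : ℕ) : ℤ)
  have hbez := Int.gcd_eq_gcd_ab s ((p - 1 : ℕ) : ℤ)
  set a := Int.gcdA s ((p - 1 : ℕ) : ℤ)
  set c := Int.gcdB s ((p - 1 : ℕ) : ℤ)
  set g := Int.gcd s ((p - 1 : ℕ) : ℤ)
  have hg0 : g ≠ 0 := by
    intro h
    rw [h, zero_mul] at he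
    exact hM0 he
  have he0 : e ≠ 0 := by
    intro h
    rw [h, mul_zero] at he
    exact hM0 he
  have hzpow : z ^ (p - 1) = τ ^ s * algebraMap F K U := by
    rw [hzG, hG, map_mul, map_zpow₀]
  set t : K := z ^ a * τ ^ c with ht
  have ht0 : t ≠ 0 := mul_ne_zero (zpow_ne_zero _ hz) (zpow_ne_zero _ hτ0)
  have hvt0 : 0 < v t := (Valuation.pos_iff _).2 ht0
  have htM : t ^ (p - 1) = τ ^ g * algebraMap F K U ^ a := by
    rw [ht, mul_pow, ← zpow_natCast (z ^ a), zpow_comm, zpow_natCast, hzpow, mul_zpow,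
      ← zpow_mul, ← zpow_natCast (τ ^ c), ← zpow_mul, ← zpow_natCast τ g, hbez,
      zpow_add₀ hτ0, mul_comm c]
    ring
  have hvte : v t ^ e = v τ := by
    have h := congrArg v htM
    rw [map_mul, map_pow, map_pow, map_zpow₀, hvU, one_zpow, mul_one, he, mul_comm g, pow_mul] at h
    exact (pow_left_inj₀ zero_le zero_le hg0).1 h
  have hvzt : v z = v t ^ s' := by
    have h := congrArg v hzpow
    rw [map_mul, map_pow, map_zpow₀, hvU, mul_one, ← hvte, ← zpow_natCast (v t) e, ← zpow_mul] at h
    have h2 : (e : ℤ) * s = s' * ((p - 1 : ℕ) : ℤ) := by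
      rw [hs', he]
      push_cast
      ring
    rw [h2, zpow_mul, zpow_natCast] at h
    exact (pow_left_inj₀ zero_le zero_le hM0).1 h
  -- the decomposition group acts on `z` through `e`-th roots of unity
  have hcard : Nat.card (P.decompositionSubgroup F) ≤ e := by
    set y : K := z ^ e * τ ^ (-s') with hy
    have hyg : y ^ g = algebraMap F K U := by
      rw [hy, mul_pow, ← pow_mul, mul_comm e, ← he, hzpow, ← zpow_natCast (τ ^ (-s')), ← zpow_mul,
        mul_right_comm, ← zpow_add₀ hτ0]
      conv_lhs => rw [hs']
      rw [show (g : ℤ) * s' + -s' * g = 0 by ring, zpow_zero, one_mul]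
    have hvy : v y = 1 := by
      have h := congrArg v hyg
      rw [map_pow, hvU] at h
      exact (pow_eq_one_iff_of_nonneg zero_le hg0).1 h
    have hy0 : y ≠ 0 := by
      rintro h
      rw [h, map_zero] at hvy
      exact zero_ne_one hvy
    obtain ⟨y₀, hy₀⟩ := exists_valuation_sub_algebraMap_lt P hg0 y b (by rwa [hyg])
    have hroot : ∀ β ∈ P.decompositionSubgroup F, (β z / z) ^ e = 1 := by
      intro β hβ
      have hβτ : β τ = τ := β.commutes t₀
      have hβy : (β z / z) ^ e = β y / y := by
        rw [hy, map_mul, map_pow, map_zpow₀, hβτ, mul_div_mul_right _ _ (zpow_ne_zero _ hτ0),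
          div_pow]
      have hpow : (β z / z) ^ (p - 1) = 1 := by
        rw [div_pow, ← map_pow, hzG, β.commutes, div_self]
        rw [← hzG]
        exact pow_ne_zero _ hz
      obtain ⟨ζ, hζ⟩ := exists_zmod_eq_of_pow_eq_one hpow
      have hζ' : algebraMap k K (ZMod.castHom (dvd_refl p) k ζ) = β z / z := by
        rw [← hζ, ← RingHom.comp_apply]
        congr 1
        exact Subsingleton.elim _ _
      rw [← hζ', ← map_pow, ← map_one (algebraMap k K)]
      congr 1
      by_contra hcon
      have h1 := valuation_algebraMap_eq_one P hk (sub_ne_zero.2 hcon)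
      have h2 : algebraMap k K (ZMod.castHom (dvd_refl p) k ζ ^ e - 1)
          = ((β (y - algebraMap k K y₀)) - (y - algebraMap k K y₀)) * y⁻¹ := by
        have h3 : β (algebraMap k K y₀) = algebraMap k K y₀ := by
          rw [IsScalarTower.algebraMap_apply k F K, β.commutes]
        rw [map_sub, map_sub, map_pow, hζ', hβy, map_one, h3]
        field_simp
        ring
      rw [h2, map_mul, map_inv₀] at h1
      change v _ * (v y)⁻¹ = 1 at h1
      rw [hvy, inv_one, mul_one] at h1
      refine absurd h1 (ne_of_lt (lt_of_le_of_lt (Valuation.map_sub v _ _) (max_lt ?_ hy₀)))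
      exact (valuation_lt_one_iff_of_mem_decompositionSubgroup hβ _).2 hy₀
    classical
    let f : P.decompositionSubgroup F → (nthRoots e (1 : K)).toFinset := fun β =>
      ⟨β.1 z / z, by
        rw [Multiset.mem_toFinset, mem_nthRoots (Nat.pos_of_ne_zero he0)]
        exact hroot β.1 β.2⟩
    have hf : Function.Injective f := by
      intro β γ h
      have h1 : β.1 z / z = γ.1 z / z := congrArg Subtype.val h
      have h2 : β.1 z = γ.1 z := by
        field_simp at h1
        exact h1
      exact Subtype.ext (algEquiv_eq_of_adjoin_eq_top hgen h2)
    calc Nat.card (P.decompositionSubgroup F)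
        ≤ Nat.card (nthRoots e (1 : K)).toFinset := Nat.card_le_card_of_injective f hf
      _ = (nthRoots e (1 : K)).toFinset.card := Nat.card_eq_finsetCard _
      _ ≤ Multiset.card (nthRoots e (1 : K)) := Multiset.toFinset_card_le _
      _ ≤ e := card_nthRoots e 1
  -- the ramification index is a multiple of `e`, and at most the order of the decomposition group
  obtain ⟨E, π, hE1, hE, hπ0, hπ1, hτπ, hπ⟩ := exists_ramificationIndex P t₀ ht₀ hlt hF
  have hvπ : 0 < v π := (Valuation.pos_iff _).2 hπ0
  obtain ⟨m, hm⟩ := hπ t ht0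
  have hmE : m * e = E := by
    have h : v π ^ (m * e) = v π ^ (E : ℤ) := by
      rw [zpow_mul, ← hm, zpow_natCast, hvte, hτπ, zpow_natCast]
    exact zpow_right_injective₀ hvπ hπ1.ne h
  have hm1 : m = 1 := by
    have h1 : (0 : ℤ) < e := by positivity
    have h2 : m * e ≤ 1 * e := by
      rw [hmE, one_mul]
      exact_mod_cast hE.trans hcard
    have h3 := le_of_mul_le_mul_right h2 h1
    have h4 : 0 < m := by
      by_contra! h
      have := mul_nonpos_of_nonpos_of_nonneg h h1.le
      rw [hmE] at this
      omega
    omega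
  have heE : Nat.card (P.decompositionSubgroup F) = e := by
    rw [hm1, one_mul] at hmE
    omega
  rw [hm1, zpow_one] at hm
  have htu : IsUniformizer P t := by
    refine ⟨by rw [← hv, hm]; exact hπ1, fun f hf => ?_⟩
    rcases eq_or_ne f 0 with rfl | hf0
    · rw [map_zero]
      exact zero_le
    obtain ⟨l, hl⟩ := hπ f hf0
    rw [← hv] at hf ⊢
    rw [hm, hl]
    have hl1 : 1 ≤ l := by
      by_contra! hcon
      rw [hl] at hf
      exact absurd hf (not_lt.2 (one_le_zpow_of_nonpos₀ hvπ hπ1.le (by omega)))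
    calc v π ^ l ≤ v π ^ (1 : ℤ) := zpow_le_zpow_right_of_le_one₀ hvπ hπ1.le hl1
      _ = v π := zpow_one _
  -- the logarithmic derivative of `t^{p-1} = t₀^g U^a`, in which `g` is prime to `p`
  set d := KaehlerDifferential.D k K with hd
  set η : K := g + a * (τ * (algebraMap F K U)⁻¹ * W) with hη
  have hvη : v η = 1 := by
    have hgk : v (g : K) = 1 := by
      have h1 : (g : k) ≠ 0 := by
        intro h
        rw [CharP.cast_eq_zero_iff k p] at h
        have h3 := Nat.le_of_dvd (Nat.pos_of_ne_zero hM0) ((h.trans (Dvd.intro _ he.symm)))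
        have := (Fact.out : p.Prime).pos
        omega
      have h2 := valuation_algebraMap_eq_one P hk h1
      rwa [map_natCast] at h2
    have ha : v (a : K) ≤ 1 := by
      have := (ValuationSubring.valuation_le_one_iff _ _).2 (hk (a : k))
      rwa [map_intCast] at this
    have h2 : v (a * (τ * (algebraMap F K U)⁻¹ * W)) < 1 := by
      rw [map_mul, map_mul, map_mul, map_inv₀, hvU, inv_one, mul_one]
      exact mul_lt_one_of_nonneg_of_lt_one_right ha zero_le
        (mul_lt_one_of_nonneg_of_lt_one_left zero_le hlt hW)
    rw [hη, Valuation.map_add_eq_of_lt_left v (by rwa [hgk]), hgk]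
  have hη0 : η ≠ 0 := by
    intro h
    rw [h, map_zero] at hvη
    exact zero_ne_one hvη
  have hpM : v ((p - 1 : ℕ) : K) = 1 := by
    have h1 : ((p - 1 : ℕ) : k) ≠ 0 := by
      rw [Nat.cast_sub (Fact.out : p.Prime).one_le]
      simp
    have h2 := valuation_algebraMap_eq_one P hk h1
    rwa [map_natCast] at h2
  have hdlog : ((p - 1 : ℕ) : K) • t⁻¹ • d t = η • τ⁻¹ • d τ := by
    have h : (t ^ (p - 1))⁻¹ • d (t ^ (p - 1)) = _ := congrArg (fun f => f⁻¹ • d f) htM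
    rw [inv_smul_derivation_mul d (pow_ne_zero g hτ0) (zpow_ne_zero a hU0), ← zpow_natCast t,
      ← zpow_natCast τ, inv_smul_derivation_zpow d ht0, inv_smul_derivation_zpow d hτ0,
      inv_smul_derivation_zpow d hU0, hdU] at h
    rw [Int.cast_natCast, Int.cast_natCast] at h
    rw [h]
    simp only [smul_smul, ← add_smul, hη]
    congr 1
    field_simp
  have hdτ : d τ = (τ * η⁻¹ * (p - 1 : ℕ) * t⁻¹) • d t := by
    have h := congrArg (fun x => (τ * η⁻¹) • x) hdlog
    simp only [smul_smul] at h
    rw [show τ * η⁻¹ * (η * τ⁻¹) = 1 by field_simp, one_smul] at h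
    rw [← h, ← mul_assoc]
  refine ⟨s' + e * j + e - 1, ⟨t, z * t ^ (-s') * (τ / t ^ e) ^ (j + 1) * η⁻¹ * (p - 1 : ℕ),
    htu, ?_, ?_⟩, ?_⟩
  · change v _ = 1
    have h1 : v (z * t ^ (-s')) = 1 := by
      rw [map_mul, map_zpow₀, hvzt, ← zpow_add₀ hvt0.ne', add_neg_cancel, zpow_zero]
    have h2 : v (τ / t ^ e) = 1 := by
      rw [map_div₀, map_pow, hvte, div_self hvτ.ne']
    rw [map_mul, map_mul, map_mul, map_zpow₀, h1, h2, one_zpow, map_inv₀, hvη, hpM]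
    simp
  · rw [hdτ, smul_smul]
    congr 1
    rw [sub_eq_add_neg, zpow_add₀ ht0, zpow_add₀ ht0, zpow_add₀ ht0, zpow_mul, zpow_neg, zpow_neg,
      zpow_one, zpow_natCast, zpow_add₀ (div_ne_zero hτ0 (pow_ne_zero e ht0)), div_zpow, zpow_one]
    field_simp
  · rw [heE]
    have hpe : (p : ℚ) - 1 = g * e := by
      have h : ((p - 1 : ℕ) : ℚ) = g * e := by exact_mod_cast he
      rwa [Nat.cast_sub (Fact.out : p.Prime).one_le, Nat.cast_one] at h
    have hsq : (s : ℚ) = g * s' := by exact_mod_cast hs'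
    have hgq : (g : ℚ) ≠ 0 := by exact_mod_cast hg0
    have heq : (e : ℚ) ≠ 0 := by exact_mod_cast he0
    rw [hpe, hsq]
    push_cast
    field_simp
    ring

/-! ### Jacobson's formula and logarithmic forms -/

section Jacobson

variable {k K : Type*} [Field k] [Field K] [Algebra k K] (D : Derivation k K K) (y : K)

/-- The derivation `D`, applied to the coefficients of a polynomial. -/
def mapCoeff (q : K[X]) : K[X] := q.sum fun n a => monomial n (D a)

theorem coeff_mapCoeff (q : K[X]) (n : ℕ) : (mapCoeff D q).coeff n = D (q.coeff n) := by
  rw [mapCoeff, Polynomial.sum, finsetSum_coeff]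
  simp only [coeff_monomial]
  rw [Finset.sum_ite_eq']
  split_ifs with h
  · rfl
  · rw [notMem_support_iff.1 h, map_zero]

theorem mapCoeff_add (q q' : K[X]) : mapCoeff D (q + q') = mapCoeff D q + mapCoeff D q' := by
  ext n
  simp only [coeff_mapCoeff, coeff_add, map_add]

theorem mapCoeff_C_mul (c : K) (q : K[X]) :
    mapCoeff D (C c * q) = C (D c) * q + C c * mapCoeff D q := by
  ext n
  simp only [coeff_mapCoeff, coeff_add, coeff_C_mul, Derivation.leibniz, smul_eq_mul]
  ring

/-- The connection `D - t y` on `K[t]`, where `D t = 0`. At `t = 1` its iterates become those of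
`D - y`, and the dependence on `t` allows to compute the `p`-th one. -/
def connection (q : K[X]) : K[X] := mapCoeff D q - X * (C y * q)

theorem connection_zero : connection D y 0 = 0 := by
  ext n
  simp [connection, coeff_mapCoeff]

theorem connection_add (q q' : K[X]) :
    connection D y (q + q') = connection D y q + connection D y q' := by
  simp only [connection, mapCoeff_add]
  ring

theorem connection_sum {ι : Type*} (s : Finset ι) (q : ι → K[X]) :
    connection D y (∑ i ∈ s, q i) = ∑ i ∈ s, connection D y (q i) := by
  classical
  induction s using Finset.induction_on with
  | empty => simp [connection_zero]
  | insert a s ha ih => rw [Finset.sum_insert ha, Finset.sum_insert ha, connection_add, ih]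

theorem connection_C_mul (c : K) (q : K[X]) :
    connection D y (C c * q) = C (D c) * q + C c * connection D y q := by
  simp only [connection, mapCoeff_C_mul]
  ring

theorem derivative_mapCoeff (q : K[X]) :
    derivative (mapCoeff D q) = mapCoeff D (derivative q) := by
  ext n
  simp only [coeff_mapCoeff, coeff_derivative, Derivation.leibniz, smul_eq_mul]
  have h : D ((n : K) + 1) = 0 := by
    rw [← Nat.cast_succ, Derivation.map_natCast]
  rw [h]
  ring

theorem derivative_connection (q : K[X]) :
    derivative (connection D y q) = connection D y (derivative q) - C y * q := by
  simp only [connection, derivative_sub, derivative_mul, derivative_X, derivative_C,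
    derivative_mapCoeff]
  ring

/-- The derivative of `(D - t y)ⁿ 1` with respect to `t`. For `n = p` only the term `j = p - 1`
survives, so that `(D - t y)^p 1` is a polynomial with the two terms `(-y)^p t^p` and
`-(D^{p-1} y) t`. -/
theorem derivative_connection_iterate (n : ℕ) :
    derivative ((connection D y)^[n] 1) = -∑ j ∈ Finset.range n,
      C ((n.choose (j + 1) : ℕ) * D^[j] y) * (connection D y)^[n - 1 - j] 1 := by
  induction n with
  | zero => simp
  | succ n ih =>
    have hneg : ∀ q, connection D y (-q) = -connection D y q := by
      intro q
      have h := connection_add D y (-q) q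
      rw [neg_add_cancel, connection_zero] at h
      exact eq_neg_of_add_eq_zero_left h.symm
    rw [Function.iterate_succ_apply', derivative_connection, ih, hneg, connection_sum]
    have h1 : ∀ j ∈ Finset.range n,
        connection D y (C ((n.choose (j + 1) : ℕ) * D^[j] y) * (connection D y)^[n - 1 - j] 1)
        = C ((n.choose (j + 1) : ℕ) * D^[j + 1] y) * (connection D y)^[n - (j + 1)] 1
          + C ((n.choose (j + 1) : ℕ) * D^[j] y) * (connection D y)^[n - j] 1 := by
      intro j hj
      have hj' := Finset.mem_range.1 hj
      rw [connection_C_mul, ← Function.iterate_succ_apply' (connection D y),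
        Function.iterate_succ_apply' D, Derivation.leibniz, Derivation.map_natCast,
        show n - 1 - j = n - (j + 1) by omega, show (n - (j + 1)).succ = n - j by omega]
      simp
    have h2 : ∀ j ∈ Finset.range (n + 1),
        C (((n + 1).choose (j + 1) : ℕ) * D^[j] y) * (connection D y)^[n + 1 - 1 - j] 1
        = C ((n.choose j : ℕ) * D^[j] y) * (connection D y)^[n - j] 1
          + C ((n.choose (j + 1) : ℕ) * D^[j] y) * (connection D y)^[n - j] 1 := by
      intro j _
      rw [Nat.choose_succ_succ, Nat.add_sub_cancel]
      push_cast
      rw [add_mul, map_add, add_mul]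
    rw [Finset.sum_congr rfl h1, Finset.sum_congr rfl h2, Finset.sum_add_distrib,
      Finset.sum_add_distrib, Finset.sum_range_succ' (fun j => C ((n.choose j : ℕ) * D^[j] y) *
        (connection D y)^[n - j] 1), Finset.sum_range_succ (fun j => C ((n.choose (j + 1) : ℕ) *
        D^[j] y) * (connection D y)^[n - j] 1)]
    simp
    ring

theorem coeff_connection_succ (q : K[X]) (n : ℕ) :
    (connection D y q).coeff (n + 1) = D (q.coeff (n + 1)) - y * q.coeff n := by
  rw [connection, coeff_sub, coeff_mapCoeff, coeff_X_mul, coeff_C_mul]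

theorem coeff_zero_connection_iterate {n : ℕ} (hn : n ≠ 0) :
    ((connection D y)^[n] 1).coeff 0 = 0 := by
  have h : ∀ q, (connection D y q).coeff 0 = D (q.coeff 0) := by
    intro q
    rw [connection, coeff_sub, coeff_mapCoeff, mul_coeff_zero]
    simp
  obtain ⟨m, rfl⟩ := Nat.exists_eq_succ_of_ne_zero hn
  clear hn
  induction m with
  | zero => simp [h]
  | succ m ih => rw [Function.iterate_succ_apply', h, ih, map_zero]

theorem coeff_connection_iterate (n : ℕ) :
    (∀ m, n < m → ((connection D y)^[n] 1).coeff m = 0) ∧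
      ((connection D y)^[n] 1).coeff n = (-y) ^ n := by
  induction n with
  | zero =>
    refine ⟨fun m hm => ?_, by simp⟩
    rw [Function.iterate_zero_apply, coeff_one, if_neg hm.ne']
  | succ n ih =>
    constructor
    · intro m hm
      obtain ⟨m, rfl⟩ := Nat.exists_eq_succ_of_ne_zero (Nat.ne_zero_of_lt hm)
      rw [Function.iterate_succ_apply', coeff_connection_succ, ih.1 _ (by omega),
        ih.1 _ (by omega)]
      simp
    · rw [Function.iterate_succ_apply', coeff_connection_succ, ih.1 _ (by omega), ih.2]
      simp [pow_succ]
      ring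

/-- **Jacobson's formula** for `(D - y)^p`, applied to `1`. -/
theorem eval_connection_iterate {p : ℕ} [hp : Fact p.Prime] [CharP K p] :
    ((connection D y)^[p] 1).eval 1 = (-y) ^ p - D^[p - 1] y := by
  have hp2 := hp.out.two_le
  set q := (connection D y)^[p] 1 with hq
  have hder : derivative q = -C (D^[p - 1] y) := by
    rw [hq, derivative_connection_iterate, show p = p - 1 + 1 by omega, Finset.sum_range_succ,
      Finset.sum_eq_zero, show p - 1 + 1 = p by omega]
    · simp
    · intro j hj
      have hj' := Finset.mem_range.1 hj
      rw [show p - 1 + 1 = p by omega,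
        (CharP.cast_eq_zero_iff K p _).2 (hp.out.dvd_choose_self (by omega) (by omega))]
      simp
  have hcoeff : ∀ i, q.coeff (i + 1) * (i + 1) = if i = 0 then -D^[p - 1] y else 0 := by
    intro i
    rw [← coeff_derivative, hder, coeff_neg, coeff_C]
    split_ifs <;> simp
  have hdeg : q.natDegree < p + 1 := by
    rw [Nat.lt_succ_iff, natDegree_le_iff_coeff_eq_zero]
    exact (coeff_connection_iterate D y p).1
  rw [eval_eq_sum_range' hdeg, Finset.sum_range_succ]
  simp only [one_pow, mul_one]
  rw [hq, (coeff_connection_iterate D y p).2, ← hq, Finset.sum_eq_single 1]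
  · have h := hcoeff 0
    simp only [Nat.cast_zero, zero_add, mul_one, if_true] at h
    rw [h]
    ring
  · intro i hi hi1
    have hi' := Finset.mem_range.1 hi
    rcases i with _ | i
    · rw [hq]; exact coeff_zero_connection_iterate D y hp.out.ne_zero
    have h := hcoeff i
    rw [if_neg (by omega)] at h
    refine (mul_eq_zero.1 h).resolve_right ?_
    intro h0
    rw [← Nat.cast_succ, CharP.cast_eq_zero_iff K p] at h0
    exact Nat.not_dvd_of_pos_of_lt (by omega) (by omega) h0
  · intro h
    exact absurd (Finset.mem_range.2 (by omega)) h

/-- A form `y dx` with `D^{p-1} y = -y^p` is logarithmic: by Jacobson's formula, `D - y` is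
nilpotent on `1`, and the last nonzero iterate is the required `f`. -/
theorem exists_derivation_eq_mul {p : ℕ} [hp : Fact p.Prime] (hp2 : p ≠ 2) [CharP K p]
    (h : D^[p - 1] y = -y ^ p) : ∃ f : K, f ≠ 0 ∧ D f = y * f := by
  have heval : ∀ q, (connection D y q).eval 1 = D (q.eval 1) - y * q.eval 1 := by
    intro q
    rw [connection, eval_sub, eval_mul, eval_X, one_mul, eval_mul, eval_C]
    congr 1
    rw [mapCoeff, Polynomial.sum, eval_finsetSum, eval_eq_sum, Polynomial.sum, map_sum]
    simp
  have hzero : ((connection D y)^[p] 1).eval 1 = 0 := by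
    rw [eval_connection_iterate, h, (hp.out.odd_of_ne_two hp2).neg_pow]
    ring
  classical
  have hex : ∃ n, ((connection D y)^[n] 1).eval 1 = 0 := ⟨p, hzero⟩
  have hpos : Nat.find hex ≠ 0 := by
    intro h0
    have := Nat.find_spec hex
    rw [h0] at this
    simp at this
  obtain ⟨m, hm⟩ := Nat.exists_eq_succ_of_ne_zero hpos
  refine ⟨((connection D y)^[m] 1).eval 1, Nat.find_min hex (by omega), ?_⟩
  have h1 := Nat.find_spec hex
  rw [hm, Function.iterate_succ_apply', heval] at h1
  exact sub_eq_zero.1 h1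

end Jacobson

/-! ### The derivation `d/dx` of a function field -/

section RatDeriv

variable {k : Type u} [Field k]

local notation "ι" => algebraMap k[X] (RatFunc k)

theorem algebraMap_ratFunc_ne_zero {a : k[X]} (ha : a ≠ 0) : ι a ≠ 0 := by
  simpa using ha

theorem ratDeriv_div (a : k[X]) {b : k[X]} (hb : b ≠ 0) :
    ratDeriv (ι a / ι b) = (ι (derivative a) * ι b - ι a * ι (derivative b)) / ι b ^ 2 := by
  set f := ι a / ι b with hf
  have hd : ι f.denom ≠ 0 := algebraMap_ratFunc_ne_zero f.denom_ne_zero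
  have hb' : ι b ≠ 0 := algebraMap_ratFunc_ne_zero hb
  have h1 : f.num * b = a * f.denom := by
    apply RatFunc.algebraMap_injective k
    have h := f.num_div_denom
    rw [hf, div_eq_div_iff (by rwa [← hf]) hb'] at h
    rw [map_mul, map_mul]
    exact h
  have h2 := congrArg (fun q => ι (derivative q)) h1
  simp only [derivative_mul, map_add, map_mul] at h2
  have h1' := congrArg ι h1
  rw [map_mul, map_mul] at h1'
  rw [ratDeriv, div_eq_div_iff (pow_ne_zero 2 hd) (pow_ne_zero 2 hb')]
  linear_combination (ι b * ι f.denom) * h2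
    - (ι b * ι (derivative f.denom) + ι (derivative b) * ι f.denom) * h1'

/-- The derivation `d/dx` of `k(x)`. -/
def ratDerivation : Derivation k (RatFunc k) (RatFunc k) where
  toFun := ratDeriv
  map_add' f g := by
    have hd := algebraMap_ratFunc_ne_zero f.denom_ne_zero
    have he := algebraMap_ratFunc_ne_zero g.denom_ne_zero
    have h : f + g = ι (f.num * g.denom + g.num * f.denom) / ι (f.denom * g.denom) := by
      conv_lhs => rw [← f.num_div_denom, ← g.num_div_denom]
      rw [map_mul, map_add, map_mul, map_mul]
      field_simp
    rw [h, ratDeriv_div _ (mul_ne_zero f.denom_ne_zero g.denom_ne_zero), ratDeriv, ratDeriv]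
    simp only [derivative_mul, map_add, map_mul]
    field_simp
    ring
  map_smul' c f := by
    have hd := algebraMap_ratFunc_ne_zero f.denom_ne_zero
    have h : c • f = ι (C c * f.num) / ι f.denom := by
      conv_lhs => rw [← f.num_div_denom]
      rw [map_mul, RatFunc.algebraMap_C, Algebra.smul_def, RatFunc.algebraMap_eq_C, mul_div_assoc]
    rw [h, ratDeriv_div _ f.denom_ne_zero, ratDeriv]
    simp only [derivative_C_mul, map_mul, RatFunc.algebraMap_C, RingHom.id_apply]
    rw [Algebra.smul_def, RatFunc.algebraMap_eq_C]
    ring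
  map_one_eq_zero' := by
    simp [ratDeriv]
  leibniz' f g := by
    have hd := algebraMap_ratFunc_ne_zero f.denom_ne_zero
    have he := algebraMap_ratFunc_ne_zero g.denom_ne_zero
    have h : f * g = ι (f.num * g.num) / ι (f.denom * g.denom) := by
      conv_lhs => rw [← f.num_div_denom, ← g.num_div_denom]
      rw [map_mul, map_mul]
      field_simp
    change ratDeriv (f * g) = f * ratDeriv g + g * ratDeriv f
    conv_rhs => rw [← f.num_div_denom, ← g.num_div_denom]
    rw [h, ratDeriv_div _ (mul_ne_zero f.denom_ne_zero g.denom_ne_zero),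
      ratDeriv_div _ f.denom_ne_zero, ratDeriv_div _ g.denom_ne_zero]
    simp only [derivative_mul, map_add, map_mul]
    field_simp
    ring

theorem coe_ratDerivation : (ratDerivation : RatFunc k → RatFunc k) = ratDeriv := rfl

theorem ratDeriv_algebraMap (a : k[X]) : ratDeriv (ι a) = ι (derivative a) := by
  have h := ratDeriv_div a (one_ne_zero (α := k[X]))
  simpa using h

theorem iterate_ratDeriv_algebraMap (n : ℕ) (a : k[X]) :
    ratDeriv^[n] (ι a) = ι (derivative^[n] a) := by
  induction n with
  | zero => rfl
  | succ n ih => rw [Function.iterate_succ_apply', ih, ratDeriv_algebraMap,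
      Function.iterate_succ_apply']

theorem ratDeriv_mul (f g : RatFunc k) : ratDeriv (f * g) = f * ratDeriv g + g * ratDeriv f :=
  ratDerivation.leibniz f g

theorem ratDeriv_add (f g : RatFunc k) : ratDeriv (f + g) = ratDeriv f + ratDeriv g :=
  ratDerivation.map_add f g

theorem iterate_derivation_mul_of_eq_zero {K : Type*} [Field K] [Algebra k K]
    (D : Derivation k K K) {c : K} (hc : D c = 0) (f : K) (n : ℕ) :
    D^[n] (c * f) = c * D^[n] f := by
  induction n with
  | zero => rfl
  | succ n ih => rw [Function.iterate_succ_apply', ih, Function.iterate_succ_apply', D.leibniz, hc,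
      smul_zero, add_zero, smul_eq_mul]

end RatDeriv

section Kaehler

variable {k : Type u} [Field k] {K : Type u} [Field K] [Algebra k K] [Algebra (RatFunc k) K]
  [IsScalarTower k (RatFunc k) K] [Algebra.IsSeparable (RatFunc k) K]

/-- The differentials of a function field are one-dimensional, with basis `dx`. -/
theorem exists_kaehlerDifferential_equiv : ∃ ψ : Ω[K⁄k] ≃ₗ[K] K,
    ψ (KaehlerDifferential.D k K (algebraMap (RatFunc k) K RatFunc.X)) = 1 := by
  let _ : Algebra k[X] K :=
    ((algebraMap (RatFunc k) K).comp (algebraMap k[X] (RatFunc k))).toAlgebra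
  have : IsScalarTower k[X] (RatFunc k) K := IsScalarTower.of_algebraMap_eq' rfl
  have : IsScalarTower k k[X] K := by
    refine IsScalarTower.of_algebraMap_eq fun c => ?_
    rw [IsScalarTower.algebraMap_apply k (RatFunc k) K,
      IsScalarTower.algebraMap_apply k[X] (RatFunc k) K,
      ← IsScalarTower.algebraMap_apply k k[X] (RatFunc k)]
  have : Algebra.FormallyEtale k[X] (RatFunc k) :=
    Algebra.FormallyEtale.of_isLocalization (nonZeroDivisors k[X])
  have : Algebra.FormallyEtale (RatFunc k) K := Algebra.FormallyEtale.of_isSeparable _ _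
  have : Algebra.FormallyEtale k[X] K := Algebra.FormallyEtale.comp k[X] (RatFunc k) K
  let e₁ := (KaehlerDifferential.tensorKaehlerEquivOfFormallyEtale k k[X] K).symm
  let e₂ := (KaehlerDifferential.polynomialEquiv k).baseChange k[X] K _ _
  let e₃ := TensorProduct.AlgebraTensorModule.rid k[X] K K
  refine ⟨e₁ ≪≫ₗ e₂ ≪≫ₗ e₃, ?_⟩
  have h : algebraMap (RatFunc k) K RatFunc.X = algebraMap k[X] K X := by
    rw [IsScalarTower.algebraMap_apply k[X] (RatFunc k) K, RatFunc.algebraMap_X]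
  rw [h, LinearEquiv.trans_apply, LinearEquiv.trans_apply,
    KaehlerDifferential.tensorKaehlerEquivOfFormallyEtale_symm_D_algebraMap]
  simp [e₂, e₃, LinearEquiv.baseChange]

/-- The derivation `d/dx` of `k(x)` extends to its separable extensions. -/
theorem exists_derivation : ∃ δ : Derivation k K K,
    (∀ f : RatFunc k, δ (algebraMap (RatFunc k) K f) = algebraMap (RatFunc k) K (ratDeriv f)) ∧
    (∀ f : K, KaehlerDifferential.D k K f
      = δ f • KaehlerDifferential.D k K (algebraMap (RatFunc k) K RatFunc.X)) ∧
    KaehlerDifferential.D k K (algebraMap (RatFunc k) K RatFunc.X) ≠ 0 := by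
  obtain ⟨ψ, hψ⟩ := exists_kaehlerDifferential_equiv (k := k) (K := K)
  let δ : Derivation k K K := ψ.toLinearMap.compDer (KaehlerDifferential.D k K)
  have hδ : ∀ f, δ f = ψ (KaehlerDifferential.D k K f) := fun f => rfl
  refine ⟨δ, ?_, ?_, ?_⟩
  · have hC : ∀ c : k, δ (algebraMap (RatFunc k) K (RatFunc.C c)) = 0 := by
      intro c
      rw [← RatFunc.algebraMap_eq_C, ← IsScalarTower.algebraMap_apply, δ.map_algebraMap]
    have hpoly : ∀ a : k[X], δ (algebraMap (RatFunc k) K (algebraMap k[X] (RatFunc k) a))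
        = algebraMap (RatFunc k) K (algebraMap k[X] (RatFunc k) (derivative a)) := by
      intro a
      induction a using Polynomial.induction_on' with
      | add a b ha hb => simp only [map_add, ha, hb]
      | monomial n c =>
        rw [← C_mul_X_pow_eq_monomial, map_mul, map_pow, map_mul, map_pow, RatFunc.algebraMap_C,
          RatFunc.algebraMap_X, δ.leibniz, hC, smul_zero, add_zero, δ.leibniz_pow, hδ, hψ,
          derivative_C_mul_X_pow]
        simp
        ring
    intro f
    have hd := algebraMap_ratFunc_ne_zero f.denom_ne_zero
    conv_lhs => rw [← f.num_div_denom]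
    rw [map_div₀, Derivation.leibniz_div, hpoly, hpoly, ratDeriv, map_div₀, map_sub, map_mul,
      map_mul, map_pow]
    simp only [smul_eq_mul]
    field_simp
  · intro f
    apply ψ.injective
    rw [map_smul, hψ, hδ, smul_eq_mul, mul_one]
  · intro h
    rw [h, map_zero] at hψ
    exact zero_ne_one hψ

end Kaehler

/-! ### Places of a function field over the line -/

/-- Chevalley's extension theorem: a transcendental function has a zero at some place. -/
theorem exists_place {k K : Type*} [Field k] [Field K] [Algebra k K] {t : K}
    (ht : Transcendental k t) :
    ∃ P : ValuationSubring K, (∀ b : k, algebraMap k K b ∈ P) ∧ P.valuation t < 1 := by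
  let A : Subring K := (aeval (R := k) t).range.toSubring
  have htA : t ∈ A := ⟨X, aeval_X t⟩
  have hI : Ideal.span {(⟨t, htA⟩ : A)} ≠ ⊤ := by
    intro h
    rw [Ideal.eq_top_iff_one, Ideal.mem_span_singleton'] at h
    obtain ⟨⟨_, a, rfl⟩, ha⟩ := h
    have h1 : aeval t a * t = 1 := congrArg Subtype.val ha
    apply ht
    refine ⟨a * X - 1, ?_, by rw [map_sub, map_mul, aeval_X, map_one, h1, sub_self]⟩
    intro h2
    have := congrArg (eval 0) h2
    simp at this
  obtain ⟨P, hP, hIP⟩ := Ideal.image_subset_nonunits_valuationSubring _ hI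
  refine ⟨P, fun b => hP ⟨C b, aeval_C t b⟩, ?_⟩
  exact (ValuationSubring.mem_nonunits_iff P).1
    (hIP ⟨⟨t, htA⟩, Ideal.mem_span_singleton_self _, rfl⟩)

section Degree

variable {k : Type*} [Field k]

/-- The derivative of a quotient of polynomials of the same degree `n` has a pole of order at
most `-2` at infinity: the leading terms do not contribute to the numerator. -/
theorem natDegree_wronskian_le {a b : k[X]} {n : ℕ} (ha : a.natDegree = n) (hb : b.natDegree = n)
    (hb0 : b ≠ 0) :
    (derivative a * b - a * derivative b).natDegree ≤ 2 * n - 2 := by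
  rcases Nat.eq_zero_or_pos n with rfl | hn
  · rw [natDegree_eq_zero] at ha hb
    obtain ⟨a, rfl⟩ := ha
    obtain ⟨b, rfl⟩ := hb
    simp
  set κ := a.leadingCoeff / b.leadingCoeff
  set E := a - C κ * b with hE
  have hlead : b.leadingCoeff ≠ 0 := leadingCoeff_ne_zero.2 hb0
  have hEdeg : E.natDegree ≤ n - 1 := by
    rw [natDegree_le_iff_coeff_eq_zero]
    intro m hm
    rw [hE, coeff_sub, coeff_C_mul]
    rcases (show n ≤ m by omega).eq_or_lt with rfl | hm'
    · have h1 : a.coeff n = a.leadingCoeff := by rw [leadingCoeff, ha]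
      have h2 : b.coeff n = b.leadingCoeff := by rw [leadingCoeff, hb]
      rw [h1, h2, div_mul_cancel₀ _ hlead, sub_self]
    · rw [coeff_eq_zero_of_natDegree_lt (by omega), coeff_eq_zero_of_natDegree_lt (by omega)]
      simp
  have h : derivative a * b - a * derivative b = derivative E * b - E * derivative b := by
    rw [hE]
    simp only [derivative_sub, derivative_C_mul]
    ring
  rw [h]
  refine (natDegree_sub_le _ _).trans (max_le ?_ ?_)
  · rcases Nat.eq_zero_or_pos E.natDegree with h0 | h0
    · rw [natDegree_eq_zero] at h0
      obtain ⟨e, he⟩ := h0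
      rw [← he]
      simp
    · have h1 := natDegree_derivative_le E
      have h2 := natDegree_mul_le (p := derivative E) (q := b)
      omega
  · have h1 := natDegree_derivative_le b
    have h2 := natDegree_mul_le (p := E) (q := derivative b)
    omega

end Degree

section Places

variable {k : Type u} [Field k] {K : Type u} [Field K] [Algebra k K] [Algebra (RatFunc k) K]
  [IsScalarTower k (RatFunc k) K]

/-- A polynomial, as a function on the curve. -/
def polyFun (K : Type u) [Field K] [Algebra (RatFunc k) K] : k[X] →+* K :=
  (algebraMap (RatFunc k) K).comp (algebraMap k[X] (RatFunc k))

omit [Algebra k K] [IsScalarTower k (RatFunc k) K] in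
theorem polyFun_apply (a : k[X]) :
    polyFun K a = algebraMap (RatFunc k) K (algebraMap k[X] (RatFunc k) a) := rfl

theorem polyFun_C (b : k) : polyFun K (C b) = algebraMap k K b := by
  rw [polyFun_apply, RatFunc.algebraMap_C, ← RatFunc.algebraMap_eq_C,
    ← IsScalarTower.algebraMap_apply]

omit [Algebra k K] [IsScalarTower k (RatFunc k) K] in
theorem polyFun_ne_zero {a : k[X]} (ha : a ≠ 0) : polyFun K a ≠ 0 := by
  rw [polyFun_apply, Ne, map_eq_zero]
  exact algebraMap_ratFunc_ne_zero ha

omit [Algebra k K] [IsScalarTower k (RatFunc k) K] in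
theorem polyFun_linear (c : k) :
    algebraMap (RatFunc k) K (linFactor c) = polyFun K (X - C c) := by
  rw [polyFun_apply, map_sub, RatFunc.algebraMap_X, RatFunc.algebraMap_C]
  rfl

variable (P : ValuationSubring K) (hk : ∀ b : k, algebraMap k K b ∈ P)

include hk

theorem valuation_polyFun_le_one {c : k} (hc : P.valuation (polyFun K (X - C c)) < 1)
    (a : k[X]) : P.valuation (polyFun K a) ≤ 1 := by
  have hX : polyFun K (X : k[X]) ∈ P := by
    have h1 := (ValuationSubring.valuation_le_one_iff _ _).1 hc.le
    have h2 := add_mem h1 (hk c)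
    rwa [map_sub, polyFun_C, sub_add_cancel] at h2
  rw [ValuationSubring.valuation_le_one_iff]
  induction a using Polynomial.induction_on' with
  | add a b ha hb => rw [map_add]; exact add_mem ha hb
  | monomial n b =>
    rw [← C_mul_X_pow_eq_monomial, map_mul, map_pow, polyFun_C]
    exact mul_mem (hk b) (pow_mem hX n)

theorem valuation_polyFun_lt_one {c : k} (hc : P.valuation (polyFun K (X - C c)) < 1)
    {a : k[X]} (ha : a.eval c = 0) : P.valuation (polyFun K a) < 1 := by
  obtain ⟨q, rfl⟩ := dvd_iff_isRoot.2 ha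
  rw [map_mul, map_mul]
  exact mul_lt_one_of_nonneg_of_lt_one_left zero_le hc (valuation_polyFun_le_one P hk hc q)

theorem valuation_polyFun_eq_one {c : k} (hc : P.valuation (polyFun K (X - C c)) < 1)
    {a : k[X]} (ha : a.eval c ≠ 0) : P.valuation (polyFun K a) = 1 := by
  have h := valuation_polyFun_lt_one P hk hc (a := a - C (a.eval c)) (by simp)
  have h1 := valuation_algebraMap_eq_one P hk ha
  rw [map_sub, polyFun_C] at h
  have h2 := Valuation.map_add_eq_of_lt_right P.valuation (h.trans_eq h1.symm)
  rwa [sub_add_cancel, h1] at h2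

theorem valuation_polyFun_le {a : k[X]} (hX : 1 < P.valuation (polyFun K (X : k[X]))) {n : ℕ}
    (hn : a.natDegree ≤ n) :
    P.valuation (polyFun K a) ≤ P.valuation (polyFun K (X : k[X])) ^ n := by
  rw [a.as_sum_range_C_mul_X_pow, map_sum]
  apply Valuation.map_sum_le
  intro i hi
  rw [map_mul, map_pow, map_mul, map_pow, polyFun_C]
  calc P.valuation (algebraMap k K (a.coeff i)) * P.valuation (polyFun K (X : k[X])) ^ i
      ≤ 1 * P.valuation (polyFun K (X : k[X])) ^ n := by
        refine mul_le_mul' ((ValuationSubring.valuation_le_one_iff _ _).2 (hk _)) ?_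
        exact pow_le_pow_right₀ hX.le (by have := Finset.mem_range.1 hi; omega)
    _ = _ := one_mul _

theorem valuation_polyFun_sub_lt {a : k[X]} (hX : 1 < P.valuation (polyFun K (X : k[X]))) :
    P.valuation (polyFun K a - algebraMap k K a.leadingCoeff * polyFun K (X : k[X]) ^ a.natDegree)
      < P.valuation (polyFun K (X : k[X])) ^ a.natDegree := by
  have h : polyFun K a - algebraMap k K a.leadingCoeff * polyFun K (X : k[X]) ^ a.natDegree
      = polyFun K a.eraseLead := by
    rw [← self_sub_C_mul_X_pow, map_sub, map_mul, map_pow, polyFun_C]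
  rw [h]
  rcases Nat.eq_zero_or_pos a.natDegree with h0 | h0
  · rw [natDegree_eq_zero] at h0
    obtain ⟨b, rfl⟩ := h0
    simp
  · refine lt_of_le_of_lt (valuation_polyFun_le P hk hX a.eraseLead_natDegree_le) ?_
    exact pow_lt_pow_right₀ hX (by omega)

theorem valuation_polyFun_eq {a : k[X]} (ha : a ≠ 0)
    (hX : 1 < P.valuation (polyFun K (X : k[X]))) :
    P.valuation (polyFun K a) = P.valuation (polyFun K (X : k[X])) ^ a.natDegree := by
  have h := valuation_polyFun_sub_lt P hk (a := a) hX
  have h1 := valuation_algebraMap_eq_one P hk (leadingCoeff_ne_zero.2 ha)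
  have h2 : P.valuation (algebraMap k K a.leadingCoeff * polyFun K (X : k[X]) ^ a.natDegree)
      = P.valuation (polyFun K (X : k[X])) ^ a.natDegree := by
    rw [map_mul, h1, one_mul, map_pow]
  have h3 := Valuation.map_add_eq_of_lt_right P.valuation (h.trans_eq h2.symm)
  rwa [sub_add_cancel, h2] at h3

end Places

/-! ### The order of `z dx` on a Kummer cover of the line -/

section Ramification

variable {p : ℕ} [Fact p.Prime] {k : Type u} [Field k] [IsAlgClosed k] [CharP k p] {K : Type u}
  [Field K] [Algebra k K] [Algebra (RatFunc k) K] [IsScalarTower k (RatFunc k) K]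

omit [IsAlgClosed k] in
theorem exists_liesAbove (c : OnePoint k) :
    ∃ P : ValuationSubring K, LiesAbove (k := k) P c := by
  have key : ∀ f : RatFunc k, (¬ ∃ c, f = RatFunc.C c) → ∃ P : ValuationSubring K,
      (∀ b : k, algebraMap k K b ∈ P) ∧ P.valuation (algebraMap (RatFunc k) K f) < 1 := by
    intro f hf
    apply exists_place
    exact (transcendental_algebraMap_iff (algebraMap (RatFunc k) K).injective).2
      (RatFunc.transcendental_of_ne_C f hf)
  have hX : ¬ ∃ c : k, (RatFunc.X : RatFunc k) = RatFunc.C c := by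
    rintro ⟨c, hc⟩
    rw [← RatFunc.algebraMap_X, ← RatFunc.algebraMap_C] at hc
    have := congrArg natDegree (RatFunc.algebraMap_injective k hc)
    simp at this
  cases c with
  | infty =>
    refine key RatFunc.X⁻¹ ?_
    rintro ⟨c, hc⟩
    exact hX ⟨c⁻¹, by rw [map_inv₀, ← hc, inv_inv]⟩
  | coe c =>
    refine key (linFactor c) ?_
    rintro ⟨b, hb⟩
    exact hX ⟨b + c, by rw [map_add, ← hb, linFactor, sub_add_cancel]⟩

variable [FiniteDimensional (RatFunc k) K] [IsGalois (RatFunc k) K]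
  {z : K} (hz : z ≠ 0) {A B : k[X]} (hA : A ≠ 0) (hB : B ≠ 0)
  (hzG : z ^ (p - 1) = algebraMap (RatFunc k) K
    (algebraMap k[X] (RatFunc k) A / algebraMap k[X] (RatFunc k) B))
  (hgen : IntermediateField.adjoin (RatFunc k) {z} = ⊤)

include hz hA hB hzG hgen

/-- The invariant of `z dx` at the points above a finite point `c`, where `z^{p-1} = A / B`. -/
theorem hasOrderAt_of_liesAbove_coe (c : k) (P : ValuationSubring K)
    (hP : LiesAbove (k := k) P (c : OnePoint k)) :
    ∃ n : ℤ, HasOrderAt k (z • KaehlerDifferential.D k K (algebraMap (RatFunc k) K RatFunc.X)) P n ∧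
      ((A.rootMultiplicity c : ℚ) - B.rootMultiplicity c) / ((p : ℚ) - 1) + 1
        = ((n : ℚ) + 1) / (Nat.card (P.decompositionSubgroup (RatFunc k)) : ℚ) := by
  obtain ⟨hk, hc'⟩ := hP
  have hc := hc'
  rw [polyFun_linear] at hc
  obtain ⟨δ, hδ, hD, -⟩ := exists_derivation (k := k) (K := K)
  have hfac : ∀ a : k[X], a ≠ 0 → ∃ b : k[X], b.eval c ≠ 0 ∧
      algebraMap k[X] (RatFunc k) a
        = linFactor c ^ a.rootMultiplicity c * algebraMap k[X] (RatFunc k) b := by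
    intro a ha
    obtain ⟨q, hq, hq'⟩ := exists_eq_pow_rootMultiplicity_mul_and_not_dvd a ha c
    refine ⟨q, fun h => hq' (dvd_iff_isRoot.2 h), ?_⟩
    conv_lhs => rw [hq, map_mul, map_pow, map_sub, RatFunc.algebraMap_X, RatFunc.algebraMap_C]
    rfl
  have ht₀ : linFactor c ≠ 0 := by
    have : algebraMap k[X] (RatFunc k) (X - C c) ≠ 0 :=
      algebraMap_ratFunc_ne_zero (X_sub_C_ne_zero c)
    rwa [map_sub, RatFunc.algebraMap_X, RatFunc.algebraMap_C] at this
  obtain ⟨A₁, hA₁, hA'⟩ := hfac A hA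
  obtain ⟨B₁, hB₁, hB'⟩ := hfac B hB
  have hB₁0 : B₁ ≠ 0 := by
    rintro rfl
    simp at hB₁
  have hB₁' := algebraMap_ratFunc_ne_zero hB₁0
  have hDt : KaehlerDifferential.D k K (algebraMap (RatFunc k) K (linFactor c))
      = KaehlerDifferential.D k K (algebraMap (RatFunc k) K RatFunc.X) := by
    rw [linFactor, map_sub, map_sub, ← RatFunc.algebraMap_eq_C, ← IsScalarTower.algebraMap_apply,
      Derivation.map_algebraMap, sub_zero]
  have hvB := valuation_polyFun_eq_one P hk hc hB₁
  have h := hasOrderAt_kummer (p := p) (k := k) hz hzG hgen P hk ht₀ hc'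
    (U := algebraMap k[X] (RatFunc k) A₁ / algebraMap k[X] (RatFunc k) B₁)
    (s := A.rootMultiplicity c - B.rootMultiplicity c) (b := A₁.eval c / B₁.eval c)
    (W := algebraMap (RatFunc k) K (ratDeriv
      (algebraMap k[X] (RatFunc k) A₁ / algebraMap k[X] (RatFunc k) B₁))) ?_ ?_ ?_ ?_ ?_ ?_ 0
  · obtain ⟨n, hn, hn'⟩ := h
    refine ⟨n, ?_, ?_⟩
    · rwa [zpow_zero, mul_one, hDt] at hn
    · rw [← hn']
      push_cast
      ring
  · intro f hf
    obtain ⟨a, ha, ha'⟩ := hfac f.num (RatFunc.num_ne_zero hf)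
    obtain ⟨b, hb, hb'⟩ := hfac f.denom f.denom_ne_zero
    refine ⟨f.num.rootMultiplicity c - f.denom.rootMultiplicity c, ?_⟩
    conv_lhs => rw [← f.num_div_denom, ha', hb', map_div₀, map_mul, map_mul, map_div₀, map_mul,
      map_mul, ← polyFun_apply, ← polyFun_apply, valuation_polyFun_eq_one P hk hc ha,
      valuation_polyFun_eq_one P hk hc hb, mul_one, mul_one]
    rw [zpow_sub₀]
    · simp
    · rw [Valuation.ne_zero_iff]
      simpa using ht₀
  · rw [hA', hB', zpow_sub₀ ht₀, zpow_natCast, zpow_natCast]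
    field_simp
  · exact div_ne_zero hA₁ hB₁
  · have h1 := valuation_polyFun_lt_one P hk hc
      (a := A₁ * C (B₁.eval c) - C (A₁.eval c) * B₁) (by simp)
    have h2 := valuation_algebraMap_eq_one P hk hB₁
    have h3 := polyFun_ne_zero (K := K) hB₁0
    have h4 : algebraMap (RatFunc k) K
          (algebraMap k[X] (RatFunc k) A₁ / algebraMap k[X] (RatFunc k) B₁)
          - algebraMap k K (A₁.eval c / B₁.eval c)
        = polyFun K (A₁ * C (B₁.eval c) - C (A₁.eval c) * B₁)
          / (polyFun K B₁ * algebraMap k K (B₁.eval c)) := by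
      have h5 : algebraMap k K (B₁.eval c) ≠ 0 := by simpa using hB₁
      rw [map_div₀, map_div₀, ← polyFun_apply, ← polyFun_apply, map_sub, map_mul, map_mul,
        polyFun_C, polyFun_C]
      field_simp
    rw [h4, map_div₀, map_mul, hvB, h2, mul_one, div_one]
    exact h1
  · rw [ratDeriv_div _ hB₁0, map_div₀, map_div₀, map_pow, map_pow, ← polyFun_apply, hvB, one_pow,
      div_one, ← map_mul, ← map_mul, ← map_sub, ← polyFun_apply]
    exact valuation_polyFun_le_one P hk hc _
  · rw [hD, hδ, hDt]

/-- The invariant of `z dx` at the points above `∞`, where `z^{p-1} = A / B`. In terms of the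
parameter `1/x`, the form `dx` contributes the exponent `-2`. -/
theorem hasOrderAt_of_liesAbove_infty (P : ValuationSubring K)
    (hP : LiesAbove (k := k) P (OnePoint.infty : OnePoint k)) :
    ∃ n : ℤ, HasOrderAt k (z • KaehlerDifferential.D k K (algebraMap (RatFunc k) K RatFunc.X)) P n ∧
      ((B.natDegree : ℚ) - A.natDegree) / ((p : ℚ) - 1) - 1
        = ((n : ℚ) + 1) / (Nat.card (P.decompositionSubgroup (RatFunc k)) : ℚ) := by
  obtain ⟨hk, hc⟩ := hP
  obtain ⟨δ, hδ, hD, -⟩ := exists_derivation (k := k) (K := K)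
  have hX0 : (RatFunc.X : RatFunc k) ≠ 0 := RatFunc.X_ne_zero
  have hXK : polyFun K (X : k[X]) = algebraMap (RatFunc k) K RatFunc.X := by
    rw [polyFun_apply, RatFunc.algebraMap_X]
  set ξ : K := algebraMap (RatFunc k) K RatFunc.X with hξ
  have hξ0 : ξ ≠ 0 := by simpa [hξ] using hX0
  have hvξ : P.valuation ξ ≠ 0 := (Valuation.ne_zero_iff _).2 hξ0
  have hX : 1 < P.valuation (polyFun K (X : k[X])) := by
    rw [hXK]
    rw [map_inv₀, map_inv₀] at hc
    exact (inv_lt_one₀ (zero_lt_iff.2 hvξ)).1 hc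
  have hDt : KaehlerDifferential.D k K ξ = (-ξ ^ 2) •
      KaehlerDifferential.D k K (algebraMap (RatFunc k) K RatFunc.X⁻¹) := by
    rw [map_inv₀, Derivation.leibniz_inv, smul_smul, ← hξ]
    field_simp
    simp
  have hA' := algebraMap_ratFunc_ne_zero hA
  have hB' := algebraMap_ratFunc_ne_zero hB
  have hlA := leadingCoeff_ne_zero.2 hA
  have hlB := leadingCoeff_ne_zero.2 hB
  -- the unit part of `A / B` at infinity, as a quotient of polynomials of the same degree;
  -- the extra factor `x` makes this degree positive
  set N := A.natDegree + B.natDegree + 1 with hN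
  set A₂ := A * X ^ (B.natDegree + 1) with hA₂
  set B₂ := B * X ^ (A.natDegree + 1) with hB₂
  have hA₂0 : A₂ ≠ 0 := mul_ne_zero hA (pow_ne_zero _ X_ne_zero)
  have hB₂0 : B₂ ≠ 0 := mul_ne_zero hB (pow_ne_zero _ X_ne_zero)
  have hA₂deg : A₂.natDegree = N := by
    rw [hA₂, natDegree_mul hA (pow_ne_zero _ X_ne_zero), natDegree_X_pow, hN]
    ring
  have hB₂deg : B₂.natDegree = N := by
    rw [hB₂, natDegree_mul hB (pow_ne_zero _ X_ne_zero), natDegree_X_pow, hN]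
    ring
  have hlA₂ : A₂.leadingCoeff = A.leadingCoeff := by
    rw [hA₂, leadingCoeff_mul, leadingCoeff_X_pow, mul_one]
  have hlB₂ : B₂.leadingCoeff = B.leadingCoeff := by
    rw [hB₂, leadingCoeff_mul, leadingCoeff_X_pow, mul_one]
  have hvB₂ := valuation_polyFun_eq P hk hB₂0 hX
  rw [hB₂deg] at hvB₂
  have hB₂K := polyFun_ne_zero (K := K) hB₂0
  have h := hasOrderAt_kummer (p := p) (k := k) hz hzG hgen P hk (inv_ne_zero hX0) hc
    (U := algebraMap k[X] (RatFunc k) A₂ / algebraMap k[X] (RatFunc k) B₂)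
    (s := B.natDegree - A.natDegree) (b := A.leadingCoeff / B.leadingCoeff)
    (W := algebraMap (RatFunc k) K (ratDeriv
      (algebraMap k[X] (RatFunc k) A₂ / algebraMap k[X] (RatFunc k) B₂)) * (-ξ ^ 2))
    ?_ ?_ ?_ ?_ ?_ ?_ (-2)
  · obtain ⟨n, ⟨t, w, ht, hw, h1⟩, hn'⟩ := h
    refine ⟨n, ⟨t, -w, ht, by rw [Valuation.map_neg, hw], ?_⟩, ?_⟩
    · rw [mul_neg, neg_smul, ← h1, hDt, smul_smul, ← neg_smul, map_inv₀, ← hξ]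
      congr 1
      rw [inv_zpow, ← zpow_neg, neg_neg]
      norm_cast
      ring
    · rw [← hn']
      push_cast
      ring
  · intro f hf
    refine ⟨f.denom.natDegree - f.num.natDegree, ?_⟩
    conv_lhs => rw [← f.num_div_denom, map_div₀, map_div₀, ← polyFun_apply, ← polyFun_apply,
      valuation_polyFun_eq P hk (RatFunc.num_ne_zero hf) hX,
      valuation_polyFun_eq P hk f.denom_ne_zero hX, hXK]
    rw [map_inv₀, map_inv₀, ← hξ, inv_zpow, ← zpow_neg, neg_sub, zpow_sub₀ hvξ, zpow_natCast,
      zpow_natCast]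
  · rw [hA₂, hB₂, inv_zpow, ← zpow_neg, neg_sub, zpow_sub₀ hX0, zpow_natCast, zpow_natCast]
    simp only [map_mul, map_pow, RatFunc.algebraMap_X]
    field_simp
    ring
  · exact div_ne_zero hlA hlB
  · have h1 := valuation_polyFun_sub_lt P hk (a := A₂) hX
    have h2 := valuation_polyFun_sub_lt P hk (a := B₂) hX
    rw [hA₂deg, hlA₂] at h1
    rw [hB₂deg, hlB₂] at h2
    have h3 : algebraMap (RatFunc k) K
          (algebraMap k[X] (RatFunc k) A₂ / algebraMap k[X] (RatFunc k) B₂)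
          - algebraMap k K (A.leadingCoeff / B.leadingCoeff)
        = ((polyFun K A₂ - algebraMap k K A.leadingCoeff * polyFun K (X : k[X]) ^ N)
          - algebraMap k K (A.leadingCoeff / B.leadingCoeff) *
            (polyFun K B₂ - algebraMap k K B.leadingCoeff * polyFun K (X : k[X]) ^ N))
          / polyFun K B₂ := by
      have h5 : algebraMap k K B.leadingCoeff ≠ 0 := by simpa using hB
      rw [map_div₀, map_div₀, ← polyFun_apply, ← polyFun_apply]
      field_simp
      ring
    rw [h3, map_div₀, hvB₂, div_lt_one₀ (pow_pos (zero_lt_one.trans hX) N)]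
    refine lt_of_le_of_lt (Valuation.map_sub _ _ _) (max_lt h1 ?_)
    rw [map_mul, valuation_algebraMap_eq_one P hk (div_ne_zero hlA hlB), one_mul]
    exact h2
  · have h1 := valuation_polyFun_le P hk hX (natDegree_wronskian_le hA₂deg hB₂deg hB₂0)
    rw [ratDeriv_div _ hB₂0, map_mul, map_div₀, map_div₀, map_pow, map_pow, ← polyFun_apply, hvB₂,
      ← map_mul, ← map_mul, ← map_sub, ← polyFun_apply, Valuation.map_neg, map_pow, ← hXK,
      ← pow_mul, div_mul_eq_mul_div, div_le_one₀ (pow_pos (zero_lt_one.trans hX) _)]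
    calc _ ≤ P.valuation (polyFun K (X : k[X])) ^ (2 * N - 2)
          * P.valuation (polyFun K (X : k[X])) ^ 2 := by gcongr
      _ = _ := by
        rw [← pow_add]
        congr 1
        omega
  · rw [hD, hδ, hDt, smul_smul]

end Ramification

/-! ### Polynomials in characteristic `p` -/

section CharP

variable {k : Type u} [Field k] {p : ℕ} [Fact p.Prime] [CharP k p]

omit [Fact p.Prime] in
theorem derivative_pow_char (f : k[X]) : derivative (f ^ p) = 0 := by
  rw [derivative_pow]; simp

omit [Fact p.Prime] in
theorem iterate_derivative_pow_char_mul (f g : k[X]) (n : ℕ) :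
    derivative^[n] (f ^ p * g) = f ^ p * derivative^[n] g := by
  induction n with
  | zero => rfl
  | succ n ih =>
    rw [Function.iterate_succ_apply', ih, derivative_mul, derivative_pow_char,
      Function.iterate_succ_apply']
    simp

/-- Over a perfect field, a polynomial with vanishing derivative is a `p`-th power. -/
theorem exists_pow_char_eq [PerfectRing k p] {f : k[X]} (hf : derivative f = 0) :
    ∃ g : k[X], f = g ^ p := by
  have hp : p ≠ 0 := (Fact.out : p.Prime).ne_zero
  refine ⟨(contract p f).map ((frobeniusEquiv k p).symm : k →+* k), ?_⟩
  rw [← map_frobenius_expand, map_expand, Polynomial.map_map]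
  have : (frobenius k p).comp ((frobeniusEquiv k p).symm : k →+* k) = RingHom.id k := by
    ext a; simp
  rw [this, Polynomial.map_id, expand_contract p hf hp]

theorem iterate_derivative_char (f : k[X]) : derivative^[p] f = 0 := by
  have h := congrArg (fun F => F f) (factorial_smul_hasseDeriv (R := k) (k := p))
  refine h.symm.trans ?_
  have h0 : ((p.factorial : ℕ) : k) = 0 :=
    (CharP.cast_eq_zero_iff k p _).2 ((Fact.out : p.Prime).dvd_factorial.2 le_rfl)
  change p.factorial • hasseDeriv p f = 0
  rw [← Nat.cast_smul_eq_nsmul k, h0, zero_smul]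

/-- `D^{p-1}` is injective on the monomials `x^n` with `n ≡ -1 (mod p)`. -/
theorem coeff_eq_zero_of_coeff_iterate_derivative {f : k[X]} {n : ℕ} (hdvd : p ∣ n + 1)
    (h : (derivative^[p - 1] f).coeff (n - (p - 1)) = 0) : f.coeff n = 0 := by
  have hp : p.Prime := Fact.out
  have hle := Nat.le_of_dvd n.succ_pos hdvd
  rw [coeff_iterate_derivative, Nat.sub_add_cancel (by omega), ← Nat.cast_smul_eq_nsmul k,
    smul_eq_mul] at h
  refine (mul_eq_zero.1 h).resolve_left fun h => ?_
  rw [CharP.cast_eq_zero_iff k p, Nat.descFactorial_eq_prod_range,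
    hp.prime.dvd_finsetProd_iff] at h
  obtain ⟨i, hi, hdi⟩ := h
  rw [Finset.mem_range] at hi
  have h2 : p ∣ (n + 1) - (n - i) := Nat.dvd_sub hdvd hdi
  have h3 := Nat.le_of_dvd (by omega) h2
  omega

/-- A polynomial killed by `D^{p-1}` is a derivative: it has no monomials `x^n` with
`n ≡ -1 (mod p)`. -/
theorem exists_derivative_eq {f : k[X]} (hf : derivative^[p - 1] f = 0) :
    ∃ F : k[X], derivative F = f := by
  have hp : p.Prime := Fact.out
  refine ⟨∑ n ∈ Finset.range (f.natDegree + 1),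
    monomial (n + 1) (f.coeff n / ((n + 1 : ℕ) : k)), ?_⟩
  rw [derivative_sum]
  conv_rhs => rw [f.as_sum_range]
  refine Finset.sum_congr rfl fun n _ => ?_
  rw [derivative_monomial, Nat.add_sub_cancel]
  congr 1
  by_cases hn : ((n + 1 : ℕ) : k) = 0
  · rw [coeff_eq_zero_of_coeff_iterate_derivative ((CharP.cast_eq_zero_iff k p _).1 hn)
      (by rw [hf, coeff_zero])]
    simp
  · rw [div_mul_cancel₀ _ hn]

/-- Up to a factor, the value of `D^{p-1}` at `c` is the coefficient of `(x - c)^{p-1}` in the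
expansion at `c`; for `(x - c)^{p-2} V` this is `V'(c)`. -/
theorem eval_iterate_derivative (c : k) (V : k[X]) :
    (derivative^[p - 1] ((X - C c) ^ (p - 2) * V)).eval c
      = ((p - 1).factorial : k) * (derivative V).eval c := by
  have hp : p.Prime := Fact.out
  have h2 := hp.two_le
  obtain ⟨W, hW⟩ := (dvd_iff_isRoot (p := V - C (V.eval c)) (a := c)).2 (by simp)
  have h3 : W.eval c = (derivative V).eval c := by
    have h4 := congrArg (fun f => (derivative f).eval c) hW
    simpa [derivative_mul] using h4.symm
  obtain ⟨W', hW'⟩ := (dvd_iff_isRoot (p := W - C (W.eval c)) (a := c)).2 (by simp)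
  have hV' : V = C (V.eval c) + (X - C c) * (C (W.eval c) + (X - C c) * W') := by
    rw [← hW', add_sub_cancel, ← hW, add_sub_cancel]
  have hsplit : (X - C c) ^ (p - 2) * V = C (V.eval c) * (X - C c) ^ (p - 2)
      + (C (W.eval c) * (X - C c) ^ (p - 1) + (X - C c) ^ p * W') := by
    have e1 : p - 1 = p - 2 + 1 := by omega
    have e2 : (X - C c) ^ p = (X - C c) ^ (p - 2 + 1 + 1) := by
      congr 1
      omega
    conv_lhs => rw [hV']
    rw [e1, e2]
    ring
  rw [hsplit, iterate_map_add, iterate_map_add, iterate_derivative_pow_char_mul,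
    iterate_derivative_eq_zero, zero_add, iterate_derivative_C_mul,
    iterate_derivative_X_sub_pow_self, h3]
  · simp [hp.ne_zero, mul_comm]
  · refine lt_of_le_of_lt (natDegree_C_mul_le _ _) ?_
    rw [natDegree_pow, natDegree_X_sub_C]
    omega

theorem factorial_pred_ne_zero : ((p - 1).factorial : k) ≠ 0 := by
  have hp : p.Prime := Fact.out
  rw [Ne, CharP.cast_eq_zero_iff k p, hp.dvd_factorial]
  have := hp.pos
  omega

theorem cast_sub_two : ((p - 2 : ℕ) : k) = -2 := by
  rw [Nat.cast_sub (Fact.out : p.Prime).two_le, CharP.cast_eq_zero]; simp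

end CharP

/-! ### Polynomial solutions of an equation of order two -/

section Equation

variable {k : Type u} [Field k] {p : ℕ} [Fact p.Prime] [CharP k p] {A₀ A₁ A₂ u : k[X]}

omit [Fact p.Prime] in
/-- The exponents at an ordinary point `c` are `0` and `1`. -/
theorem rootMultiplicity_le_one_or_dvd
    (hu : A₀ * derivative (derivative u) + A₁ * derivative u + A₂ * u = 0) (hu0 : u ≠ 0) {c : k}
    (hc : A₀.eval c ≠ 0) : u.rootMultiplicity c ≤ 1 ∨ p ≤ u.rootMultiplicity c := by
  by_contra! h
  obtain ⟨q, hq, hqc⟩ := exists_eq_pow_rootMultiplicity_mul_and_not_dvd u hu0 c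
  obtain ⟨j, hj⟩ : ∃ j, u.rootMultiplicity c = j + 2 := ⟨_, (Nat.sub_add_cancel h.1).symm⟩
  rw [hj] at hq h
  have hqc' : q.eval c ≠ 0 := fun h0 => hqc (dvd_iff_isRoot.2 h0)
  have hd1 : derivative u = (X - C c) ^ (j + 1) * (((j + 2 : ℕ) : k[X]) * q
      + (X - C c) * derivative q) := by
    rw [hq, derivative_mul, derivative_X_sub_C_pow]
    simp only [map_natCast]
    rw [show j + 2 - 1 = j + 1 by omega]
    ring
  have hd2 : derivative (derivative u) = (X - C c) ^ j * (((j + 2 : ℕ) : k[X])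
      * ((j + 1 : ℕ) : k[X]) * q + (X - C c) * (2 * ((j + 2 : ℕ) : k[X]) * derivative q
        + (X - C c) * derivative (derivative q))) := by
    rw [hd1, derivative_mul, derivative_X_sub_C_pow]
    simp only [Nat.add_sub_cancel, map_natCast, derivative_add, derivative_mul,
      derivative_natCast, derivative_sub, derivative_X, derivative_C]
    push_cast
    ring
  rw [hd2, hd1] at hu
  have hu' : (X - C c) ^ j * (A₀ * (((j + 2 : ℕ) : k[X])
      * ((j + 1 : ℕ) : k[X]) * q + (X - C c) * (2 * ((j + 2 : ℕ) : k[X]) * derivative q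
        + (X - C c) * derivative (derivative q))) + A₁ * (X - C c) * (((j + 2 : ℕ) : k[X]) * q
      + (X - C c) * derivative q) + A₂ * (X - C c) ^ 2 * q) = 0 := by
    rw [← hu]
    conv_rhs => rw [hq]
    ring
  have h1 := (mul_eq_zero.1 hu').resolve_left (pow_ne_zero _ (X_sub_C_ne_zero c))
  have h2 := congrArg (eval c) h1
  simp only [eval_add, eval_mul, eval_natCast, eval_sub, eval_X, eval_C, sub_self, zero_mul,
    add_zero, mul_zero, eval_zero, eval_pow, ne_eq, OfNat.ofNat_ne_zero, not_false_eq_true,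
    zero_pow] at h2
  have h3 := (mul_eq_zero.1 h2).resolve_left hc
  have h4 := (mul_eq_zero.1 h3).resolve_right hqc'
  rcases mul_eq_zero.1 h4 with h5 | h5
  · have := Nat.le_of_dvd (by omega) ((CharP.cast_eq_zero_iff k p _).1 h5)
    omega
  · have := Nat.le_of_dvd (by omega) ((CharP.cast_eq_zero_iff k p _).1 h5)
    omega

/-- At a zero `c` of `u`, write `u = (x - c) q` and `w u^{p-2} = (x - c)^{p-2} V`, where `w` solves
the Wronskian equation. Both equations together say that `V` has vanishing derivative at `c`, that
is, that `w / u²` has no residue there. -/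
theorem eval_iterate_derivative_wronskian_eq_zero (hp2 : p ≠ 2) {w : k[X]}
    (hu : A₀ * derivative (derivative u) + A₁ * derivative u + A₂ * u = 0)
    (hw : A₀ * derivative w + A₁ * w = 0) {c : k} (hc : A₀.eval c ≠ 0) (huc : u.eval c = 0) :
    (derivative^[p - 1] (w * u ^ (p - 2))).eval c = 0 := by
  have h2 := (Fact.out : p.Prime).two_le
  obtain ⟨q, rfl⟩ := dvd_iff_isRoot.2 huc
  rw [mul_pow, mul_left_comm]
  rw [eval_iterate_derivative]
  apply mul_eq_zero_of_right
  have h1 := congrArg (eval c) hu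
  have h3 := congrArg (eval c) hw
  simp only [derivative_mul, derivative_add, derivative_sub, derivative_X, derivative_C,
    eval_add, eval_mul, eval_sub, eval_X, eval_C, sub_self, zero_mul, mul_zero, sub_zero,
    one_mul, add_zero, eval_zero] at h1 h3
  rw [derivative_mul, derivative_pow, cast_sub_two]
  simp only [eval_add, eval_mul, eval_pow, eval_C]
  obtain ⟨n, hn⟩ : ∃ n, p - 2 = n + 1 := ⟨p - 3, by omega⟩
  rw [hn, Nat.add_sub_cancel]
  apply (mul_eq_zero.1 (?_ : A₀.eval c * _ = 0)).resolve_left hc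
  linear_combination (q.eval c) ^ (n + 1) * h3 - w.eval c * (q.eval c) ^ n * h1

/-- Reduction of order: a primitive `V` of `w / u²`, up to a `p`-th power, gives the second
solution `u V`. -/
theorem second_solution (hp2 : p ≠ 2) {w V : k[X]}
    (hu : A₀ * derivative (derivative u) + A₁ * derivative u + A₂ * u = 0)
    (hw : A₀ * derivative w + A₁ * w = 0) (hV : derivative V = w * u ^ (p - 2)) :
    A₀ * derivative (derivative (u * V)) + A₁ * derivative (u * V) + A₂ * (u * V) = 0 := by
  have h2 := (Fact.out : p.Prime).two_le
  obtain ⟨n, hn⟩ : ∃ n, p - 2 = n + 1 := ⟨p - 3, by omega⟩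
  have hc := cast_sub_two (k := k) (p := p)
  simp only [derivative_mul, derivative_add, hV, derivative_pow, hc]
  rw [hn, Nat.add_sub_cancel]
  have : (C (-2 : k) : k[X]) = -2 := by rw [C_neg]; rfl
  rw [this]
  linear_combination V * hu + u ^ (n + 2) * hw

theorem squarefree_of_rootMultiplicity_le_one [IsAlgClosed k] (hu0 : u ≠ 0)
    (h : ∀ c, u.rootMultiplicity c ≤ 1) : Squarefree u := by
  intro f hf
  by_contra hunit
  have hf0 : f ≠ 0 := by rintro rfl; exact hu0 (by simpa using hf)
  obtain ⟨c, hc⟩ := IsAlgClosed.exists_root f (fun h0 => hunit (by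
    rw [isUnit_iff_degree_eq_zero]; exact h0))
  have hd : (X - C c) ^ 2 ∣ u := by
    rw [sq]; exact (mul_dvd_mul (dvd_iff_isRoot.2 hc) (dvd_iff_isRoot.2 hc)).trans hf
  have := (le_rootMultiplicity_iff hu0).2 hd
  have := h c
  omega

/-- `D^{p-1}(w u^{p-2})` is the `p`-th power of a multiple of `u`: it is a `p`-th power since
`D^p = 0`, and it vanishes at the zeros of `u`, which are simple. -/
theorem exists_iterate_derivative_eq [IsAlgClosed k] (hp2 : p ≠ 2) {w : k[X]}
    (hu : A₀ * derivative (derivative u) + A₁ * derivative u + A₂ * u = 0)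
    (hw : A₀ * derivative w + A₁ * w = 0) (hA : ∀ c, u.eval c = 0 → A₀.eval c ≠ 0) (hu0 : u ≠ 0)
    (hsimple : ∀ c, u.rootMultiplicity c ≤ 1) :
    ∃ h : k[X], derivative^[p - 1] (w * u ^ (p - 2)) = u ^ p * h ^ p := by
  classical
  have hp : p.Prime := Fact.out
  have h2 := hp.two_le
  obtain ⟨g, hg⟩ := exists_pow_char_eq (p := p) (f := derivative^[p - 1] (w * u ^ (p - 2))) (by
    rw [← Function.iterate_succ_apply' (f := derivative), Nat.succ_eq_add_one,
      Nat.sub_add_cancel (by omega), iterate_derivative_char])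
  have hdvd : u ∣ g := by
    by_cases hg0 : g = 0
    · simp [hg0]
    rw [IsAlgClosed.dvd_iff_roots_le_roots hu0 hg0, Multiset.le_iff_subset]
    · intro c hc
      rw [mem_roots hu0] at hc
      rw [mem_roots hg0]
      have := eval_iterate_derivative_wronskian_eq_zero hp2 hu hw (hA c hc) hc
      rw [hg, eval_pow] at this
      exact eq_zero_of_pow_eq_zero this
    · rw [Multiset.nodup_iff_count_le_one]
      intro c
      rw [count_roots]
      exact hsimple c
  obtain ⟨h, rfl⟩ := hdvd
  exact ⟨h, by rw [hg, mul_pow]⟩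

end Equation

/-! ### Solutions of a Fuchsian operator with an exponent zero -/

namespace FuchsianOperator

variable {k : Type u} [Field k] {r : ℕ} {x : Fin (r - 1) → k} (L : FuchsianOperator x)

theorem monic_P₀ : L.P₀.Monic := monic_prod_of_monic _ _ fun i _ => monic_X_sub_C (x i)

theorem natDegree_P₀ : L.P₀.natDegree = r - 1 := by
  rw [P₀, natDegree_prod_of_monic _ _ fun i _ => monic_X_sub_C (x i)]
  simp

theorem eval_P₀_eq_zero_iff (c : k) : L.P₀.eval c = 0 ↔ ∃ i, x i = c := by
  rw [P₀, eval_prod, Finset.prod_eq_zero_iff]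
  simp only [Finset.mem_univ, true_and, eval_sub, eval_X, eval_C, sub_eq_zero]
  exact ⟨fun ⟨i, h⟩ => ⟨i, h.symm⟩, fun ⟨i, h⟩ => ⟨i, h.symm⟩⟩

theorem P₀_eq_mul (i : Fin (r - 1)) :
    L.P₀ = (X - C (x i)) * ∏ j ∈ Finset.univ.erase i, (X - C (x j)) :=
  (Finset.mul_prod_erase _ _ (Finset.mem_univ i)).symm

theorem eval_derivative_P₀ (i : Fin (r - 1)) :
    (derivative L.P₀).eval (x i) = (∏ j ∈ Finset.univ.erase i, (X - C (x j))).eval (x i) := by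
  rw [L.P₀_eq_mul i, derivative_mul]
  simp

theorem eval_derivative_P₀_ne_zero (hx : Function.Injective x) (i : Fin (r - 1)) :
    (derivative L.P₀).eval (x i) ≠ 0 := by
  rw [eval_derivative_P₀, eval_prod, Finset.prod_ne_zero_iff]
  intro j hj
  rw [eval_sub, eval_X, eval_C, sub_ne_zero]
  exact fun h => (Finset.ne_of_mem_erase hj) (hx h).symm

theorem eq_of_eval_eq (hr : 3 ≤ r) (hx : Function.Injective x) {f g : k[X]}
    (hf : f.natDegree ≤ r - 2) (hg : g.natDegree ≤ r - 2) (h : ∀ i, f.eval (x i) = g.eval (x i)) :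
    f = g := by
  have hlt : ∀ q : k[X], q.natDegree ≤ r - 2 →
      q.degree < (Finset.univ : Finset (Fin (r - 1))).card := by
    intro q hq
    rw [Finset.card_univ, Fintype.card_fin]
    refine degree_le_natDegree.trans_lt ?_
    exact_mod_cast (by omega : q.natDegree < r - 1)
  exact Polynomial.eq_of_degrees_lt_of_eval_index_eq (v := x) Finset.univ (hx.injOn) (hlt f hf)
    (hlt g hg) fun i _ => h i

/-- If `0` is an exponent at all finite singular points, then `P₃` has more zeros than its degree
allows. -/
theorem P₃_eq_zero (hr : 3 ≤ r) (hx : Function.Injective x) {α : Fin (r - 1) → k}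
    (hα : ∀ i, L.HasLocalExponentsAt i (α i) 0) : L.P₃ = 0 := by
  refine eq_of_eval_eq hr hx L.natDegree_P₃ (by simp) fun i => ?_
  have h := (hα i).2
  rw [mul_zero, eq_comm, div_eq_zero_iff] at h
  rw [eval_zero]
  exact h.resolve_right (pow_ne_zero _ (L.eval_derivative_P₀_ne_zero hx i))

theorem algebraMap_P₀_ne_zero : algebraMap k[X] (RatFunc k) L.P₀ ≠ 0 :=
  algebraMap_ratFunc_ne_zero L.monic_P₀.ne_zero

theorem p₂_eq_div (h3 : L.P₃ = 0) :
    L.p₂ = algebraMap k[X] (RatFunc k) L.P₂ / algebraMap k[X] (RatFunc k) L.P₀ := by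
  rw [p₂, h3]; simp

theorem apply_eq_zero_iff (h3 : L.P₃ = 0) (v : k[X]) : L.apply v = 0 ↔
    L.P₀ * derivative (derivative v) + L.P₁ * derivative v + L.P₂ * v = 0 := by
  have h0 := L.algebraMap_P₀_ne_zero
  have h : algebraMap k[X] (RatFunc k)
      (L.P₀ * derivative (derivative v) + L.P₁ * derivative v + L.P₂ * v)
      = algebraMap k[X] (RatFunc k) L.P₀ * L.apply v := by
    rw [apply, L.p₂_eq_div h3, p₁]
    simp only [map_add, map_mul]
    field_simp
  rw [← map_eq_zero_iff _ (RatFunc.algebraMap_injective k), h, mul_eq_zero,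
    or_iff_right h0]

theorem wronskianApply_eq_zero_iff (w : k[X]) : L.wronskianApply w = 0 ↔
    L.P₀ * derivative w + L.P₁ * w = 0 := by
  have h0 := L.algebraMap_P₀_ne_zero
  have h : algebraMap k[X] (RatFunc k) (L.P₀ * derivative w + L.P₁ * w)
      = algebraMap k[X] (RatFunc k) L.P₀ * L.wronskianApply w := by
    rw [wronskianApply, p₁]
    simp only [map_add, map_mul]
    field_simp
  rw [← map_eq_zero_iff _ (RatFunc.algebraMap_injective k), h, mul_eq_zero,
    or_iff_right h0]

/-- The residues of `p₁` at the finite singular points lie in the prime field, when the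
Wronskian equation has a polynomial solution. -/
theorem exists_residues (p : ℕ) [Fact p.Prime] [CharP k p] {w : k[X]}
    (hw0 : w ≠ 0) (hw : L.wronskianApply w = 0) (i : Fin (r - 1)) :
    ∃ m : ℕ, m < p ∧ L.P₁.eval (x i) = -((m : k) * (derivative L.P₀).eval (x i)) := by
  rw [L.wronskianApply_eq_zero_iff] at hw
  obtain ⟨q, hq, hqc⟩ := exists_eq_pow_rootMultiplicity_mul_and_not_dvd w hw0 (x i)
  set n := w.rootMultiplicity (x i)
  have hqc' : q.eval (x i) ≠ 0 := fun h0 => hqc (dvd_iff_isRoot.2 h0)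
  refine ⟨n % p, Nat.mod_lt _ (Fact.out : p.Prime).pos, ?_⟩
  have hn : ((n % p : ℕ) : k) = n := by
    conv_rhs => rw [← Nat.mod_add_div n p]
    simp
  rw [hn, eval_derivative_P₀]
  set A := ∏ j ∈ Finset.univ.erase i, (X - C (x j))
  have hd : (X - C (x i)) * derivative w
      = (X - C (x i)) ^ n * ((n : k[X]) * q + (X - C (x i)) * derivative q) := by
    rw [hq, derivative_mul, derivative_X_sub_C_pow, map_natCast]
    rcases n with _ | n
    · simp
    · rw [Nat.add_sub_cancel]; ring
  have h : (X - C (x i)) ^ n * (A * ((n : k[X]) * q + (X - C (x i)) * derivative q) + L.P₁ * q)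
      = 0 := by
    rw [← hw, L.P₀_eq_mul i]
    conv_rhs => rw [mul_right_comm, hd]
    conv_rhs => rw [hq]
    ring
  have h1 := (mul_eq_zero.1 h).resolve_left (pow_ne_zero _ (X_sub_C_ne_zero _))
  have h2 := congrArg (eval (x i)) h1
  simp only [eval_add, eval_mul, eval_natCast, eval_sub, eval_X, eval_C, sub_self, zero_mul,
    add_zero, eval_zero] at h2
  apply mul_right_cancel₀ hqc'
  linear_combination h2

/-- The polynomial `∏ (x - xᵢ)^{mᵢ}`. If `-mᵢ` is the residue of `p₁` at `xᵢ`, it is a solution of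
the Wronskian equation. -/
def singProd {k : Type u} [Field k] {r : ℕ} (x : Fin (r - 1) → k) (m : Fin (r - 1) → ℕ) : k[X] :=
  ∏ i, (X - C (x i)) ^ m i

theorem monic_singProd (m : Fin (r - 1) → ℕ) : (singProd x m).Monic :=
  monic_prod_of_monic _ _ fun i _ => (monic_X_sub_C (x i)).pow _

theorem natDegree_singProd (m : Fin (r - 1) → ℕ) : (singProd x m).natDegree = ∑ i, m i := by
  rw [singProd, natDegree_prod_of_monic _ _ fun i _ => (monic_X_sub_C (x i)).pow _]
  simp

/-- Lagrange interpolation, or the partial fraction expansion of `p₁`. -/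
theorem P₁_eq_sum (hr : 3 ≤ r) (hx : Function.Injective x) {m : Fin (r - 1) → ℕ}
    (hm : ∀ i, L.P₁.eval (x i) = -((m i : k) * (derivative L.P₀).eval (x i))) :
    L.P₁ = -∑ i, C (m i : k) * ∏ j ∈ Finset.univ.erase i, (X - C (x j)) := by
  refine eq_of_eval_eq hr hx L.natDegree_P₁ ?_ fun i => ?_
  · rw [natDegree_neg]
    refine natDegree_sum_le_of_forall_le _ _ fun i _ => (natDegree_C_mul_le _ _).trans ?_
    rw [natDegree_prod_of_monic _ _ fun i _ => monic_X_sub_C (x i)]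
    simp
    omega
  · rw [hm, eval_neg, eval_finsetSum, Finset.sum_eq_single i, eval_mul, eval_C,
      eval_derivative_P₀]
    · intro j _ hj
      rw [eval_mul, eval_prod,
        Finset.prod_eq_zero (Finset.mem_erase.2 ⟨hj.symm, Finset.mem_univ i⟩), mul_zero]
      simp
    · simp

theorem wronskian_singProd (hr : 3 ≤ r) (hx : Function.Injective x) {m : Fin (r - 1) → ℕ}
    (hm : ∀ i, L.P₁.eval (x i) = -((m i : k) * (derivative L.P₀).eval (x i))) :
    L.P₀ * derivative (singProd x m) + L.P₁ * singProd x m = 0 := by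
  rw [L.P₁_eq_sum hr hx hm, singProd, derivative_prod_finset, Finset.mul_sum, neg_mul,
    Finset.sum_mul,
    add_neg_eq_zero]
  refine Finset.sum_congr rfl fun i _ => ?_
  rw [L.P₀_eq_mul i, ← Finset.mul_prod_erase Finset.univ _ (Finset.mem_univ i),
    derivative_X_sub_C_pow]
  rcases m i with _ | n
  · simp
  · rw [Nat.add_sub_cancel, map_natCast]
    ring

theorem coeff_P₁ (hr : 3 ≤ r) (hx : Function.Injective x) {m : Fin (r - 1) → ℕ}
    (hm : ∀ i, L.P₁.eval (x i) = -((m i : k) * (derivative L.P₀).eval (x i))) :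
    L.P₁.coeff (r - 2) = -((singProd x m).natDegree : k) := by
  rw [L.P₁_eq_sum hr hx hm, natDegree_singProd, coeff_neg, finsetSum_coeff, Nat.cast_sum]
  congr 1
  refine Finset.sum_congr rfl fun i _ => ?_
  have hd : (∏ j ∈ Finset.univ.erase i, (X - C (x j))).natDegree = r - 2 := by
    rw [natDegree_prod_of_monic _ _ fun i _ => monic_X_sub_C (x i)]
    simp
    omega
  have hmon : (∏ j ∈ Finset.univ.erase i, (X - C (x j))).Monic :=
    monic_prod_of_monic _ _ fun i _ => monic_X_sub_C (x i)
  rw [coeff_C_mul, ← hd, hmon.coeff_natDegree, mul_one]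

/-- If `D^{p-1}(w u^{p-2})` vanishes, a primitive of `w / u²` gives a second solution which
is independent of `u` over `k[x]^p`. -/
theorem iterate_derivative_ne_zero {p : ℕ} [Fact p.Prime] [CharP k p] (hp2 : p ≠ 2)
    (hfin : L.NonzeroPCurvature p) (h3 : L.P₃ = 0) {u w : k[X]} (hu0 : u ≠ 0)
    (hu : L.apply u = 0) (hw0 : w ≠ 0) (hw : L.P₀ * derivative w + L.P₁ * w = 0) :
    derivative^[p - 1] (w * u ^ (p - 2)) ≠ 0 := by
  intro h
  obtain ⟨V, hV⟩ := exists_derivative_eq h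
  have huV := second_solution hp2 ((L.apply_eq_zero_iff h3 u).1 hu) hw hV
  rw [← L.apply_eq_zero_iff h3] at huV
  let v : Fin 2 → L.solutions p := ![⟨u, hu⟩, ⟨u * V, huV⟩]
  have hT : w * u ^ (p - 2) ≠ 0 := mul_ne_zero hw0 (pow_ne_zero _ hu0)
  have hlin : LinearIndependent (frobenius k[X] p).range v := by
    rw [LinearIndependent.pair_iff]
    rintro ⟨_, a, rfl⟩ ⟨_, b, rfl⟩ hab
    have hab' : a ^ p * u + b ^ p * (u * V) = 0 := congrArg Subtype.val hab
    have h1 : a ^ p + b ^ p * V = 0 := by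
      apply (mul_eq_zero.1 (?_ : u * _ = 0)).resolve_left hu0
      linear_combination hab'
    have h2 := congrArg derivative h1
    rw [derivative_add, derivative_mul, derivative_pow_char, derivative_pow_char, hV,
      derivative_zero, zero_mul, zero_add, zero_add] at h2
    have hb := (mul_eq_zero.1 h2).resolve_right hT
    rw [hb, zero_mul, add_zero] at h1
    exact ⟨Subtype.ext h1, Subtype.ext hb⟩
  have hrank : Module.rank (frobenius k[X] p).range (L.solutions p) = 1 := by
    have h1 : Module.finrank (frobenius k[X] p).range (L.solutions p) = 1 := hfin
    rwa [Module.finrank, Cardinal.toNat_eq_iff one_ne_zero, Nat.cast_one] at h1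
  have h1 := hlin.cardinal_lift_le_rank
  rw [hrank] at h1
  norm_num at h1

/-- The zeros of the solution of minimal degree outside the singular points are simple. -/
theorem IsMinimalSolution.rootMultiplicity_le_one {L : FuchsianOperator x} {p : ℕ}
    [Fact p.Prime] [CharP k p] {u : k[X]} (hu : L.IsMinimalSolution u) (h3 : L.P₃ = 0) {c : k}
    (hc : L.P₀.eval c ≠ 0) : u.rootMultiplicity c ≤ 1 := by
  have hu0 := hu.1.ne_zero
  have hode := (L.apply_eq_zero_iff h3 u).1 hu.2.1
  refine (rootMultiplicity_le_one_or_dvd (p := p) hode hu0 hc).resolve_right fun h => ?_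
  obtain ⟨v, rfl⟩ := (le_rootMultiplicity_iff hu0).1 h
  have hp := (Fact.out : p.Prime).pos
  have hq0 : (X - C c) ^ p ≠ 0 := pow_ne_zero _ (X_sub_C_ne_zero c)
  have hv0 : v ≠ 0 := right_ne_zero_of_mul hu0
  have hv : L.apply v = 0 := by
    rw [L.apply_eq_zero_iff h3]
    apply (mul_eq_zero.1 (?_ : (X - C c) ^ p * _ = 0)).resolve_left hq0
    rw [← hode]
    simp only [derivative_mul, derivative_pow_char, zero_mul, zero_add]
    ring
  have hle := hu.2.2 v hv0 hv
  rw [natDegree_mul hq0 hv0, natDegree_pow, natDegree_X_sub_C] at hle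
  omega

end FuchsianOperator

/-! ### Kummer covers with a logarithmic differential form -/

section Kummer

variable {p : ℕ} [Fact p.Prime] {k : Type u} [Field k] [CharP k p]

/-- A function `z` with `z^{p-1} = G` generates a cyclic cover, on which `z dx` is a
logarithmic form as soon as `D^{p-1} (1/G) = -1`: since `z = z^p (1/G)` and `p`-th powers are
constants for `D`, one has `D^{p-1} z = z^p D^{p-1}(1/G) = -z^p`. -/
theorem exists_deformationDatum (hp2 : p ≠ 2) {G : RatFunc k} (hG : G ≠ 0)
    (hD : ratDeriv^[p - 1] G⁻¹ = -1) :
    ∃ (𝒟 : DeformationDatum p k) (z : 𝒟.K), z ^ (p - 1) = algebraMap (RatFunc k) 𝒟.K G ∧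
      IntermediateField.adjoin (RatFunc k) {z} = ⊤ ∧
      𝒟.ω = z • KaehlerDifferential.D k 𝒟.K (algebraMap (RatFunc k) 𝒟.K RatFunc.X) := by
  classical
  have hp : p.Prime := Fact.out
  have h2 := hp.two_le
  have hcharF : CharP (RatFunc k) p := charP_of_injective_algebraMap (algebraMap k _).injective p
  let F : (RatFunc k)[X] := X ^ (p - 1) - C G
  have hnd : ¬ p ∣ p - 1 := fun h => by
    have := Nat.le_of_dvd (by omega) h
    omega
  have hsep : F.Separable := separable_X_pow_sub_C' p (p - 1) G hnd hG
  -- a splitting field of `F` is generated by any root, as `k` contains the roots of unity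
  let K := F.SplittingField
  have hcharK : CharP K p := charP_of_injective_algebraMap (algebraMap (RatFunc k) K).injective p
  have hgal : IsGalois (RatFunc k) K := IsGalois.of_separable_splitting_field hsep
  have hF0 : F ≠ 0 := X_pow_sub_C_ne_zero (by omega) G
  obtain ⟨z, hz⟩ : ∃ z : K, (F.map (algebraMap (RatFunc k) K)).eval z = 0 := by
    refine (SplittingField.splits F).exists_eval_eq_zero ?_
    rw [degree_map, degree_X_pow_sub_C (by omega)]
    exact_mod_cast (by omega : p - 1 ≠ 0)
  have hroot : ∀ y : K, y ∈ F.rootSet K ↔ y ^ (p - 1) = algebraMap (RatFunc k) K G := by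
    intro y
    rw [mem_rootSet]
    simp [F, hF0, sub_eq_zero]
  have hzG : z ^ (p - 1) = algebraMap (RatFunc k) K G := by
    simpa [F, sub_eq_zero] using hz
  have hz0 : z ≠ 0 := by
    rintro rfl
    rw [zero_pow (by omega), eq_comm, map_eq_zero] at hzG
    exact hG hzG
  have hmult : ∀ y : K, y ^ (p - 1) = algebraMap (RatFunc k) K G →
      ∃ c : (ZMod p)ˣ, y = ZMod.castHom (dvd_refl p) K c * z := by
    intro y hy
    obtain ⟨c, hc⟩ := exists_zmod_eq_of_pow_eq_one (p := p) (ξ := y / z) (by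
      rw [div_pow, hy, hzG, div_self]
      simpa using hG)
    exact ⟨c, by rw [hc, div_mul_cancel₀ _ hz0]⟩
  have hcast : ∀ (c : ZMod p), algebraMap (RatFunc k) K (ZMod.castHom (dvd_refl p) (RatFunc k) c)
      = ZMod.castHom (dvd_refl p) K c := fun c => by
    rw [← RingHom.comp_apply]
    exact congrFun (congrArg _ (RingHom.ext_zmod _ _)) c
  have hcastk : ∀ (c : ZMod p), algebraMap k K (ZMod.castHom (dvd_refl p) k c)
      = ZMod.castHom (dvd_refl p) K c := fun c => by
    rw [← RingHom.comp_apply]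
    exact congrFun (congrArg _ (RingHom.ext_zmod _ _)) c
  have hgen : IntermediateField.adjoin (RatFunc k) {z} = ⊤ := by
    rw [eq_top_iff, ← IntermediateField.toSubalgebra_le_toSubalgebra,
      IntermediateField.top_toSubalgebra, ← SplittingField.adjoin_rootSet F, Algebra.adjoin_le_iff]
    intro y hy
    obtain ⟨c, rfl⟩ := hmult y ((hroot y).1 hy)
    rw [← hcast]
    exact mul_mem (IntermediateField.algebraMap_mem _ _)
      (IntermediateField.mem_adjoin_simple_self (RatFunc k) z)
  obtain ⟨δ, hδ, hDδ, hdx⟩ := exists_derivation (k := k) (K := K)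
  have hβ : ∀ β : K ≃ₐ[RatFunc k] K, ∃ c : (ZMod p)ˣ, β z = ZMod.castHom (dvd_refl p) K c * z :=
    fun β => hmult _ (by rw [← map_pow, hzG, AlgEquiv.commutes])
  have hcastinj : Function.Injective
      fun c : (ZMod p)ˣ => ZMod.castHom (dvd_refl p) K (c : ZMod p) := by
    intro c d h
    exact Units.ext ((ZMod.castHom (dvd_refl p) K).injective h)
  have hβcast : ∀ (β : K ≃ₐ[RatFunc k] K) (c : ZMod p),
      β (ZMod.castHom (dvd_refl p) K c) = ZMod.castHom (dvd_refl p) K c := by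
    intro β c
    rw [← hcast, AlgEquiv.commutes]
  choose χ hχ using hβ
  let χ' : (K ≃ₐ[RatFunc k] K) →* (ZMod p)ˣ :=
    { toFun := χ
      map_one' := by
        apply hcastinj
        apply mul_right_cancel₀ hz0
        change ZMod.castHom (dvd_refl p) K (χ 1 : ZMod p) * z = _
        rw [← hχ 1]
        simp
      map_mul' := by
        intro β γ
        apply hcastinj
        apply mul_right_cancel₀ hz0
        change ZMod.castHom (dvd_refl p) K (χ (β * γ) : ZMod p) * z
          = ZMod.castHom (dvd_refl p) K ((χ β * χ γ : (ZMod p)ˣ) : ZMod p) * z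
        rw [← hχ, AlgEquiv.mul_apply, hχ γ, map_mul, hβcast, hχ β, Units.val_mul, map_mul]
        ring }
  let ω : Ω[K⁄k] := z • KaehlerDifferential.D k K (algebraMap (RatFunc k) K RatFunc.X)
  have hDK : δ^[p - 1] z = -z ^ p := by
    have hzp : z = z ^ p * algebraMap (RatFunc k) K G⁻¹ := by
      rw [map_inv₀, ← hzG, ← div_eq_mul_inv, eq_div_iff (pow_ne_zero _ hz0), ← pow_succ',
        Nat.sub_add_cancel (by omega)]
    have hit : ∀ (n : ℕ) (f : RatFunc k), δ^[n] (algebraMap (RatFunc k) K f)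
        = algebraMap (RatFunc k) K (ratDeriv^[n] f) := by
      intro n
      induction n with
      | zero => intro f; rfl
      | succ n ih => intro f; rw [Function.iterate_succ_apply, hδ, ih, Function.iterate_succ_apply]
    have hconst : δ (z ^ p) = 0 := by
      rw [Derivation.leibniz_pow, ← Nat.cast_smul_eq_nsmul K, CharP.cast_eq_zero, zero_smul]
    conv_lhs => rw [hzp]
    rw [iterate_derivation_mul_of_eq_zero δ hconst, hit, hD, map_neg, map_one, mul_neg, mul_one]
  refine ⟨{ K := K
            ω := ω
            χ := χ'
            ω_ne_zero := ?_
            χ_injective := ?_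
            pullback_eq := ?_
            logarithmic := ?_ }, z, hzG, hgen, rfl⟩
  · exact smul_ne_zero hz0 hdx
  · intro β γ h
    refine algEquiv_eq_of_adjoin_eq_top hgen ?_
    have h' : χ β = χ γ := h
    rw [hχ, hχ, h']
  · intro β
    rw [kaehlerPullback_smul_D]
    have h1 : ((β.restrictScalars k : K ≃ₐ[k] K) : K →ₐ[k] K) z
        = ZMod.castHom (dvd_refl p) K (χ β) * z := hχ β
    have h3 : ((β.restrictScalars k : K ≃ₐ[k] K) : K →ₐ[k] K)
        (algebraMap (RatFunc k) K RatFunc.X) = algebraMap (RatFunc k) K RatFunc.X :=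
      β.commutes _
    rw [h1, h3, mul_smul, ← hcastk, algebraMap_smul]
    rfl
  · obtain ⟨f, hf0, hf⟩ := exists_derivation_eq_mul δ z hp2 hDK
    refine ⟨f, hf0, ?_⟩
    rw [hDδ f, hf, smul_smul, mul_comm z f, inv_mul_cancel_left₀ hf0]

end Kummer

/-! ### Regularity and order at infinity of rational functions -/

section Regularity

variable {k : Type u} [Field k]

theorem num_mul_eq {f : RatFunc k} {a b : k[X]} (hb : b ≠ 0)
    (hf : f = algebraMap k[X] (RatFunc k) a / algebraMap k[X] (RatFunc k) b) :
    f.num * b = a * f.denom := by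
  have hb' := algebraMap_ratFunc_ne_zero hb
  have hd := algebraMap_ratFunc_ne_zero f.denom_ne_zero
  apply RatFunc.algebraMap_injective k
  rw [map_mul, map_mul, ← div_eq_div_iff hd hb', ← hf, RatFunc.num_div_denom]

theorem not_eval_num_denom (f : RatFunc k) (c : k) :
    ¬ (f.num.eval c = 0 ∧ f.denom.eval c = 0) := by
  rintro ⟨h1, h2⟩
  obtain ⟨a, b, hab⟩ := f.isCoprime_num_denom
  have := congrArg (eval c) hab
  simp [h1, h2] at this

theorem regularAt_div (a : k[X]) {b : k[X]} {c : k} (hb : b.eval c ≠ 0) :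
    RegularAt (algebraMap k[X] (RatFunc k) a / algebraMap k[X] (RatFunc k) b) c := by
  intro h
  have hb0 : b ≠ 0 := by rintro rfl; simp at hb
  have h1 := congrArg (eval c) (num_mul_eq (a := a) hb0 rfl)
  rw [eval_mul, eval_mul, h, mul_zero] at h1
  exact not_eval_num_denom _ c ⟨(mul_eq_zero.1 h1).resolve_right hb, h⟩

theorem vanishesAt_div_iff (a : k[X]) {b : k[X]} {c : k} (hb : b.eval c ≠ 0) :
    VanishesAt (algebraMap k[X] (RatFunc k) a / algebraMap k[X] (RatFunc k) b) c
      ↔ a.eval c = 0 := by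
  have hb0 : b ≠ 0 := by rintro rfl; simp at hb
  have h1 := congrArg (eval c) (num_mul_eq (a := a) hb0 rfl)
  rw [eval_mul, eval_mul] at h1
  constructor
  · intro h
    have h' : eval c _ = 0 := h
    rw [h', zero_mul, eq_comm] at h1
    exact (mul_eq_zero.1 h1).resolve_right fun h2 => not_eval_num_denom _ c ⟨h', h2⟩
  · intro h
    rw [h, zero_mul] at h1
    exact (mul_eq_zero.1 h1).resolve_right hb

/-- The pole order of `f` at `∞` is at most `n`; this includes `f = 0`, whose `intDegree` has the
value `0`. -/
def DegLE (f : RatFunc k) (n : ℤ) : Prop := f = 0 ∨ f.intDegree ≤ n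

theorem DegLE.mono {f : RatFunc k} {m n : ℤ} (h : DegLE f m) (hmn : m ≤ n) : DegLE f n :=
  h.imp_right fun h => h.trans hmn

theorem DegLE.mul {f g : RatFunc k} {m n : ℤ} (hf : DegLE f m) (hg : DegLE g n) :
    DegLE (f * g) (m + n) := by
  by_cases hf0 : f = 0
  · exact Or.inl (by rw [hf0, zero_mul])
  by_cases hg0 : g = 0
  · exact Or.inl (by rw [hg0, mul_zero])
  right
  rw [RatFunc.intDegree_mul hf0 hg0]
  exact add_le_add (hf.resolve_left hf0) (hg.resolve_left hg0)

theorem DegLE.add {f g : RatFunc k} {n : ℤ} (hf : DegLE f n) (hg : DegLE g n) :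
    DegLE (f + g) n := by
  by_cases hg0 : g = 0
  · rwa [hg0, add_zero]
  by_cases hf0 : f = 0
  · rwa [hf0, zero_add]
  by_cases hfg : f + g = 0
  · exact Or.inl hfg
  exact Or.inr ((RatFunc.intDegree_add_le hg0 hfg).trans
    (max_le (hf.resolve_left hf0) (hg.resolve_left hg0)))

theorem DegLE.neg {f : RatFunc k} {n : ℤ} (hf : DegLE f n) : DegLE (-f) n := by
  rcases hf with rfl | hf
  · exact Or.inl neg_zero
  · exact Or.inr (by rwa [RatFunc.intDegree_neg])

theorem DegLE.sub {f g : RatFunc k} {n : ℤ} (hf : DegLE f n) (hg : DegLE g n) :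
    DegLE (f - g) n := by
  rw [sub_eq_add_neg]
  exact hf.add hg.neg

theorem degLE_div {a b : k[X]} {n : ℤ} (h : a = 0 ∨ (a.natDegree : ℤ) ≤ n + b.natDegree) :
    DegLE (algebraMap k[X] (RatFunc k) a / algebraMap k[X] (RatFunc k) b) n := by
  by_cases ha : a = 0
  · exact Or.inl (by simp [ha])
  by_cases hb : b = 0
  · exact Or.inl (by simp [hb])
  right
  rw [div_eq_mul_inv, RatFunc.intDegree_mul (algebraMap_ratFunc_ne_zero ha)
    (inv_ne_zero (algebraMap_ratFunc_ne_zero hb)), RatFunc.intDegree_inv,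
    RatFunc.intDegree_polynomial, RatFunc.intDegree_polynomial]
  have := h.resolve_left ha
  omega

theorem degLE_X_pow (n : ℕ) : DegLE (RatFunc.X ^ n : RatFunc k) n := by
  have h := degLE_div (a := (X : k[X]) ^ n) (b := 1) (n := n) (Or.inr (by simp))
  simpa using h

theorem degLE_X_inv_pow (n : ℕ) : DegLE ((RatFunc.X ^ n)⁻¹ : RatFunc k) (-n) := by
  have h := degLE_div (a := (1 : k[X])) (b := X ^ n) (n := -n) (Or.inr (by simp))
  simpa using h

theorem DegLE.regularAtInfty {f : RatFunc k} (hf : DegLE f 0) : RegularAtInfty f := by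
  rcases hf with rfl | hf
  · simp [RegularAtInfty]
  · rw [RatFunc.intDegree] at hf
    unfold RegularAtInfty
    omega

/-- The derivative of a function which is regular at `∞` vanishes there to the order two, since
`d/dx = - t² d/dt` for `t = 1/x`. -/
theorem DegLE.ratDeriv {f : RatFunc k} (hf : DegLE f 0) : DegLE (ratDeriv f) (-2) := by
  rw [Fuchs.ratDeriv, ← map_mul, ← map_mul, ← map_sub, ← map_pow]
  apply degLE_div
  have hd := f.denom_ne_zero
  have hle : f.num.natDegree ≤ f.denom.natDegree := hf.regularAtInfty
  rw [natDegree_pow]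
  rcases Nat.eq_zero_or_pos f.denom.natDegree with h0 | h0
  · left
    obtain ⟨a, ha⟩ := natDegree_eq_zero.1 (Nat.le_zero.1 (h0 ▸ hle))
    obtain ⟨b, hb⟩ := natDegree_eq_zero.1 h0
    rw [← ha, ← hb]
    simp
  · right
    have key : (derivative f.num * f.denom - f.num * derivative f.denom).natDegree
        ≤ 2 * f.denom.natDegree - 2 := by
      rcases hle.eq_or_lt with h | h
      · exact natDegree_wronskian_le h rfl hd
      · have h1 := natDegree_derivative_le f.denom
        have h2 := natDegree_derivative_le f.num
        rcases Nat.eq_zero_or_pos f.num.natDegree with h3 | h3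
        · obtain ⟨a, ha⟩ := natDegree_eq_zero.1 h3
          rw [← ha, derivative_C, zero_mul, zero_sub, natDegree_neg]
          refine (natDegree_mul_le_of_le (natDegree_C a).le h1).trans ?_
          omega
        · refine (natDegree_sub_le_of_le (natDegree_mul_le_of_le h2 le_rfl)
            (natDegree_mul_le_of_le le_rfl h1)).trans ?_
          omega
    push_cast
    omega

end Regularity

/-! ### Removable singularities -/

namespace FuchsianOperator

variable {k : Type u} [Field k] {r : ℕ} {x : Fin (r - 1) → k} (L : FuchsianOperator x)

local notation "ι" => algebraMap k[X] (RatFunc k)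

theorem ratDeriv_one : ratDeriv (1 : RatFunc k) = 0 := ratDerivation.map_one_eq_zero

theorem ratDeriv_inv (f : RatFunc k) : ratDeriv f⁻¹ = -(f ^ 2)⁻¹ * ratDeriv f := by
  have h := ratDerivation.leibniz_inv f
  rw [smul_eq_mul, inv_pow] at h
  exact h

/-- A finite singular point with exponents `0` and `1` is an ordinary point, since `u` does not
vanish there and its equation forces `P₂` to vanish together with `P₁`. -/
theorem isRemovableAt_of_eval_P₁_eq_zero (hx : Function.Injective x) (h3 : L.P₃ = 0) {u : k[X]}
    (hu : L.apply u = 0) {i : Fin (r - 1)} (hui : u.eval (x i) ≠ 0)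
    (h1 : L.P₁.eval (x i) = 0) : L.IsRemovableAt (x i) := by
  have hA := L.eval_derivative_P₀_ne_zero hx i
  rw [eval_derivative_P₀] at hA
  have hP0 := L.P₀_eq_mul i
  have hode := congrArg (eval (x i)) ((L.apply_eq_zero_iff h3 u).1 hu)
  have h0 : L.P₀.eval (x i) = 0 := (L.eval_P₀_eq_zero_iff _).2 ⟨i, rfl⟩
  simp only [eval_add, eval_mul, h0, h1, zero_mul, zero_add, eval_zero] at hode
  have h2 := (mul_eq_zero.1 hode).resolve_right hui
  obtain ⟨B₁, hB₁⟩ := dvd_iff_isRoot.2 h1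
  obtain ⟨B₂, hB₂⟩ := dvd_iff_isRoot.2 h2
  set A := ∏ j ∈ Finset.univ.erase i, (X - C (x j))
  have hc := algebraMap_ratFunc_ne_zero (X_sub_C_ne_zero (x i))
  refine ⟨1, one_ne_zero, ?_, ?_⟩
  · have : L.twist₁ 1 = ι B₁ / ι A := by
      rw [twist₁, ratDeriv_one, p₁, hP0, hB₁, map_mul, map_mul, mul_div_mul_left _ _ hc]
      simp
    rw [this]
    exact regularAt_div _ hA
  · have : L.twist₂ 1 = ι B₂ / ι A := by
      have h0' : ratDeriv (0 : RatFunc k) = 0 := ratDerivation.map_zero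
      rw [twist₂, ratDeriv_one, h0', L.p₂_eq_div h3, hP0, hB₂, map_mul, map_mul,
        mul_div_mul_left _ _ hc]
      simp
    rw [this]
    exact regularAt_div _ hA

/-- At a finite singular point with exponents `0` and `-1`, the Wronskian vanishes to the order
`p - 2` up to a `p`-th power. If `D^{p-1}(w u^{p-2})` vanishes there, then the functions
`(x - xᵢ) v`, with a solution `v` of `L`, satisfy an equation without singularity at `xᵢ`. -/
theorem isRemovableAt_of_eval_iterate_derivative_eq_zero {p : ℕ} [Fact p.Prime] [CharP k p]
    (hp2 : p ≠ 2) (hr : 3 ≤ r) (hx : Function.Injective x) (h3 : L.P₃ = 0) {u : k[X]}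
    (hu : L.apply u = 0) {m : Fin (r - 1) → ℕ}
    (hm : ∀ i, L.P₁.eval (x i) = -((m i : k) * (derivative L.P₀).eval (x i)))
    {i : Fin (r - 1)} (hui : u.eval (x i) ≠ 0) (hmi : m i = p - 2)
    (hT : (derivative^[p - 1] (singProd x m * u ^ (p - 2))).eval (x i) = 0) :
    L.IsRemovableAt (x i) := by
  have hp := (Fact.out : p.Prime).two_le
  obtain ⟨n, hn⟩ : ∃ n, p - 2 = n + 1 := ⟨p - 3, by omega⟩
  have hcast : ((p - 2 : ℕ) : k) = -2 := cast_sub_two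
  have hA := L.eval_derivative_P₀_ne_zero hx i
  rw [eval_derivative_P₀] at hA
  have hP0 := L.P₀_eq_mul i
  have hode := congrArg (eval (x i)) ((L.apply_eq_zero_iff h3 u).1 hu)
  have h0 : L.P₀.eval (x i) = 0 := (L.eval_P₀_eq_zero_iff _).2 ⟨i, rfl⟩
  have hw := L.wronskian_singProd hr hx hm
  have hmi' := hm i
  rw [eval_derivative_P₀, hmi, hcast] at hmi'
  set A := ∏ j ∈ Finset.univ.erase i, (X - C (x j))
  set w := ∏ j ∈ Finset.univ.erase i, (X - C (x j)) ^ m j with hwdef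
  have hs : singProd x m = (X - C (x i)) ^ (p - 2) * w := by
    rw [singProd, ← Finset.mul_prod_erase _ _ (Finset.mem_univ i), hmi]
  have hwi : w.eval (x i) ≠ 0 := by
    rw [hwdef, eval_prod, Finset.prod_ne_zero_iff]
    intro j hj
    rw [eval_pow, eval_sub, eval_X, eval_C]
    exact pow_ne_zero _ (sub_ne_zero.2 fun h => (Finset.ne_of_mem_erase hj) (hx h).symm)
  -- the condition on `D^{p-1}` amounts to `w' u = 2 w u'` at `xᵢ`
  have hV : (derivative w).eval (x i) * u.eval (x i)
      = 2 * w.eval (x i) * (derivative u).eval (x i) := by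
    rw [hs, mul_assoc, eval_iterate_derivative] at hT
    have h := (mul_eq_zero.1 hT).resolve_left factorial_pred_ne_zero
    rw [derivative_mul, derivative_pow, hcast, hn, Nat.add_sub_cancel] at h
    simp only [eval_add, eval_mul, eval_pow, eval_C] at h
    apply mul_left_cancel₀ (pow_ne_zero n hui)
    linear_combination h
  simp only [eval_add, eval_mul, h0, hmi', zero_mul, zero_add, eval_zero] at hode
  have hE : (L.P₂ * w + A * derivative w).eval (x i) = 0 := by
    rw [eval_add, eval_mul, eval_mul]
    apply (mul_eq_zero.1 (?_ : _ * u.eval (x i) = 0)).resolve_right hui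
    linear_combination w.eval (x i) * hode + A.eval (x i) * hV
  obtain ⟨E, hE⟩ := dvd_iff_isRoot.2 hE
  -- the Wronskian equation in terms of `w`
  have hw' : L.P₁ * w = A * (2 * w - (X - C (x i)) * derivative w) := by
    have hc2 : C ((p - 2 : ℕ) : k) = -2 := by
      rw [hcast, C_neg]
      rfl
    rw [hs, hP0, derivative_mul, derivative_X_sub_C_pow, hc2, hn,
      Nat.add_sub_cancel] at hw
    apply mul_left_cancel₀ (pow_ne_zero (n + 1) (X_sub_C_ne_zero (x i)))
    linear_combination hw
  have hc0 := algebraMap_ratFunc_ne_zero (X_sub_C_ne_zero (x i))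
  have hA0 : ι A ≠ 0 := algebraMap_ratFunc_ne_zero fun h => hA (by rw [h, eval_zero])
  have hw0 : ι w ≠ 0 := algebraMap_ratFunc_ne_zero fun h => hwi (by rw [h, eval_zero])
  have hs1 : ratDeriv (ι (X - C (x i)))⁻¹ = -(ι (X - C (x i)) ^ 2)⁻¹ := by
    rw [ratDeriv_inv, ratDeriv_algebraMap]
    simp
  have hs2 : ratDeriv (ratDeriv (ι (X - C (x i)))⁻¹) = 2 * (ι (X - C (x i)) ^ 3)⁻¹ := by
    have hneg : ∀ f : RatFunc k, ratDeriv (-f) = -ratDeriv f := fun f => ratDerivation.map_neg f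
    have hsq : ratDeriv (ι (X - C (x i)) ^ 2) = 2 * ι (X - C (x i)) := by
      rw [sq, ratDeriv_mul, ratDeriv_algebraMap, derivative_X_sub_C, map_one]
      ring
    rw [hs1, hneg, ratDeriv_inv, hsq]
    field_simp
  have hwR : ι L.P₁ * ι w = ι A * (2 * ι w - ι (X - C (x i)) * ι (derivative w)) := by
    have h := congrArg ι hw'
    simpa only [map_mul, map_sub, map_ofNat] using h
  have hER : ι L.P₂ * ι w + ι A * ι (derivative w) = ι (X - C (x i)) * ι E := by
    rw [← map_mul, ← map_mul, ← map_add, hE, map_mul]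
  have hp₁ : L.p₁ = 2 / ι (X - C (x i)) - ι (derivative w) / ι w := by
    rw [p₁, hP0, map_mul]
    field_simp
    linear_combination hwR
  refine ⟨(ι (X - C (x i)))⁻¹, inv_ne_zero hc0, ?_, ?_⟩
  · have : L.twist₁ (ι (X - C (x i)))⁻¹ = ι (-derivative w) / ι w := by
      rw [twist₁, hs1, hp₁, map_neg]
      field_simp
      ring
    rw [this]
    exact regularAt_div _ hwi
  · have : L.twist₂ (ι (X - C (x i)))⁻¹ = ι E / ι (A * w) := by
      rw [twist₂, hs2, hs1, hp₁, L.p₂_eq_div h3, hP0, map_mul, map_mul]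
      field_simp
      linear_combination ι (X - C (x i)) * hER
    rw [this]
    exact regularAt_div _ (by rw [eval_mul]; exact mul_ne_zero hA hwi)

/-- The coefficient `p₂` of the twisted operator, in terms of a solution `u = s v`. -/
theorem twist₂_eq {u : k[X]} (hu : L.apply u = 0) (hu0 : u ≠ 0) {s v : RatFunc k} (hs : s ≠ 0)
    (huv : ι u = s * v) :
    L.twist₂ s = -(ratDeriv (ratDeriv v) + L.twist₁ s * ratDeriv v) / v := by
  have hv : v ≠ 0 := by
    rintro rfl
    rw [mul_zero] at huv
    exact algebraMap_ratFunc_ne_zero hu0 huv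
  rw [apply, ← ratDeriv_algebraMap, ← ratDeriv_algebraMap, huv] at hu
  simp only [ratDeriv_mul, ratDeriv_add] at hu
  rw [twist₁, twist₂]
  field_simp
  linear_combination hu

theorem ratDeriv_X : ratDeriv (RatFunc.X : RatFunc k) = 1 := by
  rw [← RatFunc.algebraMap_X, ratDeriv_algebraMap]
  simp

theorem ratDeriv_X_pow (n : ℕ) :
    ratDeriv (RatFunc.X ^ n : RatFunc k) = (n : RatFunc k) * RatFunc.X ^ n / RatFunc.X := by
  have hX : (RatFunc.X : RatFunc k) ≠ 0 := RatFunc.X_ne_zero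
  induction n with
  | zero => rw [pow_zero, ratDeriv_one]; simp
  | succ n ih =>
    rw [pow_succ, ratDeriv_mul, ih, ratDeriv_X]
    field_simp
    push_cast
    ring

/-- For functions `f` which are regular at `∞`, the operator `D² + (2/x) D = x⁻² D x² D` raises
the order of vanishing at `∞` by four. -/
theorem degLE_ratDeriv_ratDeriv {f : RatFunc k} (hf : DegLE f 0) :
    DegLE (ratDeriv (ratDeriv f) + 2 / RatFunc.X * ratDeriv f) (-4) := by
  have hX : (RatFunc.X : RatFunc k) ≠ 0 := RatFunc.X_ne_zero
  have h1 : DegLE (RatFunc.X ^ 2 * ratDeriv f) 0 := (degLE_X_pow 2).mul hf.ratDeriv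
  have h2 := (degLE_X_inv_pow 2).mul h1.ratDeriv
  refine DegLE.mono ?_ (show (-(2 : ℕ) + -2 : ℤ) ≤ -4 by norm_num)
  convert h2 using 1
  rw [ratDeriv_mul, ratDeriv_X_pow]
  field_simp
  push_cast
  ring

/-- The exponents at `∞` control the coefficient of `1/x` in the expansion of `p₁` there. -/
theorem degLE_two_mul_X_sub (hr : 3 ≤ r) {n : ℕ} (hn : L.P₁.coeff (r - 2) = 2 - 2 * (n : k)) :
    DegLE (2 * RatFunc.X - RatFunc.X ^ 2 * L.twist₁ (RatFunc.X ^ n)) 0 := by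
  have hX : (RatFunc.X : RatFunc k) ≠ 0 := RatFunc.X_ne_zero
  have h0 := L.algebraMap_P₀_ne_zero
  have hR : r - 1 = r - 2 + 1 := by omega
  set E : k[X] := C (2 - 2 * (n : k)) * L.P₀ - X * L.P₁ with hE
  have hdeg : E.natDegree ≤ r - 2 := by
    rw [natDegree_le_iff_coeff_eq_zero]
    intro j hj
    obtain ⟨j, rfl⟩ : ∃ i, j = i + 1 := ⟨j - 1, by omega⟩
    rw [hE, coeff_sub, coeff_C_mul, coeff_X_mul]
    rcases (show r - 1 ≤ j + 1 by omega).eq_or_lt with h | h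
    · have h1 : L.P₀.coeff (j + 1) = 1 := by
        rw [← h, ← L.natDegree_P₀]
        exact L.monic_P₀
      rw [h1, show j = r - 2 by omega, hn, mul_one, sub_self]
    · rw [coeff_eq_zero_of_natDegree_lt (by rw [L.natDegree_P₀]; omega),
        coeff_eq_zero_of_natDegree_lt (lt_of_le_of_lt L.natDegree_P₁ (by omega)),
        mul_zero, sub_zero]
  have : 2 * RatFunc.X - RatFunc.X ^ 2 * L.twist₁ (RatFunc.X ^ n) = ι (X * E) / ι L.P₀ := by
    rw [twist₁, ratDeriv_X_pow, p₁, hE]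
    simp only [map_mul, map_sub, RatFunc.algebraMap_X, map_ofNat,
      map_natCast]
    field_simp
    ring
  rw [this]
  apply degLE_div
  right
  have h := natDegree_mul_le_of_le (natDegree_X_le (R := k)) hdeg
  rw [L.natDegree_P₀]
  omega

theorem degLE_algebraMap_div {u : k[X]} (n : ℕ) {e : ℤ} (he : (u.natDegree : ℤ) ≤ e + n) :
    DegLE (ι u / RatFunc.X ^ n) e := by
  rw [← RatFunc.algebraMap_X, ← map_pow]
  exact degLE_div (Or.inr (by rw [natDegree_X_pow]; exact he))

theorem degLE_div_algebraMap {u : k[X]} (n : ℕ) {e : ℤ} (he : (n : ℤ) ≤ e + u.natDegree) :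
    DegLE (RatFunc.X ^ n / ι u) e := by
  rw [← RatFunc.algebraMap_X, ← map_pow]
  exact degLE_div (Or.inr (by rw [natDegree_X_pow]; exact he))

/-- If the exponents at `∞` differ by one, as those of an ordinary point, then a twist by a power
of `x` removes the singularity. -/
theorem isRemovableAtInfty_of_coeff_P₁_eq (hr : 3 ≤ r) {u : k[X]}
    (hu : L.apply u = 0) (hu0 : u ≠ 0) (h1 : L.P₁.coeff (r - 2) = 2 - 2 * (u.natDegree : k)) :
    L.IsRemovableAtInfty := by
  have hX : (RatFunc.X : RatFunc k) ≠ 0 := RatFunc.X_ne_zero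
  have huR := algebraMap_ratFunc_ne_zero hu0
  set d := u.natDegree with hd
  set v := ι u / RatFunc.X ^ d with hv
  have huv : ι u = RatFunc.X ^ d * v := by rw [hv, mul_div_cancel₀ _ (pow_ne_zero _ hX)]
  have hv0 : v ≠ 0 := div_ne_zero huR (pow_ne_zero _ hX)
  have hvdeg : DegLE v 0 := degLE_algebraMap_div d (by simp [hd])
  have hvinv : DegLE v⁻¹ 0 := by
    rw [hv, inv_div]
    exact degLE_div_algebraMap d (by simp [hd])
  have hq := L.degLE_two_mul_X_sub hr h1
  refine ⟨RatFunc.X ^ d, pow_ne_zero _ hX, hq.regularAtInfty, DegLE.regularAtInfty ?_⟩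
  have hsum := (degLE_ratDeriv_ratDeriv hvdeg).sub
    (((degLE_X_inv_pow 2).mul hq).mul hvdeg.ratDeriv)
  have h := (((degLE_X_pow 4).mul hsum).mul hvinv).neg
  refine DegLE.mono ?_ (show ((4 : ℕ) + -4 + 0 : ℤ) ≤ 0 by norm_num)
  convert h using 1
  rw [L.twist₂_eq hu hu0 (pow_ne_zero _ hX) huv]
  field_simp
  ring

/-- If the exponents at `∞` differ by `-1` and the Wronskian `w` satisfies
`(w u^{p-2})' = O(x⁻³) w u^{p-2}`, then the twist by `x^{d+1}` removes the singularity: for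
`v = u / x^{d+1}`, the twisted `p₁` is `-2 v'/v` up to `O(x⁻³)`, so that the twisted `p₂` is
`v (1/v)''` up to `O(x⁻⁴)`. -/
theorem isRemovableAtInfty_of_natDegree_derivative_le {p : ℕ} [Fact p.Prime] [CharP k p]
    (hp2 : p ≠ 2) (hr : 3 ≤ r) {u : k[X]}
    (hu : L.apply u = 0) (hu0 : u ≠ 0) (h1 : L.P₁.coeff (r - 2) = -2 * (u.natDegree : k))
    {w : k[X]} (hw0 : w ≠ 0) (hw : L.P₀ * derivative w + L.P₁ * w = 0)
    (hT : (derivative (w * u ^ (p - 2))).natDegree + 3 ≤ (w * u ^ (p - 2)).natDegree) :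
    L.IsRemovableAtInfty := by
  have hp := (Fact.out : p.Prime).two_le
  obtain ⟨n, hn⟩ : ∃ n, p - 2 = n + 1 := ⟨p - 3, by omega⟩
  have hX : (RatFunc.X : RatFunc k) ≠ 0 := RatFunc.X_ne_zero
  have huR := algebraMap_ratFunc_ne_zero hu0
  have hwR := algebraMap_ratFunc_ne_zero hw0
  have h0 := L.algebraMap_P₀_ne_zero
  set d := u.natDegree with hd
  have hs : (RatFunc.X ^ (d + 1) : RatFunc k) ≠ 0 := pow_ne_zero _ hX
  set v := ι u / RatFunc.X ^ (d + 1) with hv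
  have huv : ι u = RatFunc.X ^ (d + 1) * v := by rw [hv, mul_div_cancel₀ _ hs]
  have hv0 : v ≠ 0 := div_ne_zero huR hs
  have hvdeg : DegLE v (-1) := degLE_algebraMap_div (d + 1) (by simp [hd])
  have hvinv : DegLE v⁻¹ 1 := by
    rw [hv, inv_div]
    exact degLE_div_algebraMap (d + 1) (by push_cast; omega)
  set g := RatFunc.X ^ d / ι u with hg
  have hgdeg : DegLE g 0 := degLE_div_algebraMap d (by simp [hd])
  have hq := L.degLE_two_mul_X_sub hr (n := d + 1) (by rw [h1]; push_cast; ring)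
  refine ⟨RatFunc.X ^ (d + 1), hs, hq.regularAtInfty, DegLE.regularAtInfty ?_⟩
  have hv' : DegLE (ratDeriv v) (-2) := (hvdeg.mono (by norm_num)).ratDeriv
  have hvg : v = (RatFunc.X * g)⁻¹ := by
    rw [hv, hg, pow_succ]
    field_simp
  have hg0 : g ≠ 0 := by
    rw [hg]
    exact div_ne_zero (pow_ne_zero _ hX) huR
  -- the logarithmic derivative of `w u^{p-2}`
  set e : RatFunc k := -(ι (derivative (w * u ^ (p - 2))) / ι (w * u ^ (p - 2))) with he
  have hedeg : DegLE e (-3) := (degLE_div (Or.inr (by omega))).neg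
  have hwR' : ι L.P₀ * ι (derivative w) + ι L.P₁ * ι w = 0 := by
    rw [← map_mul, ← map_mul, ← map_add, hw, map_zero]
  have hdu : ι (derivative u) = ratDeriv (RatFunc.X ^ (d + 1) * v) := by
    rw [← huv, ratDeriv_algebraMap]
  have htw : L.twist₁ (RatFunc.X ^ (d + 1)) = e - 2 * ratDeriv v / v := by
    have hp₁ : L.p₁ = -(ι (derivative w) / ι w) := by
      rw [p₁]
      field_simp
      linear_combination hwR'
    have he' : e = -(ι (derivative w) / ι w) + 2 * (ι (derivative u) / ι u) := by
      have hc2 : C ((p - 2 : ℕ) : k) = -2 := by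
        rw [cast_sub_two, C_neg]
        rfl
      rw [he, derivative_mul, derivative_pow, hc2, hn, Nat.add_sub_cancel]
      simp only [map_add, map_mul, map_pow, map_neg, map_ofNat]
      field_simp
      ring
    rw [twist₁, hp₁, he', hdu, huv, ratDeriv_mul]
    field_simp
    ring
  -- `x (1/v)'' = (x² g')'` for `g = 1/(x v)`, which is regular at infinity
  have hsecond := ((degLE_X_inv_pow 1).mul ((degLE_X_pow 2).mul hgdeg.ratDeriv).ratDeriv)
  have hsum := (hvdeg.mul hsecond).sub (hedeg.mul (hv'.mul hvinv))
  have h := (degLE_X_pow 4).mul hsum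
  have h' := h.mono (show ((4 : ℕ) + (-1 + (-(1 : ℕ) + -2)) : ℤ) ≤ 0 by norm_num)
  have hgv : g = (RatFunc.X * v)⁻¹ := by
    rw [hvg]
    field_simp
  have hg' : RatFunc.X ^ 2 * ratDeriv g = -1 * ((v + RatFunc.X * ratDeriv v) * (v ^ 2)⁻¹) := by
    rw [hgv, ratDeriv_inv, ratDeriv_mul, ratDeriv_X]
    field_simp
    ring
  have hneg : ∀ f : RatFunc k, ratDeriv (-1 * f) = -ratDeriv f := fun f => by
    rw [neg_one_mul]
    exact ratDerivation.map_neg f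
  have hg'' : ratDeriv (RatFunc.X ^ 2 * ratDeriv g)
      = -(RatFunc.X * (ratDeriv (ratDeriv v) * v - 2 * ratDeriv v ^ 2) / v ^ 3) := by
    rw [hg', hneg, ratDeriv_mul, ratDeriv_inv, ratDeriv_add, ratDeriv_mul, ratDeriv_X, sq v,
      ratDeriv_mul]
    field_simp
    ring
  convert h' using 1
  rw [L.twist₂_eq hu hu0 hs huv, htw, hg'']
  field_simp
  ring

end FuchsianOperator

/-- If the degree of `T` is divisible by `p` and drops by more than `p - 1` under `D^{p-1}`, then
`T` has no term in the degree below its leading one, and its derivative drops by more than two. -/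
theorem natDegree_derivative_add_three_le {k : Type u} [Field k] {p : ℕ} [Fact p.Prime] [CharP k p]
    {T : k[X]} {n : ℕ} (hn : (derivative^[p - 1] T).natDegree = p * n)
    (hT : T.natDegree = p * n + 2 * p) :
    (derivative T).natDegree + 3 ≤ T.natDegree := by
  have hp := (Fact.out : p.Prime).two_le
  suffices h : (derivative T).natDegree ≤ T.natDegree - 3 by omega
  rw [natDegree_le_iff_coeff_eq_zero]
  intro j hj
  rw [coeff_derivative]
  rcases (show j + 1 = T.natDegree - 1 ∨ j + 1 = T.natDegree ∨ T.natDegree < j + 1 by omega)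
    with h | h | h
  · rw [coeff_eq_zero_of_coeff_iterate_derivative (p := p), zero_mul]
    · exact ⟨n + 2, by rw [h, hT, mul_add]; omega⟩
    · exact coeff_eq_zero_of_natDegree_lt (by omega)
  · have : ((j + 1 : ℕ) : k) = 0 := by
      rw [CharP.cast_eq_zero_iff k p]
      exact ⟨n + 2, by rw [h, hT]; ring⟩
    rw [← Nat.cast_succ, Nat.succ_eq_add_one, this, mul_zero]
  · rw [coeff_eq_zero_of_natDegree_lt h, zero_mul]

/-! ### The invariants of the deformation datum -/

section Invariants

variable {k : Type u} [Field k] {p : ℕ}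

local notation "ι" => algebraMap k[X] (RatFunc k)

theorem linFactor_eq (c : k) : linFactor c = ι (X - C c) := by
  rw [linFactor, map_sub, RatFunc.algebraMap_X, RatFunc.algebraMap_C]

theorem linFactor_ne_zero (c : k) : linFactor c ≠ 0 := by
  rw [linFactor_eq]
  exact algebraMap_ratFunc_ne_zero (X_sub_C_ne_zero c)

theorem div_pred_eq_one_iff (hp : 2 ≤ p) (N : ℕ) : (N : ℚ) / ((p : ℚ) - 1) = 1 ↔ N + 1 = p := by
  have hp' : (p : ℚ) - 1 ≠ 0 := by
    have : (2 : ℚ) ≤ p := by exact_mod_cast hp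
    linarith
  rw [div_eq_one_iff_eq hp', eq_sub_iff_add_eq]
  exact_mod_cast Iff.rfl

theorem isSupersingular_div_iff (hp : 2 ≤ p) (N : ℕ) :
    IsSupersingular p ((N : ℚ) / ((p : ℚ) - 1)) ↔ N = p + 1 := by
  have hp' : (p : ℚ) - 1 ≠ 0 := by
    have : (2 : ℚ) ≤ p := by exact_mod_cast hp
    linarith
  rw [IsSupersingular, div_left_inj' hp']
  exact_mod_cast Iff.rfl

theorem ratModEq_div_one_iff (hp : 2 ≤ p) (N : ℕ) :
    RatModEq p ((N : ℚ) / ((p : ℚ) - 1)) 1 ↔ p ∣ N + 1 := by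
  have hp' : (p : ℚ) - 1 ≠ 0 := by
    have : (2 : ℚ) ≤ p := by exact_mod_cast hp
    linarith
  have h : ((p : ℚ) - 1) * ((N : ℚ) / ((p : ℚ) - 1) - 1) = N - (p - 1) := by
    field_simp
  rw [RatModEq, h, ← Int.natCast_dvd_natCast]
  constructor
  · rintro ⟨m, hm⟩
    refine ⟨m + 1, ?_⟩
    have : (N : ℤ) - (p - 1) = p * m := by exact_mod_cast hm
    push_cast
    linear_combination this
  · rintro ⟨m, hm⟩
    refine ⟨m - 1, ?_⟩
    push_cast at hm
    have : (N : ℤ) - (p - 1) = p * (m - 1) := by linear_combination hm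
    exact_mod_cast this

variable {r : ℕ} {x : Fin (r - 1) → k}

open FuchsianOperator

theorem algebraMap_singProd (m : Fin (r - 1) → ℕ) :
    ι (singProd x m) = ∏ i, linFactor (x i) ^ m i := by
  rw [singProd, map_prod]
  exact Finset.prod_congr rfl fun i _ => by rw [map_pow, linFactor_eq]

theorem rootMultiplicity_singProd_of_forall_ne {m : Fin (r - 1) → ℕ} {c : k} (hc : ∀ i, x i ≠ c) :
    (singProd x m).rootMultiplicity c = 0 := by
  apply rootMultiplicity_eq_zero
  rw [IsRoot.def, singProd, eval_prod, Finset.prod_eq_zero_iff]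
  rintro ⟨i, -, hi⟩
  rw [eval_pow, eval_sub, eval_X, eval_C] at hi
  exact hc i (sub_eq_zero.1 (eq_zero_of_pow_eq_zero hi)).symm

theorem rootMultiplicity_singProd (hx : Function.Injective x) (m : Fin (r - 1) → ℕ)
    (i : Fin (r - 1)) : (singProd x m).rootMultiplicity (x i) = m i := by
  classical
  have h0 := (monic_singProd (x := x) m).ne_zero
  rw [singProd, ← Finset.mul_prod_erase _ _ (Finset.mem_univ i)] at h0 ⊢
  rw [rootMultiplicity_mul h0, rootMultiplicity_X_sub_C_pow, rootMultiplicity_eq_zero, add_zero]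
  rw [IsRoot.def, eval_prod, Finset.prod_eq_zero_iff]
  rintro ⟨j, hj, hi⟩
  rw [eval_pow, eval_sub, eval_X, eval_C] at hi
  exact (Finset.ne_of_mem_erase hj) (hx (sub_eq_zero.1 (eq_zero_of_pow_eq_zero hi))).symm

/-- Products of powers of the `x - xᵢ` have neither zeros nor poles at other finite points. -/
theorem exists_prod_zpow_linFactor (n : Fin (r - 1) → ℤ) : ∃ a b : k[X],
    ∏ i, linFactor (x i) ^ n i = ι a / ι b ∧
      ∀ c, (∀ i, x i ≠ c) → a.eval c ≠ 0 ∧ b.eval c ≠ 0 := by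
  refine ⟨singProd x fun i => (n i).toNat, singProd x fun i => (-n i).toNat, ?_, fun c hc => ?_⟩
  · rw [algebraMap_singProd, algebraMap_singProd, ← Finset.prod_div_distrib]
    refine Finset.prod_congr rfl fun i _ => ?_
    rw [← zpow_natCast, ← zpow_natCast, ← zpow_sub₀ (linFactor_ne_zero _),
      Int.toNat_sub_toNat_neg]
  · have hs : ∀ m : Fin (r - 1) → ℕ, (singProd x m).eval c ≠ 0 := fun m h => by
      have := (rootMultiplicity_pos (monic_singProd (x := x) m).ne_zero).2 h
      rw [rootMultiplicity_singProd_of_forall_ne hc] at this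
      exact lt_irrefl _ this
    exact ⟨hs _, hs _⟩

open Classical in
/-- The zeros of `h` outside of the points `xᵢ`. -/
def zerosOutside (x : Fin (r - 1) → k) (h : k[X]) : Finset k :=
  h.roots.toFinset.filter fun c => ∀ i, x i ≠ c

theorem mem_zerosOutside {h : k[X]} (h0 : h ≠ 0) {c : k} :
    c ∈ zerosOutside x h ↔ h.eval c = 0 ∧ ∀ i, x i ≠ c := by
  classical
  rw [zerosOutside, Finset.mem_filter, Multiset.mem_toFinset, mem_roots h0, IsRoot.def]

theorem algebraMap_eq_prod_linFactor [IsAlgClosed k] (hx : Function.Injective x) {h : k[X]}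
    (h0 : h ≠ 0) : ι h = RatFunc.C h.leadingCoeff *
      ((∏ i, linFactor (x i) ^ h.rootMultiplicity (x i)) *
        ∏ c ∈ zerosOutside x h, linFactor c ^ h.rootMultiplicity c) := by
  classical
  have hfac : h = C h.leadingCoeff * ∏ c ∈ h.roots.toFinset, (X - C c) ^ h.rootMultiplicity c := by
    conv_lhs => rw [(IsAlgClosed.splits h).eq_prod_roots, Finset.prod_multiset_map_count]
    congr 1
    exact Finset.prod_congr rfl fun c _ => by rw [count_roots]
  have hsub : ∏ c ∈ h.roots.toFinset, linFactor c ^ h.rootMultiplicity c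
      = ∏ c ∈ Finset.univ.image x ∪ zerosOutside x h, linFactor c ^ h.rootMultiplicity c := by
    refine Finset.prod_subset (fun c hc => ?_) fun c _ hc => ?_
    · rw [Multiset.mem_toFinset, mem_roots h0] at hc
      rw [Finset.mem_union, mem_zerosOutside h0, Finset.mem_image]
      by_cases h1 : ∃ i, x i = c
      · obtain ⟨i, hi⟩ := h1
        exact Or.inl ⟨i, Finset.mem_univ i, hi⟩
      · exact Or.inr ⟨hc, fun i hi => h1 ⟨i, hi⟩⟩
    · rw [Multiset.mem_toFinset, mem_roots h0] at hc
      rw [rootMultiplicity_eq_zero hc, pow_zero]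
  have hdisj : Disjoint (Finset.univ.image x) (zerosOutside x h) := by
    rw [Finset.disjoint_left]
    intro c hc hc'
    obtain ⟨i, -, hi⟩ := Finset.mem_image.1 hc
    exact ((mem_zerosOutside h0).1 hc').2 i hi
  conv_lhs => rw [hfac]
  rw [map_mul, map_prod, RatFunc.algebraMap_C, ← Finset.prod_image (f := fun c =>
    linFactor c ^ h.rootMultiplicity c) (fun i _ j _ hij => hx hij), ← Finset.prod_union hdisj,
    ← hsub]
  congr 1
  exact Finset.prod_congr rfl fun c _ => by rw [map_pow, linFactor_eq]

variable [Fact p.Prime] [CharP k p]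

omit [Fact p.Prime] in
theorem ratDeriv_pow_char (f : RatFunc k) : ratDeriv (f ^ p) = 0 := by
  have h := ratDerivation.leibniz_pow f p
  have : CharP (RatFunc k) p := charP_of_injective_algebraMap (algebraMap k _).injective p
  rw [← Nat.cast_smul_eq_nsmul (RatFunc k), CharP.cast_eq_zero, zero_smul] at h
  exact h

omit [Fact p.Prime] in
/-- `p`-th powers are constants for `D`, in particular the factor `u^p` between
`w u^{p-2}` and `w / u²`. -/
theorem iterate_ratDeriv_pow_mul {w u h : k[X]}
    (hT : derivative^[p - 1] (w * u ^ (p - 2)) = u ^ p * h ^ p) (f : RatFunc k) :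
    ratDeriv^[p - 1] (f ^ p * ι (w * u ^ (p - 2))) = (f * ι u * ι h) ^ p := by
  rw [← coe_ratDerivation, iterate_derivation_mul_of_eq_zero ratDerivation (ratDeriv_pow_char f),
    coe_ratDerivation, iterate_ratDeriv_algebraMap, hT]
  simp only [map_mul, map_pow, mul_pow]
  ring

end Invariants

/-! ### The deformation datum of a Fuchsian operator -/

section Datum

variable {k : Type u} [Field k]

local notation "ι" => algebraMap k[X] (RatFunc k)

/-- The form `ω` is `z₁ dx` with `z₁^{p-1} = -h^p u² / w`, where `w = ∏ (x - xᵢ)^{mᵢ}` solves the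
Wronskian equation and `D^{p-1}(w / u²) = h^p`. Its invariant at a finite point is
`(N + 2 ord u) / (p - 1)` with `N = p ord h + (p - 1) - ord w`, and division of `N` by `p - 1`
yields `a` and `ν`. -/
theorem exists_isAttachedTo {p : ℕ} [Fact p.Prime] (hp2 : p ≠ 2)
    [IsAlgClosed k] [CharP k p] {r : ℕ} (hr : 3 ≤ r) {x : Fin (r - 1) → k}
    (hx : Function.Injective x) {L : FuchsianOperator x} {αr : k} {u : k[X]}
    (hu : L.IsMinimalSolution u) (h3 : L.P₃ = 0)
    (hαr : L.HasLocalExponentsAtInfty (-(u.natDegree : k)) (-(u.natDegree : k) + αr))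
    (hux : ∀ i, u.eval (x i) ≠ 0) {m : Fin (r - 1) → ℕ} (hmlt : ∀ i, m i < p)
    (hm : ∀ i, L.P₁.eval (x i) = -((m i : k) * (derivative L.P₀).eval (x i)))
    {h : k[X]} (h0 : h ≠ 0) (hsimple : ∀ c, u.rootMultiplicity c ≤ 1)
    (hT : derivative^[p - 1] (FuchsianOperator.singProd x m * u ^ (p - 2)) = u ^ p * h ^ p) :
    ∃ (𝒟 : DeformationDatum p k) (σ : OnePoint k → ℚ) (a ν : OnePoint k → ℕ)
      (B : Finset k) (z : 𝒟.K) (ε : k),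
      IsAttachedTo L u 𝒟 σ a ν B z ε ∧
      (∀ i, (1 + m i : k) = (ν (x i : k) : k) - (a (x i : k) : k)) ∧
      αr = (ν OnePoint.infty : k) - (a OnePoint.infty : k) := by
  classical
  have hp : p.Prime := Fact.out
  have hp3 : 3 ≤ p := by
    have := hp.two_le
    omega
  have hpQ : (p : ℚ) - 1 = ((p - 1 : ℕ) : ℚ) := by
    rw [Nat.cast_sub hp.one_le, Nat.cast_one]
  have hpQ0 : (p : ℚ) - 1 ≠ 0 := by
    rw [hpQ]
    exact_mod_cast (by omega : p - 1 ≠ 0)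
  have hu0 := hu.1.ne_zero
  set w := FuchsianOperator.singProd x m with hw
  have hw0 : w ≠ 0 := (FuchsianOperator.monic_singProd m).ne_zero
  have hwode := L.wronskian_singProd hr hx hm
  set d := u.natDegree with hd
  -- the degree of `w u^{p-2}` drops by at least `p - 1` under `D^{p-1}`
  have hTdeg : (w * u ^ (p - 2)).natDegree = w.natDegree + (p - 2) * d := by
    rw [natDegree_mul hw0 (pow_ne_zero _ hu0), natDegree_pow]
  have hHdeg : (derivative^[p - 1] (w * u ^ (p - 2))).natDegree = p * (d + h.natDegree) := by
    rw [hT, natDegree_mul (pow_ne_zero _ hu0) (pow_ne_zero _ h0), natDegree_pow, natDegree_pow]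
    ring
  obtain ⟨Ninf, hNinf⟩ : ∃ N, w.natDegree + (p - 2) * d = N + (p - 1) + p * (d + h.natDegree) := by
    have h1 := natDegree_iterate_derivative (w * u ^ (p - 2)) (p - 1)
    rw [hHdeg, hTdeg] at h1
    have h2 : p - 1 ≤ w.natDegree + (p - 2) * d := by
      by_contra! hlt
      have h3 := iterate_derivative_eq_zero (p := w * u ^ (p - 2)) (x := p - 1) (by rwa [hTdeg])
      rw [hT] at h3
      exact mul_ne_zero (pow_ne_zero _ hu0) (pow_ne_zero _ h0) h3
    exact ⟨w.natDegree + (p - 2) * d - (p - 1) - p * (d + h.natDegree), by omega⟩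
  -- there is no truncation in the subtraction, by `hNx` and `hNc`
  let Nfin : k → ℕ := fun c => p * h.rootMultiplicity c + (p - 1) - w.rootMultiplicity c
  have hNx : ∀ i, Nfin (x i) + m i = p * h.rootMultiplicity (x i) + (p - 1) := by
    intro i
    have h1 := hmlt i
    simp only [Nfin, hw, rootMultiplicity_singProd hx]
    omega
  have hNc : ∀ c, (∀ i, x i ≠ c) → Nfin c = p * h.rootMultiplicity c + (p - 1) := by
    intro c hc
    simp only [Nfin, hw, rootMultiplicity_singProd_of_forall_ne hc, Nat.sub_zero]
  let N : OnePoint k → ℕ := fun c => OnePoint.elim c Ninf Nfin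
  have hN : ∀ c : k, N (c : OnePoint k) = Nfin c := fun c => rfl
  have hNi : N OnePoint.infty = Ninf := rfl
  let a : OnePoint k → ℕ := fun c => N c % (p - 1)
  let ν : OnePoint k → ℕ := fun c => N c / (p - 1)
  have haN : ∀ c, a c + (p - 1) * ν c = N c := fun c => Nat.mod_add_div _ _
  have haQ : ∀ c, (a c : ℚ) / ((p : ℚ) - 1) + ν c = (N c : ℚ) / ((p : ℚ) - 1) := by
    intro c
    rw [← haN c, hpQ]
    rw [hpQ] at hpQ0
    push_cast
    field_simp
  have hak : ∀ c, (ν c : k) - (a c : k) = -(N c : k) := by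
    intro c
    rw [← haN c]
    push_cast [Nat.cast_sub hp.one_le]
    rw [CharP.cast_eq_zero k p]
    ring
  let σ : OnePoint k → ℚ := fun c => OnePoint.elim c ((Ninf : ℚ) / ((p : ℚ) - 1))
    fun c => ((Nfin c + 2 * u.rootMultiplicity c : ℕ) : ℚ) / ((p : ℚ) - 1)
  have hσ : ∀ c : k, σ (c : OnePoint k)
    = ((Nfin c + 2 * u.rootMultiplicity c : ℕ) : ℚ) / ((p : ℚ) - 1) := fun c => rfl
  have hσi : σ OnePoint.infty = (Ninf : ℚ) / ((p : ℚ) - 1) := rfl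
  have hσx : ∀ i, σ (x i : OnePoint k) = (Nfin (x i) : ℚ) / ((p : ℚ) - 1) := by
    intro i
    rw [hσ, rootMultiplicity_eq_zero (hux i), mul_zero, add_zero]
  -- multiplicities of the zeros of `u`
  have humult : ∀ c, u.rootMultiplicity c = if u.eval c = 0 then 1 else 0 := by
    intro c
    split_ifs with hc
    · have h1 := (rootMultiplicity_pos hu0).2 hc
      have h2 := hsimple c
      omega
    · exact rootMultiplicity_eq_zero hc
  let B := zerosOutside x h
  have hB : ∀ c, c ∈ B ↔ h.eval c = 0 ∧ ∀ i, x i ≠ c := fun c => mem_zerosOutside h0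
  have hBmult : ∀ c, (∀ i, x i ≠ c) → (c ∈ B ↔ h.rootMultiplicity c ≠ 0) := by
    intro c hc
    rw [hB, and_iff_left hc, ← Nat.pos_iff_ne_zero, rootMultiplicity_pos h0, IsRoot.def]
  -- the function `G = -h^p u² / w`
  have hwR : ι w ≠ 0 := algebraMap_ratFunc_ne_zero hw0
  have huR : ι u ≠ 0 := algebraMap_ratFunc_ne_zero hu0
  have hhR : ι h ≠ 0 := algebraMap_ratFunc_ne_zero h0
  have hA0 : -(h ^ p * u ^ 2) ≠ 0 := neg_ne_zero.2 (mul_ne_zero (pow_ne_zero _ h0)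
    (pow_ne_zero _ hu0))
  set G : RatFunc k := ι (-(h ^ p * u ^ 2)) / ι w with hG
  have hG0 : G ≠ 0 := div_ne_zero (algebraMap_ratFunc_ne_zero hA0) hwR
  have hup : ι u ^ p = ι u ^ (p - 2) * ι u ^ 2 := by
    rw [← pow_add, Nat.sub_add_cancel (by omega)]
  have hDG : ratDeriv^[p - 1] G⁻¹ = -1 := by
    have h1 : G⁻¹ = (-(ι h * ι u)⁻¹) ^ p * ι (w * u ^ (p - 2)) := by
      rw [hG, (hp.odd_of_ne_two hp2).neg_pow, inv_pow, mul_pow, hup]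
      simp only [map_neg, map_mul, map_pow]
      field_simp
    rw [h1, iterate_ratDeriv_pow_mul hT]
    have h2 : -(ι h * ι u)⁻¹ * ι u * ι h = -1 := by field_simp
    rw [h2, (hp.odd_of_ne_two hp2).neg_one_pow]
  obtain ⟨𝒟, z₁, hz₁, hgen, hω⟩ := exists_deformationDatum hp2 hG0 hDG
  have hz₁0 : z₁ ≠ 0 := by
    rintro rfl
    rw [zero_pow (by omega), eq_comm, map_eq_zero] at hz₁
    exact hG0 hz₁
  -- the constant `ε` and the product `R` with `z₁ = ε z R`
  obtain ⟨ε, hε⟩ := IsAlgClosed.exists_pow_nat_eq (-h.leadingCoeff ^ p)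
    (show 0 < p - 1 by omega)
  have hlead : h.leadingCoeff ≠ 0 := leadingCoeff_ne_zero.2 h0
  have hε0 : ε ≠ 0 := by
    rintro rfl
    rw [zero_pow (by omega), eq_comm, neg_eq_zero] at hε
    exact pow_ne_zero _ hlead hε
  set R : RatFunc k := (∏ i, linFactor (x i) ^ ((ν (x i : k) : ℤ) - 1))
        * ∏ c ∈ B, linFactor c ^ ((ν (c : k) : ℤ) - 1) with hR
  have hR0 : R ≠ 0 := mul_ne_zero
    (Finset.prod_ne_zero_iff.2 fun i _ => zpow_ne_zero _ (linFactor_ne_zero _))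
    (Finset.prod_ne_zero_iff.2 fun i _ => zpow_ne_zero _ (linFactor_ne_zero _))
  have hlin : ∀ (c : k) (e m' : ℕ), Nfin c + m' = p * e + (p - 1) →
      linFactor c ^ (e * p) = linFactor c ^ m' * ((linFactor c ^ ((ν (c : k) : ℤ) - 1)) ^ (p - 1)
        * linFactor c ^ a (c : k)) := by
    intro c e m' hN'
    rw [← zpow_natCast, ← zpow_natCast, ← zpow_natCast, ← zpow_natCast, ← zpow_mul,
      ← zpow_add₀ (linFactor_ne_zero c), ← zpow_add₀ (linFactor_ne_zero c)]
    congr 1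
    have h1 := haN (c : k)
    rw [hN] at h1
    zify [hp.one_le] at h1 hN' ⊢
    linear_combination -hN' - h1
  have hGR : G = RatFunc.C ε ^ (p - 1) * R ^ (p - 1) *
      ((∏ i, linFactor (x i) ^ a (x i : k)) * (∏ c ∈ B, linFactor c ^ a (c : k)) * ι u ^ 2) := by
    have h1 := congrArg (fun f => f ^ p) (algebraMap_eq_prod_linFactor hx h0)
    simp only [mul_pow, ← Finset.prod_pow, ← pow_mul] at h1
    rw [Finset.prod_congr rfl fun i _ => hlin (x i) _ _ (hNx i),
      Finset.prod_congr rfl fun c hc => hlin c (h.rootMultiplicity c) 0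
        (by rw [add_zero]; exact hNc c ((hB c).1 hc).2),
      Finset.prod_mul_distrib, Finset.prod_mul_distrib] at h1
    simp only [pow_zero, one_mul, Finset.prod_mul_distrib] at h1
    rw [← algebraMap_singProd, ← hw] at h1
    rw [hG, div_eq_iff hwR, ← map_pow, hε, hR, mul_pow, ← Finset.prod_pow, ← Finset.prod_pow]
    simp only [map_neg, map_mul, map_pow, h1]
    ring
  set z : 𝒟.K := z₁ / (algebraMap k 𝒟.K ε * algebraMap (RatFunc k) 𝒟.K R) with hz
  have hεK : algebraMap k 𝒟.K ε ≠ 0 := by simpa using hε0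
  have hεK' : algebraMap k 𝒟.K ε = algebraMap (RatFunc k) 𝒟.K (RatFunc.C ε) := by
    rw [← RatFunc.algebraMap_eq_C, ← IsScalarTower.algebraMap_apply]
  have hRK : algebraMap (RatFunc k) 𝒟.K R ≠ 0 := by simpa using hR0
  have hz₁z : z₁ = algebraMap k 𝒟.K ε * z * algebraMap (RatFunc k) 𝒟.K R := by
    rw [hz]
    field_simp
  -- the function `Q`, which is inverse to `w` up to a `p`-th power
  set Q : RatFunc k := wronskianQ x a ν with hQ
  set g : RatFunc k := ∏ i, linFactor (x i) ^
    ((h.rootMultiplicity (x i) : ℤ) + 1 - (ν (x i : k) : ℤ)) with hg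
  have hg0 : g ≠ 0 := Finset.prod_ne_zero_iff.2 fun i _ => zpow_ne_zero _ (linFactor_ne_zero _)
  have hQ0 : Q ≠ 0 := Finset.prod_ne_zero_iff.2 fun i _ => zpow_ne_zero _ (linFactor_ne_zero _)
  have hQw : Q * ι w = g ^ p := by
    rw [hQ, wronskianQ, hw, algebraMap_singProd, hg, ← Finset.prod_mul_distrib, ← Finset.prod_pow]
    refine Finset.prod_congr rfl fun i _ => ?_
    rw [← zpow_natCast, ← zpow_natCast, ← zpow_mul, ← zpow_add₀ (linFactor_ne_zero _)]
    congr 1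
    have h1 := haN (x i : k)
    have h2 := hNx i
    rw [hN] at h1
    zify [hp.one_le] at h1 h2
    linear_combination h1 + h2
  -- the order of `G` at the finite points, and at infinity
  have hAmult : ∀ c, (-(h ^ p * u ^ 2)).rootMultiplicity c
      = p * h.rootMultiplicity c + 2 * u.rootMultiplicity c := by
    intro c
    rw [← count_roots, roots_neg, count_roots, rootMultiplicity_mul (neg_ne_zero.1 hA0),
      ← count_roots, ← count_roots, roots_pow, roots_pow, Multiset.count_nsmul,
      Multiset.count_nsmul, count_roots, count_roots]
  have hAdeg : (-(h ^ p * u ^ 2)).natDegree = p * h.natDegree + 2 * d := by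
    rw [natDegree_neg, natDegree_mul (pow_ne_zero _ h0) (pow_ne_zero _ hu0), natDegree_pow,
      natDegree_pow]
  have hNw : ∀ c, Nfin c + w.rootMultiplicity c = p * h.rootMultiplicity c + (p - 1) := by
    intro c
    by_cases hc : ∃ i, x i = c
    · obtain ⟨i, rfl⟩ := hc
      rw [hw, rootMultiplicity_singProd hx]
      exact hNx i
    · have hc' : ∀ i, x i ≠ c := fun i hi => hc ⟨i, hi⟩
      rw [hw, rootMultiplicity_singProd_of_forall_ne hc', add_zero]
      exact hNc c hc'
  have hsing : ∀ N' : ℕ, N' + 1 ≠ p → N' ≠ p + 1 → ¬ p ∣ N' + 1 →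
      IsSingular p ((N' : ℚ) / ((p : ℚ) - 1)) := fun N' h1 h2 h3 =>
    ⟨(div_pred_eq_one_iff hp.two_le N').not.2 h1, (isSupersingular_div_iff hp.two_le N').not.2 h2,
      (ratModEq_div_one_iff hp.two_le N').not.2 h3⟩
  have hαN : αr = -(Ninf : k) := by
    have h1 := congrArg (Nat.cast (R := k)) hNinf
    push_cast [Nat.cast_sub hp.one_le, Nat.cast_sub hp.two_le, CharP.cast_eq_zero k p] at h1
    have h2 := hαr.1
    rw [L.coeff_P₁ hr hx hm] at h2
    linear_combination h2 - h1
  refine ⟨𝒟, σ, a, ν, B, z, ε, ?_, ?_, ?_⟩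
  · refine
      { ramification := ?_
        a_lt := fun c => Nat.mod_lt _ (by omega)
        disjoint := fun i hi => ((hB _).1 hi).2 i rfl
        sigma_sing := fun i => by rw [haQ, hN, hσx]
        sigma_infty := by rw [haQ, hNi, hσi]
        spike := ?_
        sigma_spike := ?_
        sigma_other := ?_
        monic := hu.1
        squarefree := squarefree_of_rootMultiplicity_le_one hu0 hsimple
        supersingular_iff := ?_
        spike_iff := ?_
        singular := ?_
        singular_infty := ?_
        kummer := ?_
        generates := ?_
        ε_ne_zero := hε0
        omega_eq := by rw [hω, hz₁z]
        mem_B_iff := ?_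
        p₁_eq := ?_
        p₂_eq := ⟨L.P₂, L.natDegree_P₂, ?_, L.p₂_eq_div h3⟩
        apply_eq := hu.2.1 }
    · intro c
      refine ⟨exists_liesAbove c, fun P hP => ?_⟩
      cases c with
      | infty =>
        obtain ⟨n, hn, hn'⟩ := hasOrderAt_of_liesAbove_infty hz₁0 hA0 hw0 hz₁ hgen P hP
        refine ⟨n, hω ▸ hn, ?_⟩
        rw [← hn', hσi, hAdeg, eq_sub_iff_add_eq, div_add_one hpQ0]
        congr 1
        have h1 := congrArg (Nat.cast (R := ℚ)) hNinf
        push_cast [Nat.cast_sub hp.one_le, Nat.cast_sub hp.two_le] at h1 ⊢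
        linear_combination -h1
      | coe c =>
        obtain ⟨n, hn, hn'⟩ := hasOrderAt_of_liesAbove_coe hz₁0 hA0 hw0 hz₁ hgen c P hP
        refine ⟨n, hω ▸ hn, ?_⟩
        rw [← hn', hσ, hAmult, div_add_one hpQ0]
        congr 1
        have h1 := congrArg (Nat.cast (R := ℚ)) (hNw c)
        push_cast [Nat.cast_sub hp.one_le] at h1 ⊢
        linear_combination h1
    · intro c hc
      have hcx := ((hB c).1 hc).2
      have he := (hBmult c hcx).1 hc
      rw [haQ, hN, hNc c hcx]
      refine ⟨(div_pred_eq_one_iff hp.two_le _).not.2 ?_, (ratModEq_div_one_iff hp.two_le _).2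
        ⟨h.rootMultiplicity c + 1, ?_⟩⟩
      · have := Nat.mul_pos hp.pos (Nat.pos_of_ne_zero he)
        omega
      · rw [mul_add]
        omega
    · intro c hc
      rw [haQ, hN, hσ, humult]
      split_ifs
      · push_cast
        ring
      · push_cast
        ring
    · intro c hcx hc
      have he : h.rootMultiplicity c = 0 := by
        by_contra he
        exact hc ((hBmult c hcx).2 he)
      rw [hσ, humult, hNc c hcx, he]
      split_ifs
      · congr 1
        rw [show p * 0 + (p - 1) + 2 * 1 = p + 1 by omega]
        push_cast
        ring
      · rw [div_pred_eq_one_iff hp.two_le]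
        omega
    · intro c hcx
      rw [hσ, isSupersingular_div_iff hp.two_le, hBmult c hcx, humult, hNc c hcx]
      rcases Nat.eq_zero_or_pos (h.rootMultiplicity c) with he | he
      · split_ifs with huc <;> simp [he, huc]
        omega
      · have h1 := Nat.mul_le_mul_left p he
        split_ifs with huc <;> simp [he.ne', huc] <;> omega
    · intro c hcx
      rw [hσ, IsSpike, Ne, div_pred_eq_one_iff hp.two_le, ratModEq_div_one_iff hp.two_le,
        hBmult c hcx, humult, hNc c hcx]
      have e1 : p * h.rootMultiplicity c + (p - 1) + 2 * 1 + 1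
          = p * (h.rootMultiplicity c + 1) + 2 := by
        rw [mul_add]
        omega
      have e2 : p * h.rootMultiplicity c + (p - 1) + 2 * 0 + 1
          = p * (h.rootMultiplicity c + 1) := by
        rw [mul_add]
        omega
      split_ifs with huc
      · simp only [huc, ne_eq, not_true_eq_false, and_false, iff_false, e1]
        rintro ⟨-, h1⟩
        rw [Nat.dvd_add_right (dvd_mul_right _ _)] at h1
        have := Nat.le_of_dvd two_pos h1
        omega
      · simp only [huc, ne_eq, not_false_eq_true, and_true, e2, dvd_mul_right, not_iff_not]
        constructor
        · intro h1
          have h2 : p * (h.rootMultiplicity c + 1) = p * 1 := by omega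
          have := Nat.eq_of_mul_eq_mul_left hp.pos h2
          omega
        · intro h1
          rw [h1]
          omega
    · intro i hrem
      rw [hσx]
      have hNxi := hNx i
      have hmi : m i ≠ 0 := fun h1 => hrem (L.isRemovableAt_of_eval_P₁_eq_zero hx h3 hu.2.1
        (hux i) (by rw [hm, h1]; simp))
      have hmlti := hmlt i
      refine hsing _ (fun h1 => ?_) (fun h1 => ?_) (fun h1 => ?_)
      · have h2 : p ∣ m i := ⟨h.rootMultiplicity (x i), by omega⟩
        exact absurd (Nat.le_of_dvd (Nat.pos_of_ne_zero hmi) h2) (by omega)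
      · -- here `h` vanishes to the order one, and the exponent is `-1`
        have he : h.rootMultiplicity (x i) = 1 := by
          rcases lt_trichotomy (h.rootMultiplicity (x i)) 1 with he | he | he
          · rw [Nat.lt_one_iff.1 he] at hNxi
            omega
          · exact he
          · have := Nat.mul_le_mul_left p he
            omega
        rw [he] at hNxi
        have hhi : h.eval (x i) = 0 := (rootMultiplicity_pos h0).1 (by omega)
        refine hrem (L.isRemovableAt_of_eval_iterate_derivative_eq_zero hp2 hr hx h3 hu.2.1 hm
          (hux i) (by omega) ?_)
        rw [← hw, hT, eval_mul, eval_pow, eval_pow, hhi, zero_pow hp.ne_zero, mul_zero]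
      · have h2 : p ∣ m i := by
          rw [← Nat.dvd_add_right h1]
          exact ⟨h.rootMultiplicity (x i) + 1, by rw [mul_add]; omega⟩
        exact absurd (Nat.le_of_dvd (Nat.pos_of_ne_zero hmi) h2) (by omega)
    · intro hrem
      rw [hσi]
      have hreg : ¬ p ∣ Ninf + 1 := fun h1 => by
        rw [← CharP.cast_eq_zero_iff k p] at h1
        push_cast at h1
        refine hrem (L.isRemovableAtInfty_of_coeff_P₁_eq hr hu.2.1 hu0 ?_)
        linear_combination -hαr.1 + hαN - h1
      -- in the remaining case, the degree of `w u^{p-2}` is divisible by `p`, and the exponents at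
      -- infinity differ by `-1`
      refine hsing _ (fun h1 => hreg ⟨1, by omega⟩) (fun h1 => ?_) hreg
      have h2 := congrArg (Nat.cast (R := k)) h1
      push_cast [CharP.cast_eq_zero k p] at h2
      refine hrem (L.isRemovableAtInfty_of_natDegree_derivative_le hp2 hr hu.2.1 hu0 ?_ hw0 hwode
        (natDegree_derivative_add_three_le hHdeg ?_))
      · linear_combination -hαr.1 + hαN - h2
      · rw [hTdeg, hNinf, h1]
        omega
    · have hGK := congrArg (algebraMap (RatFunc k) 𝒟.K) hGR
      rw [hz, div_pow, hz₁, div_eq_iff (pow_ne_zero _ (mul_ne_zero hεK hRK)), hGK, hεK',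
        ← mul_pow, ← map_mul _ (RatFunc.C ε) R, map_mul, mul_comm]
      congr 1
      exact map_pow _ _ _
    · rw [eq_top_iff, ← hgen, IntermediateField.adjoin_simple_le_iff]
      have h1 : z₁ = algebraMap (RatFunc k) 𝒟.K (RatFunc.C ε) * z
          * algebraMap (RatFunc k) 𝒟.K R := by rw [← hεK', ← hz₁z]
      rw [h1]
      exact mul_mem (mul_mem (IntermediateField.algebraMap_mem _ _)
        (IntermediateField.mem_adjoin_simple_self (RatFunc k) z))
        (IntermediateField.algebraMap_mem _ _)
    · intro c hcx
      obtain ⟨a', b', hab, hne⟩ := exists_prod_zpow_linFactor (x := x)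
        fun i => (h.rootMultiplicity (x i) : ℤ) + 1 - (ν (x i : k) : ℤ)
      rw [← hg] at hab
      obtain ⟨ha', hb'⟩ := hne c hcx
      have h1 : (Q * ι u ^ 2)⁻¹ = ((g * ι u)⁻¹) ^ p * ι (w * u ^ (p - 2)) := by
        have hQ' : Q = g ^ p / ι w := by rw [eq_div_iff hwR, hQw]
        rw [hQ', inv_pow, mul_pow, hup, map_mul, map_pow]
        field_simp
      have h2 : ((g * ι u)⁻¹ * ι u * ι h) ^ p = ι ((h * b') ^ p) / ι (a' ^ p) := by
        have ha0 : ι a' ≠ 0 := algebraMap_ratFunc_ne_zero fun h => ha' (by rw [h, eval_zero])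
        have hb0 : ι b' ≠ 0 := algebraMap_ratFunc_ne_zero fun h => hb' (by rw [h, eval_zero])
        rw [map_pow, map_pow, ← div_pow, hab, map_mul]
        congr 1
        field_simp
      rw [h1, iterate_ratDeriv_pow_mul hT, h2, vanishesAt_div_iff _ (by
        rw [eval_pow]
        exact pow_ne_zero _ ha'), eval_pow, pow_eq_zero_iff hp.ne_zero, eval_mul, mul_eq_zero,
        or_iff_left hb', hB, and_iff_left hcx]
    · have h1 := ratDeriv_pow_char (p := p) g
      rw [← hQw, ratDeriv_mul, ratDeriv_algebraMap] at h1
      have h2 : ι L.P₀ * ι (derivative w) + ι L.P₁ * ι w = 0 := by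
        rw [← map_mul, ← map_mul, ← map_add, hwode, map_zero]
      rw [FuchsianOperator.p₁, div_eq_div_iff L.algebraMap_P₀_ne_zero hQ0]
      apply mul_left_cancel₀ hwR
      linear_combination Q * h2 - ι L.P₀ * h1
    · rw [← hαr.2, add_sub_assoc, ← neg_sub (ν OnePoint.infty : k), hak, hNi, hαN]
      ring
  · intro i
    rw [hak, hN]
    have h1 := congrArg (Nat.cast (R := k)) (hNx i)
    push_cast [Nat.cast_sub hp.one_le, CharP.cast_eq_zero k p] at h1
    linear_combination h1
  · rw [hak, hNi, hαN]

end Datum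

end Fuchs

end

theorem proposition2p3 (p : ℕ) [Fact p.Prime] (hp : p ≠ 2) (k : Type u) [Field k]
    [IsAlgClosed k] [CharP k p] (r : ℕ) (hr : 3 ≤ r)
    (x : Fin (r - 1) → k) (hx : Function.Injective x)
    (L : Fuchs.FuchsianOperator x) (α : Fin (r - 1) → k) (αr : k) (u : k[X])
    (hnil : L.NilpotentPCurvature) (hnonzero : L.NonzeroPCurvature p)
    (hnorm : L.IsNormalized) (hu : L.IsMinimalSolution u)
    (hα : ∀ i, L.HasLocalExponentsAt i (α i) 0)
    (hαr : L.HasLocalExponentsAtInfty (-(u.natDegree : k)) (-(u.natDegree : k) + αr)) :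
    ∃ (𝒟 : Fuchs.DeformationDatum p k) (σ : OnePoint k → ℚ) (a ν : OnePoint k → ℕ)
      (B : Finset k) (z : 𝒟.K) (ε : k),
      Fuchs.IsAttachedTo L u 𝒟 σ a ν B z ε ∧
      (∀ i, α i = (ν (x i : k) : k) - (a (x i : k) : k)) ∧
      αr = (ν OnePoint.infty : k) - (a OnePoint.infty : k) := by
  have h3 := L.P₃_eq_zero hr hx hα
  obtain ⟨-, v, hv0, hv⟩ := hnil
  choose m hmlt hm using L.exists_residues p hv0 hv
  have hux : ∀ i, u.eval (x i) ≠ 0 := hnorm u hu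
  have hu0 := hu.1.ne_zero
  have hP₀ : ∀ c, u.eval c = 0 → L.P₀.eval c ≠ 0 := by
    intro c hc h
    obtain ⟨i, rfl⟩ := (L.eval_P₀_eq_zero_iff c).1 h
    exact hux i hc
  have hsimple : ∀ c, u.rootMultiplicity c ≤ 1 := by
    intro c
    by_cases hc : u.eval c = 0
    · exact hu.rootMultiplicity_le_one (p := p) h3 (hP₀ c hc)
    · rw [rootMultiplicity_eq_zero hc]
      exact zero_le_one
  have hw := L.wronskian_singProd hr hx hm
  have hw0 := (Fuchs.FuchsianOperator.monic_singProd (x := x) m).ne_zero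
  obtain ⟨h, hT⟩ := Fuchs.exists_iterate_derivative_eq hp ((L.apply_eq_zero_iff h3 u).1 hu.2.1) hw
    hP₀ hu0 hsimple
  have h0 : h ≠ 0 := by
    rintro rfl
    apply L.iterate_derivative_ne_zero hp hnonzero h3 hu0 hu.2.1 hw0 hw
    rw [hT, zero_pow (Fact.out : p.Prime).ne_zero, mul_zero]
  obtain ⟨𝒟, σ, a, ν, B, z, ε, h1, h2, h4⟩ :=
    Fuchs.exists_isAttachedTo hp hr hx hu h3 hαr hux hmlt hm h0 hsimple hT
  refine ⟨𝒟, σ, a, ν, B, z, ε, h1, fun i => ?_, h4⟩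
  rw [← h2 i]
  have h5 := (hα i).1
  rw [hm i, neg_div, mul_div_cancel_right₀ _ (L.eval_derivative_P₀_ne_zero hx i)] at h5
  linear_combination h5
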